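/- Let $c>0$, $\alpha\in[0,\pi)$, and let $p,q:[c,\infty)\to\mathbb R$ be such that $p>0$ and $1/p$, $q$ are integrable on every compact subinterval of $[c,\infty)$. Put $Lx=-(px')'+qx$; a solution of $Lx=lx$ ($l\in\mathbb C$) is a complex function $x$ such that $x$ and $px'$ are locally absolutely continuous and the equation holds almost everywhere. Assume that $L$ is in the limit-point case at infinity, i.e. there is no $l_0\in\mathbb C$ for which all solutions of $Lx=l_0x$ are square integrable near infinity. For $l\in\mathbb C$ let $\varphi(\cdot,l),\psi(\cdot,l)$ be the solutions of $Lx=lx$ on $[c,\infty)$ with $$\varphi(c,l)=\sin\alpha,\quad (p\varphi')(c,l)=-\cos\alpha,\qquad \psi(c,l)=\cos\alpha,\quad (p\psi')(c,l)=\sin\alpha .$$ For $\operatorname{Im} l\neq0$ and $b>c$ let $C_b(l)$ be the circle of all $m\in\mathbb C$ such that $\chi=\varphi+m\psi$ satisfies $[\chi\chi](b)=0$, where $[fg]=p\,(f\overline{g}'-f'\overline g)$. For $b>c$ and $\beta\in[0,\pi)$ consider the self-adjoint problem $$Lx=lx\ \text{ on }[c,b],\qquad \sin\alpha\,x(c)-\cos\alpha\,(px')(c)=0,\qquad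 \cos\beta\,x(b)+\sin\beta\,(px')(b)=0 .$$ Its eigenvalues $\lambda^{(b)}_n$ are real, only finitely many lie in any bounded interval, and its normalized eigenfunctions in $L^2(c,b)$ are $t^{(b)}_n\psi(\cdot,\lambda^{(b)}_n)$, so that $|t_n^{(b)}|^2=\bigl(\int_c^b|\psi(r,\lambda_n^{(b)})|^2dr\bigr)^{-1}$. Its spectral function $\rho^{(b)}$ is the right-continuous nondecreasing step function with $\rho^{(b)}(0)=0$ whose jumps are exactly $|t^{(b)}_n|^2$ at $\lambda^{(b)}_n$. **Theorem.** For each $l$ with $\operatorname{Im} l\ne0$, the circles $C_b(l)$ shrink to a point $m_\infty(l)$ as $b\to\infty$, and there is a nondecreasing function $\rho:\mathbb R\to\mathbb R$ such that: 1. for every choice of angles $\beta=\beta(b)\in[0,\pi)$ and all points of continuity $\lambda,\mu$ of $\rho$, $$\rho(\lambda)-\rho(\mu)=\lim_{b\to\infty}\bigl(\rho^{(b)}(\lambda)-\rho^{(b)}(\mu)\bigr);$$ 2. $\rho$ is essentially unique: if $\sigma:\mathbb R\to\mathbb R$ is nondecreasing and, for some choice of angles $\beta(b)\in[0,\pi)$,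 satisfies the formula in 1 (with $\sigma$ in place of $\rho$) at all its points of continuity, then there is a constant $C$ with $\sigma=\rho+C$ at every point of continuity of $\rho$; 3. for all $\lambda,\mu\in\mathbb R$, $$\rho(\lambda)-\rho(\mu)=\lim_{\varepsilon\to0^+}\frac1\pi\int_\mu^\lambda \operatorname{Im} m_\infty(\nu+i\varepsilon)\,d\nu ,$$ where for every $\varepsilon>0$ the integrand is integrable on bounded intervals. -/

import Mathlib

open MeasureTheory Set Filter Topology

namespace WeylTheory

/-- `x` solves `-(p x')' + q x = l x` on the interval `s` with left endpoint `c`, and `y` is its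
quasi-derivative `p x'`. This is the first-order system `x' = y / p`, `y' = (q - l) x` in
Carathéodory form: `x` and `y` are locally absolutely continuous and the two differential equations
hold almost everywhere, that is, `x` and `y` are continuous and are the indefinite integrals
of `y / p` and `(q - l) x`. -/
def IsSolutionOn (p q : ℝ → ℝ) (c : ℝ) (s : Set ℝ) (l : ℂ) (x y : ℝ → ℂ) : Prop :=
  ContinuousOn x s ∧ ContinuousOn y s ∧
    ∀ r ∈ s, x r = x c + ∫ t in c..r, y t / (p t : ℂ) ∧
      y r = y c + ∫ t in c..r, ((q t : ℂ) - l) * x t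

/-- The limit-circle case at infinity: for some complex `l₀`, every solution of `L x = l₀ x` is
square integrable near infinity. -/
def LimitCircleAtInfinity (p q : ℝ → ℝ) (c : ℝ) : Prop :=
  ∃ l₀ : ℂ, ∀ x y : ℝ → ℂ, IsSolutionOn p q c (Ici c) l₀ x y →
    ∃ R ≥ c, IntegrableOn (fun r => ‖x r‖ ^ 2) (Ioi R)

/-- The limit-point case at infinity. -/
def LimitPointAtInfinity (p q : ℝ → ℝ) (c : ℝ) : Prop :=
  ¬ LimitCircleAtInfinity p q c

/-- The solution of `L x = l x` on `[c, ∞)` with `x c = u` and `(p x') c = v`, as the pair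
`(x, p x')`. If `1 / p` and `q` are integrable on the compact subintervals of `[c, ∞)`, it exists
and is unique there; its values to the left of `c` are never used. -/
noncomputable def cauchySolution (p q : ℝ → ℝ) (c : ℝ) (l u v : ℂ) : (ℝ → ℂ) × (ℝ → ℂ) :=
  Classical.epsilon fun z => IsSolutionOn p q c (Ici c) l z.1 z.2 ∧ z.1 c = u ∧ z.2 c = v

/-- The pair `(φ, p φ')` with `φ c = sin α`, `(p φ') c = - cos α`. -/
noncomputable def phi (p q : ℝ → ℝ) (c α : ℝ) (l : ℂ) : (ℝ → ℂ) × (ℝ → ℂ) :=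
  cauchySolution p q c l (Real.sin α : ℂ) (-(Real.cos α : ℂ))

/-- The pair `(ψ, p ψ')` with `ψ c = cos α`, `(p ψ') c = sin α`. -/
noncomputable def psi (p q : ℝ → ℝ) (c α : ℝ) (l : ℂ) : (ℝ → ℂ) × (ℝ → ℂ) :=
  cauchySolution p q c l (Real.cos α : ℂ) (Real.sin α : ℂ)

/-- The bracket `[f g] = p (f (conj g)' - f' conj g)` of two functions given as pairs
`f = (f, p f')` and `g = (g, p g')`. -/
noncomputable def bracket (f g : (ℝ → ℂ) × (ℝ → ℂ)) (r : ℝ) : ℂ :=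
  f.1 r * (starRingEnd ℂ) (g.2 r) - f.2 r * (starRingEnd ℂ) (g.1 r)

/-- The circle `C_b` in the `m`-plane: with `χ = φ + m ψ`, its equation is `[χ χ](b) = 0`. -/
def weylCircle (p q : ℝ → ℝ) (c α : ℝ) (l : ℂ) (b : ℝ) : Set ℂ :=
  {m | bracket (phi p q c α l + m • psi p q c α l) (phi p q c α l + m • psi p q c α l) b = 0}

/-- `m` is the limit point at infinity for the given `l`: the nonempty sets `C_b` shrink to `m`
as `b → ∞`. -/
def IsWeylLimitPoint (p q : ℝ → ℝ) (c α : ℝ) (l m : ℂ) : Prop :=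
  (∀ b > c, (weylCircle p q c α l b).Nonempty) ∧
    Tendsto (weylCircle p q c α l) atTop (𝓝 m).smallSets

/-- The eigenvalues of the self-adjoint problem `L x = l x` on `[c, b]` with the boundary conditions
`sin α x(c) - cos α (p x')(c) = 0` and `cos β x(b) + sin β (p x')(b) = 0`. -/
def eigenvalues (p q : ℝ → ℝ) (c α b β : ℝ) : Set ℝ :=
  {t | ∃ x y : ℝ → ℂ, IsSolutionOn p q c (Icc c b) (t : ℂ) x y ∧ (∃ r ∈ Icc c b, x r ≠ 0) ∧
    (Real.sin α : ℂ) * x c - (Real.cos α : ℂ) * y c = 0 ∧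
    (Real.cos β : ℂ) * x b + (Real.sin β : ℂ) * y b = 0}

/-- The jump `|τ|²` at an eigenvalue `t`, where `τ ψ(·, t)` is the eigenfunction of unit norm in
`L²(c, b)`; so `|τ|² = 1 / ∫_c^b |ψ(r, t)|² dr`. -/
noncomputable def jump (p q : ℝ → ℝ) (c α b t : ℝ) : ℝ :=
  (∫ r in c..b, ‖(psi p q c α (t : ℂ)).1 r‖ ^ 2)⁻¹

/-- The spectral function `ρ^(b)` of the problem on `[c, b]`: the right-continuous step function
that vanishes at `0` and jumps by `|τ|²` at each eigenvalue. (A bounded interval contains only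
finitely many eigenvalues, so that the sums are finite.) -/
noncomputable def spectralFunction (p q : ℝ → ℝ) (c α b β s : ℝ) : ℝ :=
  (∑' t : ↥(eigenvalues p q c α b β ∩ Ioc 0 s), jump p q c α b t) -
    ∑' t : ↥(eigenvalues p q c α b β ∩ Ioc s 0), jump p q c α b t

/-- `ρ s - ρ t = lim_{b → ∞} (ρ^(b) s - ρ^(b) t)` at all continuity points `s, t` of `ρ`, where
the boundary condition at `b` has the angle `β b`. -/
def IsLimitOfSpectralFunctions (p q : ℝ → ℝ) (c α : ℝ) (β : ℝ → ℝ) (ρ : ℝ → ℝ) : Prop :=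
  ∀ s t : ℝ, ContinuousAt ρ s → ContinuousAt ρ t →
    Tendsto (fun b => spectralFunction p q c α b (β b) s - spectralFunction p q c α b (β b) t)
      atTop (𝓝 (ρ s - ρ t))

end WeylTheory

/-!
The theorem is proved through the Weyl functions `weylM` of the finite intervals. For a boundary
angle `β` at `b`, the function `m_{b,β} = -(cos β φ + sin β p φ') / (cos β ψ + sin β p ψ')`, taken
at `b`, has two features. For nonreal `l` its value lies on the circle `C_b(l)`
(`weylM_mem_weylCircle`), and across the real line it is meromorphic with simple poles at the
eigenvalues, where its principal parts are `w / (t - l)` with `w` the jump of the spectral function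
(`hasRealPoles_weylM`); the latter follows from Green's formula, which evaluates the derivative of
the denominator at its zeros.

*Limit point.* By Green's formula, `C_b(l)` bounds the disc `∫_c^b |φ + m ψ|² ≤ Im m / Im l`. These
discs are compact and decrease with `b`. If `m`, `m'` lie in the disc of `b`, then
`|m - m'|² ∫_c^b |ψ|²` is bounded independently of `b`; hence the discs shrink to a point unless
`ψ` is square integrable, and in that case so is every solution (`exists_isWeylLimitPoint`).

*Convergence of the spectral functions.* The discs give `|m_{b,β}(l)| |Im l| ≤ C` for `|l| ≤ R`,
uniformly in `b` and `β`. On the circle `|z| = R` one has `|R² - z²| = 2 R |Im z|`, so that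
`(R² - z²) m_{b,β}(z)` is bounded there, and by dominated convergence its contour integrals against
powers of `z` converge. By the residue theorem these are the moments of the jumps with the weight
`R² - t²` on `[-R, R]` (`HasRealPoles.circleIntegral_eq`). The Weierstrass approximation theorem and
the Riesz–Markov–Kakutani theorem then yield the vague limit `μ` of the pole measures
(`IsPoleFamily.exists_measure`). All limits are taken along the filter of the pairs `(b, β)` with
`b → ∞` and arbitrary `β`, which makes them uniform in `β`; so one `μ` serves every choice of
angles. The function `ρ` is the distribution function of `μ`, with the mean of its one-sided limits
at the atoms (`distMid`).

*Inversion formula.* After subtraction of the poles near `[-r, r]`, the remainder `K` of `m_{b,β}` is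
analytic, and real on the real line. The maximum principle, again for `(r² - z²) K(z)`, bounds
it uniformly, so `Im K(ν + i ε) = O(ε)`. Hence `Im m_∞(ν + i ε)` is the Poisson integral of `μ` up to
`O(ε)`, and integration in `ν` turns the Poisson kernel into a difference of arc tangents, which
converges to `π` times the increment of `ρ` at all points (`IsPoleFamily.tendsto_integral_im`).

*Uniqueness.* Two monotone functions with the same increments between common continuity points, which
are dense, differ by a constant where the first is continuous (`exists_const_of_increments_eq`).
-/

namespace WeylTheory

/-! ### Indefinite integrals and Volterra operators -/

/-- Integration by parts for two indefinite integrals, in the form of the product rule. -/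
lemma integral_mul_primitive_add {𝕜 : Type*} [RCLike 𝕜] {a b : ℝ} (hab : a ≤ b) {f g : ℝ → 𝕜}
    (hf : IntervalIntegrable f volume a b) (hg : IntervalIntegrable g volume a b) :
    (∫ t in a..b, (f t * (∫ s in a..t, g s) + (∫ s in a..t, f s) * g t)) =
      (∫ t in a..b, f t) * ∫ t in a..b, g t := by
  have hf' : Integrable f (volume.restrict (Ioc a b)) := by
    rwa [intervalIntegrable_iff_integrableOn_Ioc_of_le hab] at hf
  have hg' : Integrable g (volume.restrict (Ioc a b)) := by
    rwa [intervalIntegrable_iff_integrableOn_Ioc_of_le hab] at hg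
  set ν := volume.restrict (Ioc a b) with hν
  have hprod := hf'.mul_prod hg'
  have e1 : ∀ (h : ℝ → 𝕜) (t : ℝ), t ∈ Ioc a b →
      (∫ s in a..t, h s) = ∫ s, (Iic t).indicator h s ∂ν := by
    intro h t ht
    rw [intervalIntegral.integral_of_le ht.1.le, hν, integral_indicator measurableSet_Iic,
      Measure.restrict_restrict measurableSet_Iic]
    congr 2
    ext s; simp only [mem_Ioc, mem_inter_iff, mem_Iic]; constructor
    · rintro ⟨h1, h2⟩; exact ⟨h2, h1, h2.trans ht.2⟩
    · rintro ⟨h1, h2, h3⟩; exact ⟨h2, h1⟩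
  have meas1 : MeasurableSet {z : ℝ × ℝ | z.2 ≤ z.1} :=
    measurableSet_le measurable_snd measurable_fst
  have i1 : Integrable (Function.uncurry fun t s => f t * (Iic t).indicator g s) (ν.prod ν) := by
    refine (hprod.indicator meas1).congr (Eventually.of_forall fun z => ?_)
    by_cases h : z.2 ≤ z.1 <;> simp [Function.uncurry, indicator, h]
  have i2 : Integrable (Function.uncurry fun t s => f s * (Iic t).indicator (fun _ => g t) s)
      (ν.prod ν) := by
    have h2 : Integrable (fun z : ℝ × ℝ => f z.2 * g z.1) (ν.prod ν) := hprod.swap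
    refine (h2.indicator meas1).congr (Eventually.of_forall fun z => ?_)
    by_cases h : z.2 ≤ z.1 <;> simp [Function.uncurry, indicator, h]
  -- Fubini on the triangle `s ≤ t`
  have e2 : (∫ t, (∫ s, (Iic t).indicator f s ∂ν) * g t ∂ν) =
      ∫ s, f s * (∫ t, (Ici s).indicator g t ∂ν) ∂ν := by
    have := integral_integral_swap i2
    calc _ = ∫ t, ∫ s, f s * (Iic t).indicator (fun _ => g t) s ∂ν ∂ν := by
          refine integral_congr_ae (Eventually.of_forall fun t => ?_)
          simp only
          rw [← integral_mul_const]
          refine integral_congr_ae (Eventually.of_forall fun s => ?_)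
          by_cases h : s ≤ t <;> simp [indicator, h]
      _ = _ := this
      _ = _ := by
          refine integral_congr_ae (Eventually.of_forall fun s => ?_)
          simp only
          rw [← integral_const_mul]
          refine integral_congr_ae (Eventually.of_forall fun t => ?_)
          by_cases h : s ≤ t <;> simp [indicator, h]
  have j1 : Integrable (fun t => f t * ∫ s, (Iic t).indicator g s ∂ν) ν :=
    i1.integral_prod_left.congr (Eventually.of_forall fun t => by
      simp only [Function.uncurry]; rw [integral_const_mul])
  have j2 : Integrable (fun t => (∫ s, (Iic t).indicator f s ∂ν) * g t) ν :=
    i2.integral_prod_left.congr (Eventually.of_forall fun t => by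
      simp only [Function.uncurry]; rw [← integral_mul_const]
      refine integral_congr_ae (Eventually.of_forall fun s => ?_)
      by_cases h : s ≤ t <;> simp [indicator, h])
  have j3 : Integrable (fun s => f s * (∫ t, (Ici s).indicator g t ∂ν)) ν := by
    have := i2.integral_prod_right
    refine this.congr (Eventually.of_forall fun t => ?_)
    simp only [Function.uncurry]; rw [← integral_const_mul]
    refine integral_congr_ae (Eventually.of_forall fun s => ?_)
    by_cases h : t ≤ s <;> simp [indicator, h]
  rw [intervalIntegral.integral_of_le hab, intervalIntegral.integral_of_le hab,
    intervalIntegral.integral_of_le hab]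
  calc _ = ∫ t, (f t * (∫ s, (Iic t).indicator g s ∂ν) +
        (∫ s, (Iic t).indicator f s ∂ν) * g t) ∂ν := by
        refine setIntegral_congr_fun measurableSet_Ioc fun t ht => ?_
        simp only [e1 f t ht, e1 g t ht]
    _ = ∫ t, f t * ((∫ s, (Iic t).indicator g s ∂ν) + (∫ s, (Ici t).indicator g s ∂ν)) ∂ν := by
        rw [integral_add j1 j2, e2, ← integral_add j1 j3]
        simp only [mul_add]
    _ = ∫ t, f t * (∫ s, g s ∂ν) ∂ν := by
        refine integral_congr_ae (Eventually.of_forall fun t => ?_)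
        simp only
        rw [← integral_add (hg'.indicator measurableSet_Iic) (hg'.indicator measurableSet_Ici)]
        congr 1
        refine integral_congr_ae ?_
        have : ∀ᵐ s ∂ν, s ≠ t := ae_restrict_of_ae (by simp [ae_iff])
        filter_upwards [this] with s hs
        rcases lt_or_gt_of_ne hs with h | h
        · simp [indicator, h.le, not_le.2 h]
        · simp [indicator, h.le, not_le.2 h]
    _ = _ := by rw [integral_mul_const]

/-- The product rule for two absolutely continuous functions, given as indefinite integrals. -/
lemma mul_eq_integral_of_primitives {𝕜 : Type*} [RCLike 𝕜] {a b : ℝ} (hab : a ≤ b)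
    {f g F G : ℝ → 𝕜}
    (hf : IntervalIntegrable f volume a b) (hg : IntervalIntegrable g volume a b)
    (hF : ∀ t ∈ Icc a b, F t = F a + ∫ s in a..t, f s)
    (hG : ∀ t ∈ Icc a b, G t = G a + ∫ s in a..t, g s) :
    F b * G b = F a * G a + ∫ t in a..b, (f t * G t + F t * g t) := by
  have key := integral_mul_primitive_add hab hf hg
  have hIf : ContinuousOn (fun t => ∫ s in a..t, f s) (uIcc a b) :=
    intervalIntegral.continuousOn_primitive_interval' hf left_mem_uIcc
  have hIg : ContinuousOn (fun t => ∫ s in a..t, g s) (uIcc a b) :=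
    intervalIntegral.continuousOn_primitive_interval' hg left_mem_uIcc
  have e : (∫ t in a..b, (f t * G t + F t * g t)) =
      ∫ t in a..b, ((f t * G a + F a * g t) +
        (f t * (∫ s in a..t, g s) + (∫ s in a..t, f s) * g t)) := by
    refine intervalIntegral.integral_congr fun t ht => ?_
    rw [uIcc_of_le hab] at ht
    rw [hF t ht, hG t ht]; ring
  rw [e, intervalIntegral.integral_add, key, intervalIntegral.integral_add,
    intervalIntegral.integral_mul_const, intervalIntegral.integral_const_mul,
    hF b (right_mem_Icc.2 hab), hG b (right_mem_Icc.2 hab)]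
  · ring
  · exact hf.mul_const _
  · exact hg.const_mul _
  · exact (hf.mul_const _).add (hg.const_mul _)
  · exact (hf.mul_continuousOn hIg).add (hg.continuousOn_mul hIf)

/-- `∫ G' G ^ n = G ^ (n + 1) / (n + 1)` for an indefinite integral `G`. As `G`
need not be differentiable, this is derived from the product rule by induction. -/
lemma integral_mul_primitive_pow {a b : ℝ} {g : ℝ → ℝ} (hg : IntervalIntegrable g volume a b)
    (n : ℕ) {r : ℝ} (hr : r ∈ Icc a b) :
    (∫ t in a..r, g t * (∫ s in a..t, g s) ^ n) = (∫ s in a..r, g s) ^ (n + 1) / (n + 1) := by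
  have hI : ContinuousOn (fun t => ∫ s in a..t, g s) (uIcc a b) :=
    intervalIntegral.continuousOn_primitive_interval' hg left_mem_uIcc
  have hab : a ≤ b := hr.1.trans hr.2
  induction n generalizing r with
  | zero => simp
  | succ n ih =>
    have hgr : IntervalIntegrable g volume a r :=
      hg.mono_set (by rw [uIcc_of_le hab, uIcc_of_le hr.1]; exact Icc_subset_Icc le_rfl hr.2)
    have hIr : ContinuousOn (fun t => ∫ s in a..t, g s) (uIcc a r) :=
      hI.mono (by rw [uIcc_of_le hab, uIcc_of_le hr.1]; exact Icc_subset_Icc le_rfl hr.2)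
    have hpow : IntervalIntegrable (fun t => (n + 1) * (g t * (∫ s in a..t, g s) ^ n)) volume a r :=
      (hgr.mul_continuousOn (hIr.pow n)).const_mul _
    have := mul_eq_integral_of_primitives hr.1 (F := fun t => ∫ s in a..t, g s)
      (G := fun t => (∫ s in a..t, g s) ^ (n + 1)) hgr hpow (fun t _ => by simp)
      (fun t ht => by
        simp only [intervalIntegral.integral_const_mul]
        rw [ih ⟨ht.1, ht.2.trans hr.2⟩]
        have : (n + 1 : ℝ) ≠ 0 := by positivity
        simp
        field_simp)
    have e : (∫ t in a..r, (g t * (∫ s in a..t, g s) ^ (n + 1) +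
        (∫ s in a..t, g s) * ((n + 1) * (g t * (∫ s in a..t, g s) ^ n)))) =
        ∫ t in a..r, (n + 2) * (g t * (∫ s in a..t, g s) ^ (n + 1)) := by
      refine intervalIntegral.integral_congr fun t _ => ?_
      ring
    rw [e, intervalIntegral.integral_const_mul] at this
    simp at this
    have h2 : (n + 2 : ℝ) ≠ 0 := by positivity
    push_cast
    rw [show (n + 1 + 1 : ℝ) = n + 2 by ring, eq_div_iff h2, mul_comm, ← this]
    ring

lemma continuous_volterra {c b : ℝ} (hcb : c ≤ b) {k : ℝ → ℂ}
    (hk : IntervalIntegrable k volume c b) (u : C(Icc c b, ℂ)) :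
    Continuous fun r : Icc c b => ∫ t in c..(r : ℝ), k t * IccExtend hcb u t := by
  have h1 : IntervalIntegrable (fun t => k t * IccExtend hcb u t) volume c b :=
    hk.mul_continuousOn u.continuous.Icc_extend'.continuousOn
  have h2 := intervalIntegral.continuousOn_primitive_interval' h1 left_mem_uIcc
  rw [uIcc_of_le hcb] at h2
  exact continuousOn_iff_continuous_domRestrict.1 h2

/-- The Volterra operator `u ↦ (r ↦ ∫_c^r k u)` on the continuous functions on `[c, b]`. -/
noncomputable def volterra {c b : ℝ} (hcb : c ≤ b) (k : ℝ → ℂ)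
    (hk : IntervalIntegrable k volume c b) :
    C(Icc c b, ℂ) →L[ℂ] C(Icc c b, ℂ) :=
  LinearMap.mkContinuous
    { toFun := fun u => ⟨fun r => ∫ t in c..(r : ℝ), k t * IccExtend hcb u t,
        continuous_volterra hcb hk u⟩
      map_add' := fun u v => by
        ext r
        have hs : uIcc c (r : ℝ) ⊆ uIcc c b := by
          rw [uIcc_of_le hcb, uIcc_of_le r.2.1]; exact Icc_subset_Icc le_rfl r.2.2
        have hk' := hk.mono_set hs
        change (∫ t in c..(r : ℝ), k t * IccExtend hcb (u + v : C(Icc c b, ℂ)) t) =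
          (∫ t in c..(r : ℝ), k t * IccExtend hcb u t) + ∫ t in c..(r : ℝ), k t * IccExtend hcb v t
        rw [← intervalIntegral.integral_add
          (hk'.mul_continuousOn u.continuous.Icc_extend'.continuousOn)
          (hk'.mul_continuousOn v.continuous.Icc_extend'.continuousOn)]
        refine intervalIntegral.integral_congr fun t _ => ?_
        simp [IccExtend, mul_add]
      map_smul' := fun a u => by
        ext r
        change (∫ t in c..(r : ℝ), k t * IccExtend hcb (a • u : C(Icc c b, ℂ)) t) =
          a * ∫ t in c..(r : ℝ), k t * IccExtend hcb u t
        rw [← intervalIntegral.integral_const_mul]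
        refine intervalIntegral.integral_congr fun t _ => ?_
        simp [IccExtend]; ring }
    (∫ t in c..b, ‖k t‖) (fun u => by
      have h0 : 0 ≤ ∫ t in c..b, ‖k t‖ :=
        intervalIntegral.integral_nonneg hcb fun _ _ => norm_nonneg _
      rw [ContinuousMap.norm_le _ (by positivity)]
      intro r
      have hs : uIcc c (r : ℝ) ⊆ uIcc c b := by
        rw [uIcc_of_le hcb, uIcc_of_le r.2.1]; exact Icc_subset_Icc le_rfl r.2.2
      calc ‖∫ t in c..(r : ℝ), k t * IccExtend hcb u t‖
          ≤ ∫ t in c..(r : ℝ), ‖k t‖ * ‖u‖ := by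
            refine intervalIntegral.norm_integral_le_of_norm_le r.2.1
              (Eventually.of_forall fun t _ => ?_) ((hk.mono_set hs).norm.mul_const _)
            rw [norm_mul]
            gcongr
            exact u.norm_coe_le_norm _
        _ = (∫ t in c..(r : ℝ), ‖k t‖) * ‖u‖ := by rw [intervalIntegral.integral_mul_const]
        _ ≤ _ := by
            gcongr
            exact intervalIntegral.integral_mono_interval le_rfl r.2.1 r.2.2
              (Eventually.of_forall fun _ => norm_nonneg _) hk.norm)

lemma volterra_apply {c b : ℝ} (hcb : c ≤ b) {k : ℝ → ℂ} (hk : IntervalIntegrable k volume c b)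
    (u : C(Icc c b, ℂ)) (r : Icc c b) :
    volterra hcb k hk u r = ∫ t in c..(r : ℝ), k t * IccExtend hcb u t := rfl

/-- The integral operator `(x, y) ↦ (∫_c k₁ y, ∫_c k₂ x)` of the first-order system
`x' = k₁ y`, `y' = k₂ x`. -/
noncomputable def systemOp {c b : ℝ} (hcb : c ≤ b) (k₁ k₂ : ℝ → ℂ)
    (hk₁ : IntervalIntegrable k₁ volume c b) (hk₂ : IntervalIntegrable k₂ volume c b) :
    (C(Icc c b, ℂ) × C(Icc c b, ℂ)) →L[ℂ] (C(Icc c b, ℂ) × C(Icc c b, ℂ)) :=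
  ((volterra hcb k₁ hk₁).comp (ContinuousLinearMap.snd ℂ _ _)).prod
    ((volterra hcb k₂ hk₂).comp (ContinuousLinearMap.fst ℂ _ _))

/-- One step of the Picard iteration: a bound `G ^ n / n!` on `u`, with `G` the indefinite integral
of `g ≥ ‖k‖`, becomes the bound `G ^ (n + 1) / (n + 1)!` on its image. -/
lemma norm_volterra_apply_le {c b : ℝ} (hcb : c ≤ b) {k : ℝ → ℂ} {g : ℝ → ℝ}
    (hk : IntervalIntegrable k volume c b) (hg : IntervalIntegrable g volume c b)
    (hkg : ∀ t, ‖k t‖ ≤ g t) {n : ℕ} {M : ℝ} {u : C(Icc c b, ℂ)}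
    (hu : ∀ r : Icc c b, ‖u r‖ ≤ (∫ t in c..(r : ℝ), g t) ^ n / n.factorial * M) (r : Icc c b) :
    ‖volterra hcb k hk u r‖ ≤
      (∫ t in c..(r : ℝ), g t) ^ (n + 1) / (n + 1).factorial * M := by
  have hs : uIcc c (r : ℝ) ⊆ uIcc c b := by
    rw [uIcc_of_le hcb, uIcc_of_le r.2.1]; exact Icc_subset_Icc le_rfl r.2.2
  have hI : ContinuousOn (fun t => ∫ s in c..t, g s) (uIcc c b) :=
    intervalIntegral.continuousOn_primitive_interval' hg left_mem_uIcc
  rw [volterra_apply]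
  calc _ ≤ ∫ t in c..(r : ℝ), g t * (∫ s in c..t, g s) ^ n * (M / n.factorial) := by
        refine intervalIntegral.norm_integral_le_of_norm_le r.2.1
          (Eventually.of_forall fun t ht => ?_)
          (((hg.mono_set hs).mul_continuousOn ((hI.mono hs).pow n)).mul_const _)
        have ht' : t ∈ Icc c b := ⟨ht.1.le, ht.2.trans r.2.2⟩
        rw [norm_mul, IccExtend_of_mem hcb _ ht', mul_assoc]
        refine mul_le_mul (hkg t) ((hu ⟨t, ht'⟩).trans (le_of_eq ?_)) (norm_nonneg _)
          ((norm_nonneg _).trans (hkg t))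
        simp only; ring
    _ = _ := by
        rw [intervalIntegral.integral_mul_const, integral_mul_primitive_pow hg n r.2,
          Nat.factorial_succ]
        push_cast
        field_simp

/-- `1 - V` is invertible for the integral operator `V` of a system with integrable coefficients:
`V` is quasi-nilpotent because `‖V ^ n‖ ≤ (∫ g) ^ n / n!`. -/
lemma isUnit_one_sub_systemOp {c b : ℝ} (hcb : c ≤ b) {k₁ k₂ : ℝ → ℂ}
    (hk₁ : IntervalIntegrable k₁ volume c b) (hk₂ : IntervalIntegrable k₂ volume c b) :
    IsUnit (1 - systemOp hcb k₁ k₂ hk₁ hk₂) := by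
  set V := systemOp hcb k₁ k₂ hk₁ hk₂
  set g : ℝ → ℝ := fun t => ‖k₁ t‖ + ‖k₂ t‖
  have hg : IntervalIntegrable g volume c b := hk₁.norm.add hk₂.norm
  have hV : ∀ u, ∀ n, ∀ r, ‖((V ^ n) u).1 r‖ ≤ (∫ t in c..(r : ℝ), g t) ^ n / n.factorial * ‖u‖ ∧
      ‖((V ^ n) u).2 r‖ ≤ (∫ t in c..(r : ℝ), g t) ^ n / n.factorial * ‖u‖ := by
    intro u n
    induction n with
    | zero =>
      intro r
      simp only [pow_zero, Nat.factorial_zero, Nat.cast_one, div_one, one_mul]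
      exact ⟨(u.1.norm_coe_le_norm r).trans (norm_fst_le u),
        (u.2.norm_coe_le_norm r).trans (norm_snd_le u)⟩
    | succ n ih =>
      intro r
      rw [pow_succ']
      exact ⟨norm_volterra_apply_le hcb hk₁ hg (fun t => by simp [g]) (fun r => (ih r).2) r,
        norm_volterra_apply_le hcb hk₂ hg (fun t => by simp [g]) (fun r => (ih r).1) r⟩
  set A := ∫ t in c..b, g t
  have hA : 0 ≤ A := intervalIntegral.integral_nonneg hcb fun _ _ => by positivity
  have hVn : ∀ n, ‖V ^ n‖ ≤ A ^ n / n.factorial := by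
    intro n
    refine ContinuousLinearMap.opNorm_le_bound _ (by positivity) fun u => ?_
    have hle : ∀ r : Icc c b, (∫ t in c..(r : ℝ), g t) ^ n / n.factorial * ‖u‖ ≤
        A ^ n / n.factorial * ‖u‖ := by
      intro r
      gcongr
      · exact intervalIntegral.integral_nonneg r.2.1 fun _ _ => by positivity
      · exact intervalIntegral.integral_mono_interval le_rfl r.2.1 r.2.2
          (Eventually.of_forall fun _ => by simp only [Pi.zero_apply, g]; positivity) hg
    rw [Prod.norm_def, max_le_iff]
    constructor
    · rw [ContinuousMap.norm_le _ (by positivity)]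
      exact fun r => (hV u n r).1.trans (hle r)
    · rw [ContinuousMap.norm_le _ (by positivity)]
      exact fun r => (hV u n r).2.trans (hle r)
  obtain ⟨n, hn⟩ := ((FloorSemiring.tendsto_pow_div_factorial_atTop A).eventually
    (gt_mem_nhds one_pos)).exists
  have hunit : IsUnit (1 - V ^ n) :=
    (Units.oneSub (V ^ n) ((hVn n).trans_lt hn)).isUnit
  have e₁ : (1 - V) * (∑ i ∈ Finset.range n, V ^ i) = 1 - V ^ n := mul_neg_geom_sum V n
  have e₂ : (∑ i ∈ Finset.range n, V ^ i) * (1 - V) = 1 - V ^ n := geom_sum_mul_neg V n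
  rw [← e₁] at hunit
  exact ((Commute.isUnit_mul_iff (e₁.trans e₂.symm)).1 hunit).1

end WeylTheory

namespace WeylTheory

/-! ### Solutions of the differential equation -/

/-- The standing assumptions on the coefficients: `p > 0`, and `1 / p`, `q` are integrable on the
compact intervals `[c, b]`. -/
structure RegularCoeff (p q : ℝ → ℝ) (c : ℝ) : Prop where
  pos : ∀ r ∈ Ici c, 0 < p r
  inv_p : ∀ b, c ≤ b → IntervalIntegrable (fun t => (p t)⁻¹) volume c b
  int_q : ∀ b, c ≤ b → IntervalIntegrable q volume c b

variable {p q : ℝ → ℝ} {c : ℝ}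

lemma RegularCoeff.intervalIntegrable_inv (h : RegularCoeff p q c) {b : ℝ} (hb : c ≤ b) :
    IntervalIntegrable (fun t => (p t : ℂ)⁻¹) volume c b := by
  have h1 : IntervalIntegrable (fun t => (((p t)⁻¹ : ℝ) : ℂ)) volume c b :=
    ⟨(h.inv_p b hb).1.ofReal, (h.inv_p b hb).2.ofReal⟩
  simpa using h1

lemma RegularCoeff.intervalIntegrable_sub (h : RegularCoeff p q c) {b : ℝ} (hb : c ≤ b) (l : ℂ) :
    IntervalIntegrable (fun t => (q t : ℂ) - l) volume c b :=
  IntervalIntegrable.sub ⟨(h.int_q b hb).1.ofReal, (h.int_q b hb).2.ofReal⟩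
    intervalIntegrable_const

/-- The integral operator on `[c, b]` of the first-order system for `L x = l x`. -/
noncomputable def RegularCoeff.op (h : RegularCoeff p q c) {b : ℝ} (hb : c ≤ b) (l : ℂ) :
    (C(Icc c b, ℂ) × C(Icc c b, ℂ)) →L[ℂ] (C(Icc c b, ℂ) × C(Icc c b, ℂ)) :=
  systemOp hb _ _ (h.intervalIntegrable_inv hb) (h.intervalIntegrable_sub hb l)

lemma RegularCoeff.op_eq (h : RegularCoeff p q c) {b : ℝ} (hb : c ≤ b) (l : ℂ) :
    h.op hb l = h.op hb 0 -
      l • systemOp hb (fun _ => 0) (fun _ => 1) intervalIntegrable_const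
        intervalIntegrable_const := by
  refine ContinuousLinearMap.ext fun u =>
    Prod.ext (ContinuousMap.ext fun r => ?_) (ContinuousMap.ext fun r => ?_)
  · change (∫ t in c..(r : ℝ), (p t : ℂ)⁻¹ * IccExtend hb u.2 t) =
      (∫ t in c..(r : ℝ), (p t : ℂ)⁻¹ * IccExtend hb u.2 t) -
        l * ∫ t in c..(r : ℝ), 0 * IccExtend hb u.2 t
    simp
  · change (∫ t in c..(r : ℝ), ((q t : ℂ) - l) * IccExtend hb u.1 t) =
      (∫ t in c..(r : ℝ), ((q t : ℂ) - 0) * IccExtend hb u.1 t) -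
        l * ∫ t in c..(r : ℝ), 1 * IccExtend hb u.1 t
    have hc : ∀ s, ContinuousOn (IccExtend hb u.1) s :=
      fun s => u.1.continuous.Icc_extend'.continuousOn
    rw [← intervalIntegral.integral_const_mul, ← intervalIntegral.integral_sub]
    · refine intervalIntegral.integral_congr fun t _ => ?_
      ring
    · exact (h.intervalIntegrable_sub r.2.1 0).mul_continuousOn (hc _)
    · exact (intervalIntegrable_const.mul_continuousOn (hc _)).const_mul _

/-- The inverse of `1 - V`, for the integral operator `V` on `[c, b]` of `L x = l x`. It maps a pair
of constants to the solution with these initial values. -/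
noncomputable def RegularCoeff.flow (h : RegularCoeff p q c) {b : ℝ} (hb : c ≤ b) (l : ℂ) :
    (C(Icc c b, ℂ) × C(Icc c b, ℂ)) →L[ℂ] (C(Icc c b, ℂ) × C(Icc c b, ℂ)) :=
  Ring.inverse (1 - h.op hb l)

/-- If `1 - (A - l B)` is invertible for all `l`, then the solution `F l` of
`F l - (A - l B) (F l) = w` is an entire function of `l`. -/
lemma differentiable_of_sub_apply_eq {E : Type*} [NormedAddCommGroup E] [NormedSpace ℂ E]
    [CompleteSpace E] (A B : E →L[ℂ] E) (hu : ∀ l : ℂ, IsUnit (1 - (A - l • B))) (w : E)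
    (F : ℂ → E) (hF : ∀ l, F l - (A - l • B) (F l) = w) : Differentiable ℂ F := by
  have e : F = fun l => (Ring.inverse (1 - (A - l • B)) : E →L[ℂ] E) w := by
    funext l
    have := DFunLike.congr_fun (Ring.inverse_mul_cancel _ (hu l)) (F l)
    have h2 : (Ring.inverse (1 - (A - l • B)) : E →L[ℂ] E) (F l - (A - l • B) (F l)) = F l := this
    rw [← hF l, h2]
  rw [e]
  intro l
  have hd : DifferentiableAt ℂ (fun l : ℂ => 1 - (A - l • B)) l :=
    (differentiableAt_const _).sub ((differentiableAt_const _).sub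
      (differentiableAt_fun_id.smul_const B))
  have h2 : DifferentiableAt ℂ (fun l : ℂ => (Ring.inverse (1 - (A - l • B)) : E →L[ℂ] E)) l :=
    DifferentiableAt.inverse (h := fun l : ℂ => 1 - (A - l • B)) hd (hu l)
  exact h2.clm_apply (differentiableAt_const w)

/-- The pair of constant functions given by the initial values. -/
noncomputable def constPair (c b : ℝ) (u v : ℂ) : C(Icc c b, ℂ) × C(Icc c b, ℂ) :=
  (ContinuousMap.const _ u, ContinuousMap.const _ v)

lemma RegularCoeff.flow_eq (h : RegularCoeff p q c) {b : ℝ} (hb : c ≤ b) (l : ℂ)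
    (w : C(Icc c b, ℂ) × C(Icc c b, ℂ)) : h.flow hb l w = w + h.op hb l (h.flow hb l w) := by
  have hu : IsUnit (1 - h.op hb l) := isUnit_one_sub_systemOp hb _ _
  have := DFunLike.congr_fun (Ring.mul_inverse_cancel _ hu) w
  have h2 : h.flow hb l w - h.op hb l (h.flow hb l w) = w := this
  exact sub_eq_iff_eq_add.1 h2

lemma RegularCoeff.eq_flow (h : RegularCoeff p q c) {b : ℝ} (hb : c ≤ b) (l : ℂ)
    {w z : C(Icc c b, ℂ) × C(Icc c b, ℂ)} (hz : z = w + h.op hb l z) : z = h.flow hb l w := by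
  have hu : IsUnit (1 - h.op hb l) := isUnit_one_sub_systemOp hb _ _
  have := DFunLike.congr_fun (Ring.inverse_mul_cancel _ hu) z
  have h2 : h.flow hb l (z - h.op hb l z) = z := this
  rw [← h2]
  congr 1
  exact sub_eq_iff_eq_add.2 hz

lemma RegularCoeff.differentiable_flow (h : RegularCoeff p q c) {b : ℝ} (hb : c ≤ b)
    (w : C(Icc c b, ℂ) × C(Icc c b, ℂ)) : Differentiable ℂ fun l => h.flow hb l w := by
  set B := systemOp hb (fun _ => 0) (fun _ => 1) intervalIntegrable_const intervalIntegrable_const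
  have e : ∀ l, h.op hb l = h.op hb 0 - l • B := h.op_eq hb
  refine differentiable_of_sub_apply_eq (h.op hb 0) B (fun l => ?_) w _ fun l => ?_
  · rw [← e l]; exact isUnit_one_sub_systemOp hb _ _
  · rw [← e l]; exact sub_eq_iff_eq_add.2 (h.flow_eq hb l w)

/-- Solutions on `[c, b]` are given by the flow. -/
lemma IsSolutionOn.eq_flow (h : RegularCoeff p q c) {b : ℝ} (hb : c ≤ b) {l : ℂ} {x y : ℝ → ℂ}
    (hs : IsSolutionOn p q c (Icc c b) l x y) (r : Icc c b) :
    x r = (h.flow hb l (constPair c b (x c) (y c))).1 r ∧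
      y r = (h.flow hb l (constPair c b (x c) (y c))).2 r := by
  obtain ⟨hx, hy, hxy⟩ := hs
  let X : C(Icc c b, ℂ) := ⟨fun r => x r, continuousOn_iff_continuous_domRestrict.1 hx⟩
  let Y : C(Icc c b, ℂ) := ⟨fun r => y r, continuousOn_iff_continuous_domRestrict.1 hy⟩
  have key : (X, Y) = h.flow hb l (constPair c b (x c) (y c)) := by
    refine h.eq_flow hb l ?_
    ext r
    · change x r = x c + ∫ t in c..(r : ℝ), (p t : ℂ)⁻¹ * IccExtend hb Y t
      rw [(hxy r r.2).1]
      congr 1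
      refine intervalIntegral.integral_congr fun t ht => ?_
      rw [uIcc_of_le r.2.1] at ht
      rw [IccExtend_of_mem hb _ ⟨ht.1, ht.2.trans r.2.2⟩, div_eq_inv_mul]
      rfl
    · change y r = y c + ∫ t in c..(r : ℝ), ((q t : ℂ) - l) * IccExtend hb X t
      rw [(hxy r r.2).2]
      congr 1
      refine intervalIntegral.integral_congr fun t ht => ?_
      rw [uIcc_of_le r.2.1] at ht
      rw [IccExtend_of_mem hb _ ⟨ht.1, ht.2.trans r.2.2⟩]
      rfl
  exact ⟨congrArg (fun z => z.1 r) key, congrArg (fun z => z.2 r) key⟩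

lemma IsSolutionOn.mono {s t : Set ℝ} {l : ℂ} {x y : ℝ → ℂ} (hs : IsSolutionOn p q c s l x y)
    (hts : t ⊆ s) : IsSolutionOn p q c t l x y :=
  ⟨hs.1.mono hts, hs.2.1.mono hts, fun r hr => hs.2.2 r (hts hr)⟩

lemma IsSolutionOn.eqOn (h : RegularCoeff p q c) {b : ℝ} (hb : c ≤ b) {l : ℂ}
    {x y x' y' : ℝ → ℂ} (hs : IsSolutionOn p q c (Icc c b) l x y)
    (hs' : IsSolutionOn p q c (Icc c b) l x' y') (hx : x c = x' c) (hy : y c = y' c) :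
    EqOn x x' (Icc c b) ∧ EqOn y y' (Icc c b) := by
  constructor <;> intro r hr
  · rw [(hs.eq_flow h hb ⟨r, hr⟩).1, (hs'.eq_flow h hb ⟨r, hr⟩).1, hx, hy]
  · rw [(hs.eq_flow h hb ⟨r, hr⟩).2, (hs'.eq_flow h hb ⟨r, hr⟩).2, hx, hy]

lemma RegularCoeff.exists_solution_Icc (h : RegularCoeff p q c) {b : ℝ} (hb : c ≤ b)
    (l u v : ℂ) :
    ∃ x y : ℝ → ℂ, IsSolutionOn p q c (Icc c b) l x y ∧ x c = u ∧ y c = v := by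
  set z := h.flow hb l (constPair c b u v) with hz
  have key := h.flow_eq hb l (constPair c b u v)
  rw [← hz] at key
  have h1 : ∀ r (hr : r ∈ Icc c b), IccExtend hb z.1 r =
      u + ∫ t in c..r, (p t : ℂ)⁻¹ * IccExtend hb z.2 t := by
    intro r hr
    rw [IccExtend_of_mem hb _ hr]
    exact congrArg (fun w => w.1 ⟨r, hr⟩) key
  have h2 : ∀ r (hr : r ∈ Icc c b), IccExtend hb z.2 r =
      v + ∫ t in c..r, ((q t : ℂ) - l) * IccExtend hb z.1 t := by
    intro r hr
    rw [IccExtend_of_mem hb _ hr]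
    exact congrArg (fun w => w.2 ⟨r, hr⟩) key
  have h1c : IccExtend hb z.1 c = u := by rw [h1 c (left_mem_Icc.2 hb)]; simp
  have h2c : IccExtend hb z.2 c = v := by rw [h2 c (left_mem_Icc.2 hb)]; simp
  refine ⟨IccExtend hb z.1, IccExtend hb z.2, ⟨z.1.continuous.Icc_extend'.continuousOn,
    z.2.continuous.Icc_extend'.continuousOn, fun r hr => ⟨?_, ?_⟩⟩, h1c, h2c⟩
  · rw [h1c, h1 r hr]; simp only [div_eq_inv_mul]
  · rw [h2c]; exact h2 r hr

/-- Existence on `[c, ∞)`: the value at `r` is that of the solution on `[c, r]`, since the solutions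
on two intervals `[c, b]` agree where both are defined. -/
lemma RegularCoeff.exists_solution_Ici (h : RegularCoeff p q c) (l u v : ℂ) :
    ∃ z : (ℝ → ℂ) × (ℝ → ℂ), IsSolutionOn p q c (Ici c) l z.1 z.2 ∧ z.1 c = u ∧ z.2 c = v := by
  choose X Y hXY hX hY using fun (b : ℝ) (hb : c ≤ b) => h.exists_solution_Icc hb l u v
  set x : ℝ → ℂ := fun r => if hr : c ≤ r then X r hr r else 0 with hx
  set y : ℝ → ℂ := fun r => if hr : c ≤ r then Y r hr r else 0 with hy
  have hxe : ∀ b (hb : c ≤ b), EqOn x (X b hb) (Icc c b) ∧ EqOn y (Y b hb) (Icc c b) := by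
    intro b hb
    constructor <;> intro r hr <;>
      have := IsSolutionOn.eqOn h hr.1 (hXY r hr.1)
        ((hXY b hb).mono (Icc_subset_Icc le_rfl hr.2)) (by rw [hX, hX]) (by rw [hY, hY])
    · simp only [hx, dif_pos hr.1]; exact this.1 (right_mem_Icc.2 hr.1)
    · simp only [hy, dif_pos hr.1]; exact this.2 (right_mem_Icc.2 hr.1)
  have hnhds : ∀ r ∈ Ici c, Icc c (r + 1) ∈ 𝓝[Ici c] r := by
    intro r _
    rw [← Ici_inter_Iic]
    exact inter_mem self_mem_nhdsWithin (mem_nhdsWithin_of_mem_nhds (Iic_mem_nhds (by linarith)))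
  have hxc : x c = u := by rw [(hxe c le_rfl).1 (left_mem_Icc.2 le_rfl), hX]
  have hyc : y c = v := by rw [(hxe c le_rfl).2 (left_mem_Icc.2 le_rfl), hY]
  refine ⟨(x, y), ⟨fun r hr => ?_, fun r hr => ?_, fun r hr => ?_⟩, hxc, hyc⟩
  · have hr1 : c ≤ r + 1 := le_trans (mem_Ici.1 hr) (by linarith)
    exact (((hXY _ hr1).1.congr (hxe _ hr1).1) r ⟨hr, by linarith⟩).mono_of_mem_nhdsWithin
      (hnhds r hr)
  · have hr1 : c ≤ r + 1 := le_trans (mem_Ici.1 hr) (by linarith)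
    exact (((hXY _ hr1).2.1.congr (hxe _ hr1).2) r ⟨hr, by linarith⟩).mono_of_mem_nhdsWithin
      (hnhds r hr)
  · have hr' : c ≤ r := hr
    obtain ⟨e1, e2⟩ := (hXY r hr').2.2 r (right_mem_Icc.2 hr')
    rw [hX] at e1
    rw [hY] at e2
    simp only [hxc, hyc]
    rw [(hxe r hr').1 (right_mem_Icc.2 hr'), (hxe r hr').2 (right_mem_Icc.2 hr'), e1, e2]
    constructor
    · congr 1
      refine intervalIntegral.integral_congr fun t ht => ?_
      rw [uIcc_of_le hr'] at ht
      simp only [(hxe r hr').2 ht]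
    · congr 1
      refine intervalIntegral.integral_congr fun t ht => ?_
      rw [uIcc_of_le hr'] at ht
      simp only [(hxe r hr').1 ht]

lemma RegularCoeff.cauchySolution_spec (h : RegularCoeff p q c) (l u v : ℂ) :
    IsSolutionOn p q c (Ici c) l (cauchySolution p q c l u v).1 (cauchySolution p q c l u v).2 ∧
      (cauchySolution p q c l u v).1 c = u ∧ (cauchySolution p q c l u v).2 c = v :=
  Classical.epsilon_spec (h.exists_solution_Ici l u v)

lemma RegularCoeff.cauchySolution_isSolutionOn (h : RegularCoeff p q c) (l u v : ℂ) (b : ℝ) :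
    IsSolutionOn p q c (Icc c b) l (cauchySolution p q c l u v).1
      (cauchySolution p q c l u v).2 :=
  (h.cauchySolution_spec l u v).1.mono Icc_subset_Ici_self

lemma RegularCoeff.cauchySolution_eq_flow (h : RegularCoeff p q c) {b : ℝ} (hb : c ≤ b)
    (l u v : ℂ) (r : Icc c b) :
    (cauchySolution p q c l u v).1 r = (h.flow hb l (constPair c b u v)).1 r ∧
      (cauchySolution p q c l u v).2 r = (h.flow hb l (constPair c b u v)).2 r := by
  have := (h.cauchySolution_isSolutionOn l u v b).eq_flow h hb r
  rwa [(h.cauchySolution_spec l u v).2.1, (h.cauchySolution_spec l u v).2.2] at this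

/-- At a fixed point the solution is an entire function of the spectral parameter. -/
lemma RegularCoeff.differentiable_cauchySolution (h : RegularCoeff p q c) {b : ℝ} (hb : c ≤ b)
    (u v : ℂ) :
    Differentiable ℂ (fun l => (cauchySolution p q c l u v).1 b) ∧
      Differentiable ℂ (fun l => (cauchySolution p q c l u v).2 b) := by
  have hd := h.differentiable_flow hb (constPair c b u v)
  have e := fun l => h.cauchySolution_eq_flow hb l u v ⟨b, right_mem_Icc.2 hb⟩
  simp only [fun l => (e l).1, fun l => (e l).2]
  let X := C(Icc c b, ℂ)
  let ev : X →L[ℂ] ℂ := ContinuousMap.evalCLM ℂ ⟨b, right_mem_Icc.2 hb⟩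
  have h1 := (ev.comp (ContinuousLinearMap.fst ℂ X X)).differentiable.comp hd
  have h2 := (ev.comp (ContinuousLinearMap.snd ℂ X X)).differentiable.comp hd
  exact ⟨h1, h2⟩

/-- The flow is continuous in `l` for the uniform norm, whence the norm of the solution in
`L²(c, b)` depends continuously on `l`. -/
lemma RegularCoeff.continuous_integral_normSq (h : RegularCoeff p q c) {b : ℝ} (hb : c ≤ b)
    (u v : ℂ) :
    Continuous fun l => ∫ r in c..b, ‖(cauchySolution p q c l u v).1 r‖ ^ 2 := by
  have hd : Continuous fun l => (h.flow hb l (constPair c b u v)).1 :=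
    continuous_fst.comp (h.differentiable_flow hb (constPair c b u v)).continuous
  have e : ∀ l, (∫ r in c..b, ‖(cauchySolution p q c l u v).1 r‖ ^ 2) =
      ∫ r in c..b, ‖(h.flow hb l (constPair c b u v)).1 (projIcc c b hb r)‖ ^ 2 := by
    intro l
    refine intervalIntegral.integral_congr fun r hr => ?_
    rw [uIcc_of_le hb] at hr
    rw [projIcc_of_mem hb hr, (h.cauchySolution_eq_flow hb l u v ⟨r, hr⟩).1]
  simp only [e]
  refine intervalIntegral.continuous_parametric_intervalIntegral_of_continuous' ?_ _ _
  have : Continuous fun z : ℂ × ℝ =>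
      (h.flow hb z.1 (constPair c b u v)).1 (projIcc c b hb z.2) :=
    (hd.comp continuous_fst).eval (continuous_projIcc.comp continuous_snd)
  exact this.norm.pow 2

lemma IsSolutionOn.conj {s : Set ℝ} {l : ℂ} {x y : ℝ → ℂ} (hs : IsSolutionOn p q c s l x y) :
    IsSolutionOn p q c s (starRingEnd ℂ l) (fun r => starRingEnd ℂ (x r))
      (fun r => starRingEnd ℂ (y r)) := by
  refine ⟨Complex.continuous_conj.comp_continuousOn hs.1,
    Complex.continuous_conj.comp_continuousOn hs.2.1, fun r hr => ?_⟩
  obtain ⟨h1, h2⟩ := hs.2.2 r hr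
  simp only
  constructor
  · rw [h1, map_add, ← intervalIntegral.intervalIntegral_conj]
    simp
  · rw [h2, map_add, ← intervalIntegral.intervalIntegral_conj]
    simp

lemma IsSolutionOn.linear (h : RegularCoeff p q c) {s : Set ℝ} {l : ℂ} {x y x' y' : ℝ → ℂ}
    (hsub : ∀ r ∈ s, Icc c r ⊆ s ∧ c ≤ r)
    (hs : IsSolutionOn p q c s l x y) (hs' : IsSolutionOn p q c s l x' y') (k k' : ℂ) :
    IsSolutionOn p q c s l (fun r => k * x r + k' * x' r) (fun r => k * y r + k' * y' r) := by
  refine ⟨(hs.1.const_mul k).add (hs'.1.const_mul k'),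
    (hs.2.1.const_mul k).add (hs'.2.1.const_mul k'), fun r hr => ?_⟩
  obtain ⟨h1, h2⟩ := hs.2.2 r hr
  obtain ⟨h1', h2'⟩ := hs'.2.2 r hr
  obtain ⟨hss, hcr⟩ := hsub r hr
  have hu : uIcc c r ⊆ s := by rwa [uIcc_of_le hcr]
  have i1 := h.intervalIntegrable_inv hcr
  have i2 := h.intervalIntegrable_sub hcr l
  have e1 : (∫ t in c..r, (k * y t + k' * y' t) / (p t : ℂ)) =
      k * (∫ t in c..r, y t / (p t : ℂ)) + k' * ∫ t in c..r, y' t / (p t : ℂ) := by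
    rw [← intervalIntegral.integral_const_mul, ← intervalIntegral.integral_const_mul,
      ← intervalIntegral.integral_add]
    · refine intervalIntegral.integral_congr fun t _ => ?_
      ring
    · simpa only [div_eq_mul_inv] using (i1.continuousOn_mul (hs.2.1.mono hu)).const_mul k
    · simpa only [div_eq_mul_inv] using (i1.continuousOn_mul (hs'.2.1.mono hu)).const_mul k'
  have e2 : (∫ t in c..r, ((q t : ℂ) - l) * (k * x t + k' * x' t)) =
      k * (∫ t in c..r, ((q t : ℂ) - l) * x t) + k' * ∫ t in c..r, ((q t : ℂ) - l) * x' t := by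
    rw [← intervalIntegral.integral_const_mul, ← intervalIntegral.integral_const_mul,
      ← intervalIntegral.integral_add]
    · refine intervalIntegral.integral_congr fun t _ => ?_
      ring
    · exact (i2.mul_continuousOn (hs.1.mono hu)).const_mul k
    · exact (i2.mul_continuousOn (hs'.1.mono hu)).const_mul k'
  constructor
  · simp only [e1]; rw [h1, h1']; ring
  · simp only [e2]; rw [h2, h2']; ring

/-- Green's formula, in the form without complex conjugation. -/
lemma IsSolutionOn.green (h : RegularCoeff p q c) {b : ℝ} (hb : c ≤ b) {l₁ l₂ : ℂ}
    {x₁ y₁ x₂ y₂ : ℝ → ℂ} (h₁ : IsSolutionOn p q c (Icc c b) l₁ x₁ y₁)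
    (h₂ : IsSolutionOn p q c (Icc c b) l₂ x₂ y₂) :
    x₁ b * y₂ b - y₁ b * x₂ b =
      x₁ c * y₂ c - y₁ c * x₂ c + (l₁ - l₂) * ∫ t in c..b, x₁ t * x₂ t := by
  have hu := uIcc_of_le hb
  have i1 := h.intervalIntegrable_inv hb
  have j1 : IntervalIntegrable (fun t => y₁ t / (p t : ℂ)) volume c b := by
    simpa only [div_eq_mul_inv] using i1.continuousOn_mul (hu ▸ h₁.2.1)
  have j2 : IntervalIntegrable (fun t => y₂ t / (p t : ℂ)) volume c b := by
    simpa only [div_eq_mul_inv] using i1.continuousOn_mul (hu ▸ h₂.2.1)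
  have k1 := (h.intervalIntegrable_sub hb l₁).mul_continuousOn (hu ▸ h₁.1)
  have k2 := (h.intervalIntegrable_sub hb l₂).mul_continuousOn (hu ▸ h₂.1)
  have e1 := mul_eq_integral_of_primitives hb j1 k2 (fun t ht => (h₁.2.2 t ht).1)
    (fun t ht => (h₂.2.2 t ht).2)
  have e2 := mul_eq_integral_of_primitives hb k1 j2 (fun t ht => (h₁.2.2 t ht).2)
    (fun t ht => (h₂.2.2 t ht).1)
  have e3 : (∫ t in c..b, (y₁ t / (p t : ℂ) * y₂ t + x₁ t * (((q t : ℂ) - l₂) * x₂ t))) -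
      (∫ t in c..b, (((q t : ℂ) - l₁) * x₁ t * x₂ t + y₁ t * (y₂ t / (p t : ℂ)))) =
      (l₁ - l₂) * ∫ t in c..b, x₁ t * x₂ t := by
    rw [← intervalIntegral.integral_const_mul, ← intervalIntegral.integral_sub]
    · refine intervalIntegral.integral_congr fun t _ => ?_
      ring
    · exact (j1.mul_continuousOn (hu ▸ h₂.2.1)).add (k2.continuousOn_mul (hu ▸ h₁.1))
    · exact (k1.mul_continuousOn (hu ▸ h₂.1)).add (j2.continuousOn_mul (hu ▸ h₁.2.1))
  rw [e1, e2, ← e3]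
  ring

/-- A solution whose first component vanishes on `[c, b]` is trivial, because `p > 0`. -/
lemma IsSolutionOn.initial_eq_zero (h : RegularCoeff p q c) {b : ℝ} (hb : c < b) {l : ℂ}
    {x y : ℝ → ℂ} (hs : IsSolutionOn p q c (Icc c b) l x y) (hx : ∀ r ∈ Icc c b, x r = 0) :
    x c = 0 ∧ y c = 0 := by
  have hxc := hx c (left_mem_Icc.2 hb.le)
  refine ⟨hxc, ?_⟩
  have hy : ∀ r ∈ Icc c b, y r = y c := by
    intro r hr
    rw [(hs.2.2 r hr).2]
    have : (∫ t in c..r, ((q t : ℂ) - l) * x t) = ∫ t in c..r, (0 : ℂ) := by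
      refine intervalIntegral.integral_congr fun t ht => ?_
      rw [uIcc_of_le hr.1] at ht
      simp [hx t ⟨ht.1, ht.2.trans hr.2⟩]
    rw [this]; simp
  have h1 := (hs.2.2 b (right_mem_Icc.2 hb.le)).1
  rw [hx b (right_mem_Icc.2 hb.le), hxc, zero_add] at h1
  have h2 : (∫ t in c..b, y t / (p t : ℂ)) = y c * ((∫ t in c..b, (p t)⁻¹ : ℝ) : ℂ) := by
    rw [← intervalIntegral.integral_ofReal, ← intervalIntegral.integral_const_mul]
    refine intervalIntegral.integral_congr fun t ht => ?_
    rw [uIcc_of_le hb.le] at ht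
    simp only [hy t ht, div_eq_mul_inv, Complex.ofReal_inv]
  have h3 : 0 < ∫ t in c..b, (p t)⁻¹ :=
    intervalIntegral.intervalIntegral_pos_of_pos_on (h.inv_p b hb.le)
      (fun t ht => inv_pos.2 (h.pos t ht.1.le)) hb
  rw [h2] at h1
  rcases mul_eq_zero.1 h1.symm with h4 | h4
  · exact h4
  · exact absurd (Complex.ofReal_eq_zero.1 h4) h3.ne'

lemma IsSolutionOn.integral_normSq_pos (h : RegularCoeff p q c) {b : ℝ} (hb : c < b) {l : ℂ}
    {x y : ℝ → ℂ} (hs : IsSolutionOn p q c (Icc c b) l x y) (hne : x c ≠ 0 ∨ y c ≠ 0) :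
    0 < ∫ r in c..b, ‖x r‖ ^ 2 := by
  by_contra hle
  have hcont : ContinuousOn (fun r => ‖x r‖ ^ 2) (Icc c b) := hs.1.norm.pow 2
  have h1 : ∀ r ∈ Icc c b, x r = 0 := by
    by_contra! hr
    obtain ⟨r, hr, hr0⟩ := hr
    exact hle (intervalIntegral.integral_pos hb hcont (fun _ _ => by positivity)
      ⟨r, hr, by positivity⟩)
  obtain ⟨h2, h3⟩ := hs.initial_eq_zero h hb h1
  rcases hne with h4 | h4
  · exact h4 h2
  · exact h4 h3

end WeylTheory

namespace WeylTheory

variable {p q : ℝ → ℝ} {c : ℝ}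

/-! ### Weyl circles and the limit point -/

/-- The solution `χ = φ + m ψ`. -/
noncomputable def chi (p q : ℝ → ℝ) (c α : ℝ) (l m : ℂ) : (ℝ → ℂ) × (ℝ → ℂ) :=
  phi p q c α l + m • psi p q c α l

lemma chi_fst (α : ℝ) (l m : ℂ) (r : ℝ) :
    (chi p q c α l m).1 r = (phi p q c α l).1 r + m * (psi p q c α l).1 r := rfl

lemma chi_snd (α : ℝ) (l m : ℂ) (r : ℝ) :
    (chi p q c α l m).2 r = (phi p q c α l).2 r + m * (psi p q c α l).2 r := rfl

namespace RegularCoeff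

lemma phi_isSolutionOn (h : RegularCoeff p q c) (α : ℝ) (l : ℂ) (b : ℝ) :
    IsSolutionOn p q c (Icc c b) l (phi p q c α l).1 (phi p q c α l).2 :=
  h.cauchySolution_isSolutionOn _ _ _ b

lemma psi_isSolutionOn (h : RegularCoeff p q c) (α : ℝ) (l : ℂ) (b : ℝ) :
    IsSolutionOn p q c (Icc c b) l (psi p q c α l).1 (psi p q c α l).2 :=
  h.cauchySolution_isSolutionOn _ _ _ b

lemma phi_initial (h : RegularCoeff p q c) (α : ℝ) (l : ℂ) :
    (phi p q c α l).1 c = (Real.sin α : ℂ) ∧ (phi p q c α l).2 c = -(Real.cos α : ℂ) :=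
  (h.cauchySolution_spec _ _ _).2

lemma psi_initial (h : RegularCoeff p q c) (α : ℝ) (l : ℂ) :
    (psi p q c α l).1 c = (Real.cos α : ℂ) ∧ (psi p q c α l).2 c = (Real.sin α : ℂ) :=
  (h.cauchySolution_spec _ _ _).2

lemma chi_isSolutionOn (h : RegularCoeff p q c) (α : ℝ) (l m : ℂ) (b : ℝ) :
    IsSolutionOn p q c (Icc c b) l (chi p q c α l m).1 (chi p q c α l m).2 := by
  have := (h.phi_isSolutionOn α l b).linear h
    (fun r hr => ⟨Icc_subset_Icc le_rfl hr.2, hr.1⟩) (h.psi_isSolutionOn α l b) 1 m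
  simp only [one_mul] at this
  exact this

end RegularCoeff

lemma ofReal_sin_sq_add_cos_sq (α : ℝ) :
    (Real.sin α : ℂ) ^ 2 + (Real.cos α : ℂ) ^ 2 = 1 := by
  exact_mod_cast Real.sin_sq_add_cos_sq α

lemma psi_initial_ne_zero (h : RegularCoeff p q c) (α : ℝ) (l : ℂ) :
    (psi p q c α l).1 c ≠ 0 ∨ (psi p q c α l).2 c ≠ 0 := by
  by_contra! hcon
  rw [(h.psi_initial α l).1, (h.psi_initial α l).2] at hcon
  have := ofReal_sin_sq_add_cos_sq α
  rw [hcon.1, hcon.2] at this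
  norm_num at this

lemma integral_normSq_psi_pos (h : RegularCoeff p q c) (α : ℝ) (l : ℂ) {b : ℝ} (hb : c < b) :
    0 < ∫ r in c..b, ‖(psi p q c α l).1 r‖ ^ 2 :=
  (h.psi_isSolutionOn α l b).integral_normSq_pos h hb (psi_initial_ne_zero h α l)

/-- The bracket of a solution with itself: `[x x](b) = [x x](c) + 2 i Im l ∫_c^b |x|²`. -/
lemma IsSolutionOn.bracket_self (h : RegularCoeff p q c) {b : ℝ} (hb : c ≤ b) {l : ℂ}
    {z : (ℝ → ℂ) × (ℝ → ℂ)} (hs : IsSolutionOn p q c (Icc c b) l z.1 z.2) :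
    bracket z z b = bracket z z c +
      ((2 * (l.im * ∫ r in c..b, ‖z.1 r‖ ^ 2) : ℝ) : ℂ) * Complex.I := by
  have := hs.green h hb hs.conj
  unfold bracket
  rw [this]
  congr 1
  have e : (∫ t in c..b, z.1 t * (starRingEnd ℂ) (z.1 t)) =
      ((∫ r in c..b, ‖z.1 r‖ ^ 2 : ℝ) : ℂ) := by
    rw [← intervalIntegral.integral_ofReal]
    refine intervalIntegral.integral_congr fun t _ => ?_
    simp only [Complex.mul_conj, Complex.normSq_eq_norm_sq]
  rw [e, Complex.sub_conj]
  push_cast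
  ring

lemma bracket_chi (h : RegularCoeff p q c) (α : ℝ) (l m : ℂ) {b : ℝ} (hb : c ≤ b) :
    bracket (chi p q c α l m) (chi p q c α l m) b =
      ((2 * (l.im * (∫ r in c..b, ‖(chi p q c α l m).1 r‖ ^ 2) - m.im) : ℝ) : ℂ) * Complex.I := by
  rw [(h.chi_isSolutionOn α l m b).bracket_self h hb]
  have e : bracket (chi p q c α l m) (chi p q c α l m) c = ((-2 * m.im : ℝ) : ℂ) * Complex.I := by
    unfold bracket
    rw [chi_fst, chi_snd, (h.phi_initial α l).1, (h.phi_initial α l).2, (h.psi_initial α l).1,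
      (h.psi_initial α l).2]
    simp only [map_add, map_mul, map_neg, Complex.conj_ofReal]
    have h1 := Complex.sub_conj m
    have h2 := ofReal_sin_sq_add_cos_sq α
    push_cast at h1 h2 ⊢
    linear_combination (-1 : ℂ) * h1 + (-m + (starRingEnd ℂ) m) * h2
  rw [e]
  push_cast
  ring

lemma mem_weylCircle_iff (h : RegularCoeff p q c) (α : ℝ) (l m : ℂ) {b : ℝ} (hb : c ≤ b) :
    m ∈ weylCircle p q c α l b ↔
      l.im * (∫ r in c..b, ‖(chi p q c α l m).1 r‖ ^ 2) = m.im := by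
  change bracket (chi p q c α l m) (chi p q c α l m) b = 0 ↔ _
  rw [bracket_chi h α l m hb, mul_eq_zero, or_iff_left Complex.I_ne_zero, Complex.ofReal_eq_zero,
    mul_eq_zero, or_iff_right two_ne_zero, sub_eq_zero]

/-- The closed disc bounded by the circle `C_b`, for `Im l ≠ 0` and `b > c`. In this form it is
evident that the discs decrease with `b`. -/
def weylDisc (p q : ℝ → ℝ) (c α : ℝ) (l : ℂ) (b : ℝ) : Set ℂ :=
  {m | ∫ r in c..b, ‖(chi p q c α l m).1 r‖ ^ 2 ≤ m.im / l.im}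

lemma weylCircle_subset_weylDisc (h : RegularCoeff p q c) (α : ℝ) {l : ℂ} (hl : l.im ≠ 0)
    {b : ℝ} (hb : c ≤ b) : weylCircle p q c α l b ⊆ weylDisc p q c α l b := by
  intro m hm
  rw [mem_weylCircle_iff h α l m hb] at hm
  exact (eq_div_of_mul_eq hl (by rw [mul_comm]; exact hm)).le

lemma IsSolutionOn.intervalIntegrable_normSq {b : ℝ} (hb : c ≤ b) {l : ℂ} {x y : ℝ → ℂ}
    (hs : IsSolutionOn p q c (Icc c b) l x y) :
    IntervalIntegrable (fun r => ‖x r‖ ^ 2) volume c b := by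
  have : ContinuousOn (fun r => ‖x r‖ ^ 2) (Icc c b) := hs.1.norm.pow 2
  exact (this.mono (uIcc_of_le hb).subset).intervalIntegrable

lemma weylDisc_anti (h : RegularCoeff p q c) (α : ℝ) (l : ℂ) {b b' : ℝ} (hb : c ≤ b)
    (hbb : b ≤ b') : weylDisc p q c α l b' ⊆ weylDisc p q c α l b := by
  intro m hm
  refine le_trans ?_ (show (∫ r in c..b', ‖(chi p q c α l m).1 r‖ ^ 2) ≤ m.im / l.im from hm)
  exact intervalIntegral.integral_mono_interval le_rfl hb hbb
    (Eventually.of_forall fun _ => by simp only [Pi.zero_apply]; positivity)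
    ((h.chi_isSolutionOn α l m b').intervalIntegrable_normSq (hb.trans hbb))

lemma integral_normSq_linear_le {x y : ℝ → ℂ} {b : ℝ} (hb : c ≤ b)
    (hx : ContinuousOn x (Icc c b)) (hy : ContinuousOn y (Icc c b)) (k k' : ℂ) :
    (∫ r in c..b, ‖k * x r + k' * y r‖ ^ 2) ≤
      2 * ‖k‖ ^ 2 * (∫ r in c..b, ‖x r‖ ^ 2) + 2 * ‖k'‖ ^ 2 * ∫ r in c..b, ‖y r‖ ^ 2 := by
  have hu := uIcc_of_le hb
  have i1 : IntervalIntegrable (fun r => ‖x r‖ ^ 2) volume c b :=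
    ContinuousOn.intervalIntegrable (by rw [hu]; exact hx.norm.pow 2)
  have i2 : IntervalIntegrable (fun r => ‖y r‖ ^ 2) volume c b :=
    ContinuousOn.intervalIntegrable (by rw [hu]; exact hy.norm.pow 2)
  have i3 : IntervalIntegrable (fun r => ‖k * x r + k' * y r‖ ^ 2) volume c b :=
    ContinuousOn.intervalIntegrable (by
      rw [hu]; exact ((hx.const_mul k).add (hy.const_mul k')).norm.pow 2)
  rw [← intervalIntegral.integral_const_mul, ← intervalIntegral.integral_const_mul,
    ← intervalIntegral.integral_add (i1.const_mul _) (i2.const_mul _)]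
  refine intervalIntegral.integral_mono_on hb i3 ((i1.const_mul _).add (i2.const_mul _)) ?_
  intro r _
  have h1 := norm_add_le (k * x r) (k' * y r)
  rw [norm_mul, norm_mul] at h1
  have h2 := norm_nonneg (k * x r + k' * y r)
  nlinarith [sq_nonneg (‖k‖ * ‖x r‖ - ‖k'‖ * ‖y r‖)]

/-- Two points at which `φ + m ψ` is bounded in `L²(c, b)` are close to each other if `ψ` has a large
norm. -/
lemma normSq_sub_mul_integral_le (h : RegularCoeff p q c) (α : ℝ) (l : ℂ) {b : ℝ} (hb : c ≤ b)
    (m m' : ℂ) :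
    ‖m - m'‖ ^ 2 * (∫ r in c..b, ‖(psi p q c α l).1 r‖ ^ 2) ≤
      2 * (∫ r in c..b, ‖(chi p q c α l m).1 r‖ ^ 2) +
      2 * ∫ r in c..b, ‖(chi p q c α l m').1 r‖ ^ 2 := by
  have := integral_normSq_linear_le hb (h.chi_isSolutionOn α l m b).1
    (h.chi_isSolutionOn α l m' b).1 1 (-1)
  rw [← intervalIntegral.integral_const_mul]
  refine le_trans (le_of_eq ?_) (this.trans (le_of_eq (by simp)))
  refine intervalIntegral.integral_congr fun r _ => ?_
  simp only [chi_fst]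
  rw [← mul_pow, ← norm_mul]
  congr 2
  ring

/-- A point `m` of a Weyl disc satisfies `|m| |Im l| ≤ C`, locally uniformly in `l`. Since `m` lies
in the disc of `b₀`, comparison with `m = 0` gives `|m|² ∫ |ψ|² ≤ 2 Im m / Im l + 2 ∫ |φ|²` with
integrals over `[c, b₀]`, and these depend continuously on `l`. -/
lemma exists_norm_mul_im_le (h : RegularCoeff p q c) (α : ℝ) {b₀ : ℝ} (hb₀ : c < b₀) (R : ℝ) :
    ∃ C : ℝ, ∀ b ≥ b₀, ∀ l : ℂ, ‖l‖ ≤ R → l.im ≠ 0 → ∀ m ∈ weylDisc p q c α l b,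
      ‖m‖ * |l.im| ≤ C := by
  have hcont := h.continuous_integral_normSq hb₀.le (Real.cos α : ℂ) (Real.sin α : ℂ)
  have hcont' := h.continuous_integral_normSq hb₀.le (Real.sin α : ℂ) (-(Real.cos α : ℂ))
  have hcpt := isCompact_closedBall (0 : ℂ) R
  rcases (Metric.closedBall (0 : ℂ) R).eq_empty_or_nonempty with he | hne
  · refine ⟨0, fun b _ l hl => ?_⟩
    have : l ∈ Metric.closedBall (0 : ℂ) R := by simpa using hl
    rw [he] at this
    exact this.elim
  obtain ⟨l₀, -, hl₀⟩ := hcpt.exists_isMinOn hne hcont.continuousOn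
  obtain ⟨l₁, -, hl₁⟩ := hcpt.exists_isMaxOn hne hcont'.continuousOn
  set δ := ∫ r in c..b₀, ‖(psi p q c α l₀).1 r‖ ^ 2 with hδ
  set A := ∫ r in c..b₀, ‖(phi p q c α l₁).1 r‖ ^ 2 with hA
  have hδ0 : 0 < δ := integral_normSq_psi_pos h α l₀ hb₀
  have hA0 : 0 ≤ A := intervalIntegral.integral_nonneg hb₀.le fun _ _ => by positivity
  refine ⟨1 + (2 + 2 * A * R ^ 2) / δ, fun b hb l hl hl0 m hm => ?_⟩
  have hlm : l ∈ Metric.closedBall (0 : ℂ) R := by simpa using hl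
  have h1 : δ ≤ ∫ r in c..b₀, ‖(psi p q c α l).1 r‖ ^ 2 := hl₀ hlm
  have h2 : (∫ r in c..b₀, ‖(phi p q c α l).1 r‖ ^ 2) ≤ A := hl₁ hlm
  have h3 := normSq_sub_mul_integral_le h α l hb₀.le m 0
  have h4 : (∫ r in c..b₀, ‖(chi p q c α l m).1 r‖ ^ 2) ≤ m.im / l.im :=
    weylDisc_anti h α l hb₀.le hb hm
  have h5 : (∫ r in c..b₀, ‖(chi p q c α l 0).1 r‖ ^ 2) =
      ∫ r in c..b₀, ‖(phi p q c α l).1 r‖ ^ 2 := by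
    simp only [chi_fst, zero_mul, add_zero]
  rw [sub_zero, h5] at h3
  set y := |l.im| with hy
  have hy0 : 0 < y := abs_pos.2 hl0
  have h6 : m.im / l.im * y ≤ ‖m‖ := by
    calc m.im / l.im * y ≤ |m.im / l.im * y| := le_abs_self _
      _ = |m.im| := by rw [abs_mul, abs_div, hy, abs_abs, div_mul_cancel₀ _ hy0.ne']
      _ ≤ ‖m‖ := Complex.abs_im_le_norm m
  have hyR : y ≤ R := (Complex.abs_im_le_norm l).trans hl
  -- a quadratic inequality for `t = |m| |Im l|`
  set t := ‖m‖ * y with ht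
  have ht0 : 0 ≤ t := by positivity
  have h7 : t ^ 2 * δ ≤ 2 * t + 2 * A * R ^ 2 := by
    have a1 : ‖m‖ ^ 2 * δ ≤ 2 * (m.im / l.im) + 2 * A := by
      have := mul_le_mul_of_nonneg_left h1 (sq_nonneg ‖m‖)
      linarith
    have a2 : y ^ 2 * (‖m‖ ^ 2 * δ) ≤ y ^ 2 * (2 * (m.im / l.im) + 2 * A) :=
      mul_le_mul_of_nonneg_left a1 (sq_nonneg y)
    have a3 : y ^ 2 * (2 * (m.im / l.im)) ≤ 2 * t := by
      have := mul_le_mul_of_nonneg_left h6 hy0.le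
      rw [ht]; nlinarith
    have a4 : y ^ 2 * (2 * A) ≤ 2 * A * R ^ 2 := by
      have : y ^ 2 ≤ R ^ 2 := by gcongr
      nlinarith
    rw [ht]; nlinarith
  rcases le_total t 1 with ht1 | ht1
  · have : 0 ≤ (2 + 2 * A * R ^ 2) / δ := by positivity
    linarith
  · have : t ≤ (2 + 2 * A * R ^ 2) / δ := by
      rw [le_div_iff₀ hδ0]
      have a5 : 2 * A * R ^ 2 ≤ 2 * A * R ^ 2 * t := le_mul_of_one_le_right (by positivity) ht1
      nlinarith
    linarith

lemma isClosed_weylDisc (h : RegularCoeff p q c) (α : ℝ) (l : ℂ) {b : ℝ} (hb : c ≤ b) :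
    IsClosed (weylDisc p q c α l b) := by
  have hu := uIcc_of_le hb
  have hφ := (h.phi_isSolutionOn α l b).1
  have hψ := (h.psi_isSolutionOn α l b).1
  set x := (phi p q c α l).1
  set y := (psi p q c α l).1
  have hre : ContinuousOn (fun r => (x r * (starRingEnd ℂ) (y r)).re) (Icc c b) :=
    Complex.continuous_re.comp_continuousOn
      (hφ.mul (Complex.continuous_conj.comp_continuousOn hψ))
  have him : ContinuousOn (fun r => (x r * (starRingEnd ℂ) (y r)).im) (Icc c b) :=
    Complex.continuous_im.comp_continuousOn
      (hφ.mul (Complex.continuous_conj.comp_continuousOn hψ))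
  have i1 : IntervalIntegrable (fun r => ‖x r‖ ^ 2) volume c b :=
    ContinuousOn.intervalIntegrable (by rw [hu]; exact hφ.norm.pow 2)
  have i2 : IntervalIntegrable (fun r => ‖y r‖ ^ 2) volume c b :=
    ContinuousOn.intervalIntegrable (by rw [hu]; exact hψ.norm.pow 2)
  have i3 := ContinuousOn.intervalIntegrable (μ := volume) (hu.symm ▸ hre)
  have i4 := ContinuousOn.intervalIntegrable (μ := volume) (hu.symm ▸ him)
  -- the integral is a polynomial in the real and imaginary parts of `m`
  have key : ∀ m : ℂ, (∫ r in c..b, ‖(chi p q c α l m).1 r‖ ^ 2) =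
      ((∫ r in c..b, ‖x r‖ ^ 2) + ‖m‖ ^ 2 * ∫ r in c..b, ‖y r‖ ^ 2) +
      (2 * m.re * (∫ r in c..b, (x r * (starRingEnd ℂ) (y r)).re) +
        2 * m.im * ∫ r in c..b, (x r * (starRingEnd ℂ) (y r)).im) := by
    intro m
    simp only [← intervalIntegral.integral_const_mul]
    rw [← intervalIntegral.integral_add i1 (i2.const_mul _),
      ← intervalIntegral.integral_add (i3.const_mul _) (i4.const_mul _),
      ← intervalIntegral.integral_add (i1.add (i2.const_mul _))
        ((i3.const_mul _).add (i4.const_mul _))]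
    refine intervalIntegral.integral_congr fun r _ => ?_
    simp only [chi_fst, ← Complex.normSq_eq_norm_sq, Complex.normSq_apply, Complex.add_re,
      Complex.add_im, Complex.mul_re, Complex.mul_im, Complex.conj_re, Complex.conj_im]
    ring
  unfold weylDisc
  simp only [key]
  refine isClosed_le ?_ ?_
  · fun_prop
  · fun_prop

/-- In the limit-point case, if some `φ + m ψ` is square integrable, then `ψ` is not: otherwise all
solutions, being combinations of the two, would be square integrable. -/
lemma not_bddAbove_integral_psi (h : RegularCoeff p q c) (hL : LimitPointAtInfinity p q c) (α : ℝ)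
    (l m : ℂ) {M : ℝ} (hM : ∀ b > c, (∫ r in c..b, ‖(chi p q c α l m).1 r‖ ^ 2) ≤ M) (K : ℝ) :
    ∃ b > c, K < ∫ r in c..b, ‖(psi p q c α l).1 r‖ ^ 2 := by
  by_contra! hK
  refine hL ⟨l, fun x y hxy => ⟨c, le_rfl, ?_⟩⟩
  set s : ℂ := (Real.sin α : ℂ) with hs
  set k : ℂ := (Real.cos α : ℂ) with hk
  have hsk : s ^ 2 + k ^ 2 = 1 := ofReal_sin_sq_add_cos_sq α
  -- the coefficients of the solution in the basis `χ`, `ψ`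
  set A : ℂ := s * x c - k * y c with hA
  set B : ℂ := k * x c + s * y c - A * m with hB
  have hx : ∀ b > c, ∀ r ∈ Icc c b,
      x r = A * (chi p q c α l m).1 r + B * (psi p q c α l).1 r := by
    intro b hb r hr
    have hlin := (h.chi_isSolutionOn α l m b).linear h
      (fun r hr => ⟨Icc_subset_Icc le_rfl hr.2, hr.1⟩) (h.psi_isSolutionOn α l b) A B
    refine ((hxy.mono Icc_subset_Ici_self).eqOn h hb.le hlin ?_ ?_).1 hr
    · simp only [chi_fst]
      rw [(h.phi_initial α l).1, (h.psi_initial α l).1, hA, hB, hA, ← hs, ← hk]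
      linear_combination (-x c) * hsk
    · simp only [chi_snd]
      rw [(h.phi_initial α l).2, (h.psi_initial α l).2, hA, hB, hA, ← hs, ← hk]
      linear_combination (-y c) * hsk
  have hbd : ∀ b > c, (∫ r in c..b, ‖x r‖ ^ 2) ≤ 2 * ‖A‖ ^ 2 * M + 2 * ‖B‖ ^ 2 * K := by
    intro b hb
    have e : (∫ r in c..b, ‖x r‖ ^ 2) =
        ∫ r in c..b, ‖A * (chi p q c α l m).1 r + B * (psi p q c α l).1 r‖ ^ 2 := by
      refine intervalIntegral.integral_congr fun r hr => ?_
      rw [uIcc_of_le (le_of_lt hb)] at hr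
      simp only [hx b hb r hr]
    rw [e]
    refine (integral_normSq_linear_le (le_of_lt hb) (h.chi_isSolutionOn α l m b).1
      (h.psi_isSolutionOn α l b).1 A B).trans ?_
    have := hM b hb
    have := hK b hb
    gcongr
  refine integrableOn_Ioi_of_intervalIntegral_norm_bounded
    (2 * ‖A‖ ^ 2 * M + 2 * ‖B‖ ^ 2 * K) c (l := atTop) (b := id) (fun b => ?_) tendsto_id ?_
  · rcases le_or_gt b c with hbc | hbc
    · simp [hbc]
    · exact (intervalIntegrable_iff_integrableOn_Ioc_of_le hbc.le).1
        ((hxy.mono Icc_subset_Ici_self).intervalIntegrable_normSq hbc.le)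
  · filter_upwards [eventually_gt_atTop c] with b hb
    refine le_trans (le_of_eq ?_) (hbd b hb)
    refine intervalIntegral.integral_congr fun r _ => ?_
    simp

/-- The Weyl function `m_b` of the problem on `[c, b]` with boundary angle `β` at `b`: the value
`m` for which `φ + m ψ` satisfies the boundary condition at `b`. -/
noncomputable def weylM (p q : ℝ → ℝ) (c α b β : ℝ) (l : ℂ) : ℂ :=
  -((Real.cos β : ℂ) * (phi p q c α l).1 b + (Real.sin β : ℂ) * (phi p q c α l).2 b) /
    ((Real.cos β : ℂ) * (psi p q c α l).1 b + (Real.sin β : ℂ) * (psi p q c α l).2 b)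

/-- The boundary condition says that `(x, y)` is a multiple of `(sin β, -cos β)`. -/
lemma eq_smul_of_boundary {β : ℝ} {x y : ℂ}
    (hxy : (Real.cos β : ℂ) * x + (Real.sin β : ℂ) * y = 0) :
    x = ((Real.sin β : ℂ) * x - (Real.cos β : ℂ) * y) * (Real.sin β : ℂ) ∧
      y = -((Real.sin β : ℂ) * x - (Real.cos β : ℂ) * y) * (Real.cos β : ℂ) := by
  have h2 := ofReal_sin_sq_add_cos_sq β
  constructor
  · linear_combination (Real.cos β : ℂ) * hxy - x * h2
  · linear_combination (Real.sin β : ℂ) * hxy - y * h2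

/-- A real boundary condition at `b` forces `[z z](b) = 0`. -/
lemma bracket_eq_zero_of_boundary {β b : ℝ} {z : (ℝ → ℂ) × (ℝ → ℂ)}
    (hz : (Real.cos β : ℂ) * z.1 b + (Real.sin β : ℂ) * z.2 b = 0) : bracket z z b = 0 := by
  obtain ⟨h1, h2⟩ := eq_smul_of_boundary hz
  set k := (Real.sin β : ℂ) * z.1 b - (Real.cos β : ℂ) * z.2 b
  unfold bracket
  rw [h1, h2]
  simp only [map_mul, map_neg, Complex.conj_ofReal]
  ring

/-- A nonreal `l` is not an eigenvalue, so that the denominator of `weylM` does not vanish. -/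
lemma boundary_psi_ne_zero (h : RegularCoeff p q c) (α β : ℝ) {b : ℝ} (hb : c < b) {l : ℂ}
    (hl : l.im ≠ 0) :
    (Real.cos β : ℂ) * (psi p q c α l).1 b + (Real.sin β : ℂ) * (psi p q c α l).2 b ≠ 0 := by
  intro h0
  have h1 := bracket_eq_zero_of_boundary h0
  have h2 : bracket (psi p q c α l) (psi p q c α l) c = 0 := by
    unfold bracket
    rw [(h.psi_initial α l).1, (h.psi_initial α l).2]
    simp only [Complex.conj_ofReal]
    ring
  rw [(h.psi_isSolutionOn α l b).bracket_self h hb.le, h2, zero_add, mul_eq_zero,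
    or_iff_left Complex.I_ne_zero, Complex.ofReal_eq_zero] at h1
  have := integral_normSq_psi_pos h α l hb
  simp [hl, this.ne'] at h1

lemma weylM_mem_weylCircle (h : RegularCoeff p q c) (α β : ℝ) {b : ℝ} (hb : c < b) {l : ℂ}
    (hl : l.im ≠ 0) : weylM p q c α b β l ∈ weylCircle p q c α l b := by
  have h0 := boundary_psi_ne_zero h α β hb hl
  refine bracket_eq_zero_of_boundary (z := chi p q c α l (weylM p q c α b β l)) (β := β) ?_
  rw [chi_fst, chi_snd, weylM]
  field_simp
  ring

lemma exists_mem_iInter_weylDisc (h : RegularCoeff p q c) (α : ℝ) {l : ℂ} (hl : l.im ≠ 0) :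
    ∃ m : ℂ, ∀ b > c, m ∈ weylDisc p q c α l b := by
  obtain ⟨C, hC⟩ := exists_norm_mul_im_le h α (lt_add_one c) ‖l‖
  have hcn : ∀ n : ℕ, c < c + 1 + n := fun n => by
    have : (0 : ℝ) ≤ n := n.cast_nonneg
    linarith
  have hcpt : IsCompact (weylDisc p q c α l (c + 1 + (0 : ℕ))) := by
    refine Metric.isCompact_of_isClosed_isBounded (isClosed_weylDisc h α l (by simp)) ?_
    refine (Metric.isBounded_closedBall (x := (0 : ℂ)) (r := C / |l.im|)).subset fun m hm => ?_
    rw [mem_closedBall_zero_iff, le_div_iff₀ (abs_pos.2 hl)]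
    exact hC _ (by simp) l le_rfl hl m hm
  obtain ⟨m, hm⟩ := IsCompact.nonempty_iInter_of_sequence_nonempty_isCompact_isClosed
    (fun n : ℕ => weylDisc p q c α l (c + 1 + n))
    (fun n => weylDisc_anti h α l (hcn n).le (by push_cast; linarith))
    (fun n => ⟨_, weylCircle_subset_weylDisc h α hl (hcn n).le
      (weylM_mem_weylCircle h α 0 (hcn n) hl)⟩)
    hcpt (fun n => isClosed_weylDisc h α l (hcn n).le)
  refine ⟨m, fun b hb => ?_⟩
  obtain ⟨n, hn⟩ := exists_nat_ge (b - (c + 1))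
  exact weylDisc_anti h α l (le_of_lt hb) (by linarith) (mem_iInter.1 hm n)

/-- In the limit-point case the circles `C_b` shrink to a point of the intersection of the discs. -/
theorem exists_isWeylLimitPoint (h : RegularCoeff p q c) (hL : LimitPointAtInfinity p q c) (α : ℝ)
    {l : ℂ} (hl : l.im ≠ 0) : ∃ m : ℂ, IsWeylLimitPoint p q c α l m := by
  obtain ⟨m, hm⟩ := exists_mem_iInter_weylDisc h α hl
  refine ⟨m, fun b hb => ⟨_, weylM_mem_weylCircle h α 0 hb hl⟩, ?_⟩
  obtain ⟨C, hC⟩ := exists_norm_mul_im_le h α (lt_add_one c) ‖l‖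
  set y := |l.im|
  have hy : 0 < y := abs_pos.2 hl
  have hdisc : ∀ b > c + 1, ∀ m' ∈ weylDisc p q c α l b, m'.im / l.im ≤ C / y / y := by
    intro b hb m' hm'
    have h1 : ‖m'‖ ≤ C / y := by
      rw [le_div_iff₀ hy]
      exact hC b (le_of_lt hb) l le_rfl hl m' hm'
    calc m'.im / l.im ≤ |m'.im / l.im| := le_abs_self _
      _ = |m'.im| / y := by rw [abs_div]
      _ ≤ C / y / y := by gcongr; exact (Complex.abs_im_le_norm m').trans h1
  rw [tendsto_smallSets_iff]
  intro t ht
  obtain ⟨ε, hε, hεt⟩ := Metric.mem_nhds_iff.1 ht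
  obtain ⟨b₁, hb₁, hlarge⟩ := not_bddAbove_integral_psi h hL α l m (M := m.im / l.im)
    (fun b hb => hm b hb) ((4 * (C / y / y)) / ε ^ 2)
  filter_upwards [eventually_gt_atTop (c + 1), eventually_ge_atTop b₁] with b hb hbb m' hm'
  refine hεt ?_
  have hcb : c < b := by linarith
  have hm'd := weylCircle_subset_weylDisc h α hl hcb.le hm'
  have h1 := normSq_sub_mul_integral_le h α l hcb.le m' m
  have h2 : (∫ r in c..b₁, ‖(psi p q c α l).1 r‖ ^ 2) ≤
      ∫ r in c..b, ‖(psi p q c α l).1 r‖ ^ 2 :=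
    intervalIntegral.integral_mono_interval le_rfl (le_of_lt hb₁) hbb
      (Eventually.of_forall fun _ => by simp only [Pi.zero_apply]; positivity)
      ((h.psi_isSolutionOn α l b).intervalIntegrable_normSq hcb.le)
  have h3 : (∫ r in c..b, ‖(chi p q c α l m').1 r‖ ^ 2) ≤ C / y / y :=
    le_trans hm'd (hdisc b hb m' hm'd)
  have h4 : (∫ r in c..b, ‖(chi p q c α l m).1 r‖ ^ 2) ≤ C / y / y :=
    le_trans (hm b hcb) (hdisc b hb m (hm b hcb))
  rw [mem_ball_iff_norm]
  by_contra! hcon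
  have h5 : ε ^ 2 ≤ ‖m' - m‖ ^ 2 := by gcongr
  have h6 : 4 * (C / y / y) < ε ^ 2 * ∫ r in c..b₁, ‖(psi p q c α l).1 r‖ ^ 2 := by
    rw [div_lt_iff₀ (by positivity)] at hlarge
    linarith
  have h7 : 0 ≤ ∫ r in c..b₁, ‖(psi p q c α l).1 r‖ ^ 2 :=
    (integral_normSq_psi_pos h α l hb₁).le
  have h8 := mul_le_mul h5 h2 h7 (sq_nonneg _)
  linarith

end WeylTheory

namespace WeylTheory

/-! ### Principal parts at real poles -/

/-- `m` is a function on the upper and lower half planes, symmetric under conjugation, which is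
meromorphic across the real line with simple poles at the points `t` of `E` and principal parts
`w t / (t - z)` with `w t ≥ 0`. The poles in any bounded interval are finite in number. -/
structure HasRealPoles (m : ℂ → ℂ) (E : Set ℝ) (w : ℝ → ℝ) : Prop where
  conj : ∀ z : ℂ, z.im ≠ 0 → m ((starRingEnd ℂ) z) = (starRingEnd ℂ) (m z)
  nonneg : ∀ t ∈ E, 0 ≤ w t
  principal : ∀ R : ℝ, ∃ (F : Finset ℝ) (K : ℂ → ℂ), (∀ t, t ∈ F ↔ t ∈ E ∧ |t| ≤ R) ∧
    AnalyticOnNhd ℂ K (Metric.closedBall 0 R) ∧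
    ∀ z : ℂ, z.im ≠ 0 → m z = K z + ∑ t ∈ F, (w t : ℂ) / (t - z)

/-- At a simple zero `t` of `D` with `N t = w D'(t)`, the singularity of `-N / D - w / (t - z)` is
removable. -/
lemma exists_analyticAt_sub_principal {N D : ℂ → ℂ} (hN : Differentiable ℂ N)
    (hD : Differentiable ℂ D) {t w : ℂ} (hDt : D t = 0) (hD' : deriv D t ≠ 0)
    (hw : N t = w * deriv D t) :
    ∃ g : ℂ → ℂ, AnalyticAt ℂ g t ∧ ∀ᶠ z in 𝓝[≠] t, -N z / D z - w / (t - z) = g z := by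
  have hds : ∀ {f : ℂ → ℂ}, Differentiable ℂ f → Differentiable ℂ (dslope f t) := fun {f} hf =>
    differentiableOn_univ.1 ((Complex.differentiableOn_dslope univ_mem).2 hf.differentiableOn)
  set d := dslope D t with hd
  set n : ℂ → ℂ := fun z => -N z + w * d z with hn
  have hnd : Differentiable ℂ n := hN.neg.add ((hds hD).const_mul w)
  have hdt : d t = deriv D t := dslope_same D t
  have hnt : n t = 0 := by simp only [hn, hdt, hw]; ring
  have hdt0 : d t ≠ 0 := hdt ▸ hD'
  refine ⟨fun z => dslope n t z / d z,
    ((hds hnd).analyticAt t).div ((hds hD).analyticAt t) hdt0, ?_⟩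
  have hev : ∀ᶠ z in 𝓝[≠] t, d z ≠ 0 :=
    eventually_nhdsWithin_of_eventually_nhds ((hds hD).continuous.continuousAt.eventually_ne hdt0)
  filter_upwards [hev, self_mem_nhdsWithin] with z hz hzt
  have hzt' : z - t ≠ 0 := sub_ne_zero.2 hzt
  have hzt'' : t - z ≠ 0 := sub_ne_zero.2 (Ne.symm hzt)
  have e1 : D z = (z - t) * d z := by
    have := sub_smul_dslope D t z
    rw [hDt, sub_zero, smul_eq_mul] at this
    exact this.symm
  have e2 : n z = (z - t) * dslope n t z := by
    have := sub_smul_dslope n t z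
    rw [hnt, sub_zero, smul_eq_mul] at this
    exact this.symm
  have e3 : -N z = (z - t) * dslope n t z - w * d z := by rw [← e2]; simp only [hn]; ring
  rw [e1, e3]
  field_simp
  ring

/-- Let `N`, `D` be entire, and let the zeros of `D` in `U` be real, simple, and contained in the
finite set `F`. Then `-N / D` is the sum of its principal parts and a function analytic on `U`. The latter is the
meromorphic normal form of the difference, which fills in the values at the poles. -/
lemma exists_analyticOnNhd_sub_principal {N D : ℂ → ℂ} (hN : Differentiable ℂ N)
    (hD : Differentiable ℂ D) {F : Finset ℝ} {w : ℝ → ℝ} {U : Set ℂ}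
    (hD0 : ∀ z ∈ U, D z = 0 → ∃ t ∈ F, z = (t : ℂ)) (hDF : ∀ t ∈ F, D (t : ℂ) = 0)
    (hD' : ∀ t ∈ F, deriv D (t : ℂ) ≠ 0) (hw : ∀ t ∈ F, N (t : ℂ) = w t * deriv D (t : ℂ))
    (hDim : ∀ z : ℂ, z.im ≠ 0 → D z ≠ 0) :
    ∃ K : ℂ → ℂ, AnalyticOnNhd ℂ K U ∧
      ∀ z : ℂ, z.im ≠ 0 → -N z / D z = K z + ∑ t ∈ F, (w t : ℂ) / (t - z) := by
  set f : ℂ → ℂ := fun z => -N z / D z - ∑ t ∈ F, (w t : ℂ) / (t - z) with hf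
  have hpole : ∀ (t z : ℂ) (k : ℂ), z ≠ t → AnalyticAt ℂ (fun z => k / (t - z)) z := by
    intro t z k hzt
    exact analyticAt_const.div (analyticAt_const.sub analyticAt_id) (sub_ne_zero.2 hzt.symm)
  have hreg : ∀ z, D z ≠ 0 → AnalyticAt ℂ f z := by
    intro z hz
    refine ((hN.analyticAt z).neg.div (hD.analyticAt z) hz).sub
      (Finset.analyticAt_fun_sum _ fun t ht => hpole _ _ _ ?_)
    rintro rfl
    exact hz (hDF t ht)
  have hmer : MeromorphicOn f univ := by
    intro z _
    refine ((hN.analyticAt z).neg.meromorphicAt.div (hD.analyticAt z).meromorphicAt).sub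
      (MeromorphicAt.fun_sum fun t _ => ?_)
    exact (MeromorphicAt.const _ _).div
      ((MeromorphicAt.const _ _).sub analyticAt_id.meromorphicAt)
  refine ⟨toMeromorphicNFOn f univ, fun z hz => ?_, fun z hz => ?_⟩
  · refine ((meromorphicNFOn_toMeromorphicNFOn f univ) (mem_univ z)
      ).meromorphicOrderAt_nonneg_iff_analyticAt.1 ?_
    rw [meromorphicOrderAt_toMeromorphicNFOn hmer (mem_univ z)]
    by_cases h0 : D z = 0
    · obtain ⟨t, ht, rfl⟩ := hD0 z hz h0
      obtain ⟨g, hg, hge⟩ := exists_analyticAt_sub_principal hN hD h0 (hD' t ht) (hw t ht)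
      set S : ℂ → ℂ := fun z => ∑ s ∈ F.erase t, (w s : ℂ) / (s - z) with hS
      have hSan : AnalyticAt ℂ S t := by
        refine Finset.analyticAt_fun_sum _ fun s hs => hpole _ _ _ ?_
        intro h
        exact (Finset.ne_of_mem_erase hs) (Complex.ofReal_injective h).symm
      have he : f =ᶠ[𝓝[≠] (t : ℂ)] g - S := by
        filter_upwards [hge] with z hz
        simp only [hf, hS, Pi.sub_apply]
        rw [← hz, ← Finset.add_sum_erase F _ ht]
        ring
      rw [meromorphicOrderAt_congr he]
      exact (hg.sub hSan).meromorphicOrderAt_nonneg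
    · exact (hreg z h0).meromorphicOrderAt_nonneg
  · rw [toMeromorphicNFOn_eq_toMeromorphicNFAt hmer (mem_univ z),
      toMeromorphicNFAt_eq_self.2 (hreg z (hDim z hz)).meromorphicNFAt]
    simp only [hf]
    ring

/-- The real zeros of an entire function that does not vanish at `i` are locally finite. -/
lemma finite_real_zeros {D : ℂ → ℂ} (hD : Differentiable ℂ D) (hI : D Complex.I ≠ 0) (R : ℝ) :
    {t : ℝ | D (t : ℂ) = 0 ∧ |t| ≤ R}.Finite := by
  have hcod : D ⁻¹' {0}ᶜ ∈ codiscrete ℂ :=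
    AnalyticOnNhd.preimage_zero_mem_codiscrete (fun z _ => hD.analyticAt z) hI
  have hcl : IsClosed (D ⁻¹' {0}) := isClosed_singleton.preimage hD.continuous
  have hdisc : IsDiscrete (D ⁻¹' {0}) := by
    have := (mem_codiscrete'.1 hcod).2
    simpa [preimage_compl] using this
  have hfin : (Metric.closedBall (0 : ℂ) R ∩ D ⁻¹' {0}).Finite :=
    ((isCompact_closedBall (0 : ℂ) R).inter_right hcl).finite (hdisc.mono inter_subset_right)
  refine (hfin.preimage Complex.ofReal_injective.injOn).subset fun t ht => ?_
  exact ⟨by simpa using ht.2, ht.1⟩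

/-! ### The Weyl function of a finite interval -/

variable {p q : ℝ → ℝ} {c : ℝ}

lemma cauchySolution_conj (h : RegularCoeff p q c) {b : ℝ} (hb : c ≤ b) (l : ℂ) (u v : ℝ) :
    (cauchySolution p q c ((starRingEnd ℂ) l) u v).1 b =
        (starRingEnd ℂ) ((cauchySolution p q c l u v).1 b) ∧
      (cauchySolution p q c ((starRingEnd ℂ) l) u v).2 b =
        (starRingEnd ℂ) ((cauchySolution p q c l u v).2 b) := by
  have h1 := (h.cauchySolution_isSolutionOn l u v b).conj
  have h2 := h.cauchySolution_isSolutionOn ((starRingEnd ℂ) l) u v b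
  obtain ⟨-, e1, e2⟩ := h.cauchySolution_spec l u v
  obtain ⟨-, e3, e4⟩ := h.cauchySolution_spec ((starRingEnd ℂ) l) u v
  have := h2.eqOn h hb h1 (by rw [e1, e3, Complex.conj_ofReal]) (by rw [e2, e4, Complex.conj_ofReal])
  exact ⟨this.1 (right_mem_Icc.2 hb), this.2 (right_mem_Icc.2 hb)⟩

lemma phi_conj (h : RegularCoeff p q c) (α : ℝ) {b : ℝ} (hb : c ≤ b) (l : ℂ) :
    (phi p q c α ((starRingEnd ℂ) l)).1 b = (starRingEnd ℂ) ((phi p q c α l).1 b) ∧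
      (phi p q c α ((starRingEnd ℂ) l)).2 b = (starRingEnd ℂ) ((phi p q c α l).2 b) := by
  have := cauchySolution_conj h hb l (Real.sin α) (-Real.cos α)
  push_cast at this
  unfold phi
  push_cast
  exact this

lemma psi_conj (h : RegularCoeff p q c) (α : ℝ) {b : ℝ} (hb : c ≤ b) (l : ℂ) :
    (psi p q c α ((starRingEnd ℂ) l)).1 b = (starRingEnd ℂ) ((psi p q c α l).1 b) ∧
      (psi p q c α ((starRingEnd ℂ) l)).2 b = (starRingEnd ℂ) ((psi p q c α l).2 b) :=
  cauchySolution_conj h hb l (Real.cos α) (Real.sin α)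

lemma weylM_conj (h : RegularCoeff p q c) (α β : ℝ) {b : ℝ} (hb : c ≤ b) (l : ℂ) :
    weylM p q c α b β ((starRingEnd ℂ) l) = (starRingEnd ℂ) (weylM p q c α b β l) := by
  unfold weylM
  rw [(phi_conj h α hb l).1, (phi_conj h α hb l).2, (psi_conj h α hb l).1, (psi_conj h α hb l).2]
  simp only [map_div₀, map_neg, map_add, map_mul, Complex.conj_ofReal]

/-- The Wronskian of `φ` and `ψ`. -/
lemma wronskian_phi_psi (h : RegularCoeff p q c) (α : ℝ) {b : ℝ} (hb : c ≤ b) (l : ℂ) :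
    (phi p q c α l).1 b * (psi p q c α l).2 b - (phi p q c α l).2 b * (psi p q c α l).1 b = 1 := by
  rw [(h.phi_isSolutionOn α l b).green h hb (h.psi_isSolutionOn α l b), (h.phi_initial α l).1,
    (h.phi_initial α l).2, (h.psi_initial α l).1, (h.psi_initial α l).2]
  linear_combination ofReal_sin_sq_add_cos_sq α

/-- The real parameters `t` for which `ψ(·, t)` satisfies the boundary condition at `b` are the
eigenvalues. -/
lemma mem_eigenvalues_iff (h : RegularCoeff p q c) (α β : ℝ) {b : ℝ} (hb : c < b) (t : ℝ) :
    t ∈ eigenvalues p q c α b β ↔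
      (Real.cos β : ℂ) * (psi p q c α (t : ℂ)).1 b +
        (Real.sin β : ℂ) * (psi p q c α (t : ℂ)).2 b = 0 := by
  have hψ := h.psi_isSolutionOn α (t : ℂ) b
  constructor
  · rintro ⟨x, y, hs, hne, hc, hβ⟩
    set k : ℂ := (Real.cos α : ℂ) * x c + (Real.sin α : ℂ) * y c with hk
    have h2 := ofReal_sin_sq_add_cos_sq α
    have hlin := hψ.linear h (fun r hr => ⟨Icc_subset_Icc le_rfl hr.2, hr.1⟩) hψ k 0
    have heq := hs.eqOn h hb.le hlin
      (by rw [(h.psi_initial α t).1, hk]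
          linear_combination (Real.sin α : ℂ) * hc - x c * h2)
      (by rw [(h.psi_initial α t).2, hk]
          linear_combination -(Real.cos α : ℂ) * hc - y c * h2)
    have hk0 : k ≠ 0 := by
      intro hk0
      obtain ⟨r, hr, hr0⟩ := hne
      apply hr0
      rw [heq.1 hr]
      simp [hk0]
    have hbm := right_mem_Icc.2 hb.le
    rw [heq.1 hbm, heq.2 hbm] at hβ
    refine (mul_eq_zero.1 (?_ : k * _ = 0)).resolve_left hk0
    linear_combination hβ
  · intro h0
    refine ⟨_, _, hψ, ?_, ?_, h0⟩
    · by_contra! hcon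
      obtain ⟨h1, h2⟩ := hψ.initial_eq_zero h hb hcon
      rcases psi_initial_ne_zero h α (t : ℂ) with h3 | h3
      · exact h3 h1
      · exact h3 h2
    · rw [(h.psi_initial α t).1, (h.psi_initial α t).2]
      ring

/-- `ψ` is real-valued for real `t`. -/
lemma conj_psi_ofReal (h : RegularCoeff p q c) (α : ℝ) {b : ℝ} (hb : c ≤ b) (t : ℝ) :
    (starRingEnd ℂ) ((psi p q c α (t : ℂ)).1 b) = (psi p q c α (t : ℂ)).1 b := by
  have := (psi_conj h α hb (t : ℂ)).1
  rw [Complex.conj_ofReal] at this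
  exact this.symm

lemma integral_psi_mul_self (h : RegularCoeff p q c) (α : ℝ) {b : ℝ} (hb : c ≤ b) (t : ℝ) :
    (∫ r in c..b, (psi p q c α (t : ℂ)).1 r * (psi p q c α (t : ℂ)).1 r) =
      ((jump p q c α b t)⁻¹ : ℝ) := by
  rw [jump, inv_inv, ← intervalIntegral.integral_ofReal]
  refine intervalIntegral.integral_congr fun r hr => ?_
  rw [uIcc_of_le hb] at hr
  nth_rewrite 2 [← conj_psi_ofReal h α hr.1 t]
  rw [Complex.mul_conj, Complex.normSq_eq_norm_sq]

lemma continuous_integral_psi_mul (h : RegularCoeff p q c) (α : ℝ) {b : ℝ} (hb : c ≤ b) (t : ℝ) :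
    Continuous fun z : ℂ => ∫ r in c..b, (psi p q c α z).1 r * (psi p q c α (t : ℂ)).1 r := by
  have hd : Continuous fun l =>
      (h.flow hb l (constPair c b (Real.cos α : ℂ) (Real.sin α : ℂ))).1 :=
    continuous_fst.comp (h.differentiable_flow hb _).continuous
  have e : ∀ l, (∫ r in c..b, (psi p q c α l).1 r * (psi p q c α (t : ℂ)).1 r) =
      ∫ r in c..b, (h.flow hb l (constPair c b (Real.cos α : ℂ) (Real.sin α : ℂ))).1
          (projIcc c b hb r) *
        (h.flow hb t (constPair c b (Real.cos α : ℂ) (Real.sin α : ℂ))).1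
          (projIcc c b hb r) := by
    intro l
    refine intervalIntegral.integral_congr fun r hr => ?_
    rw [uIcc_of_le hb] at hr
    simp only [psi]
    rw [projIcc_of_mem hb hr, (h.cauchySolution_eq_flow hb l _ _ ⟨r, hr⟩).1,
      (h.cauchySolution_eq_flow hb t _ _ ⟨r, hr⟩).1]
  simp only [e]
  refine intervalIntegral.continuous_parametric_intervalIntegral_of_continuous' ?_ _ _
  exact ((hd.comp continuous_fst).eval (continuous_projIcc.comp continuous_snd)).mul
    ((ContinuousMap.continuous _).comp (continuous_projIcc.comp continuous_snd))

/-- The Weyl function of `[c, b]` has simple poles at the eigenvalues, with residues given by the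
jumps of the spectral function. -/
theorem hasRealPoles_weylM (h : RegularCoeff p q c) (α β : ℝ) {b : ℝ} (hb : c < b) :
    HasRealPoles (weylM p q c α b β) (eigenvalues p q c α b β) (jump p q c α b) := by
  set N : ℂ → ℂ := fun l => (Real.cos β : ℂ) * (phi p q c α l).1 b +
    (Real.sin β : ℂ) * (phi p q c α l).2 b with hNdef
  set D : ℂ → ℂ := fun l => (Real.cos β : ℂ) * (psi p q c α l).1 b +
    (Real.sin β : ℂ) * (psi p q c α l).2 b with hDdef
  have hN : Differentiable ℂ N := by
    obtain ⟨h1, h2⟩ := h.differentiable_cauchySolution hb.le (Real.sin α : ℂ) (-(Real.cos α : ℂ))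
    exact (h1.const_mul _).add (h2.const_mul _)
  have hD : Differentiable ℂ D := by
    obtain ⟨h1, h2⟩ := h.differentiable_cauchySolution hb.le (Real.cos α : ℂ) (Real.sin α : ℂ)
    exact (h1.const_mul _).add (h2.const_mul _)
  have hDim : ∀ z : ℂ, z.im ≠ 0 → D z ≠ 0 := fun z hz => boundary_psi_ne_zero h α β hb hz
  have hE : ∀ t : ℝ, t ∈ eigenvalues p q c α b β ↔ D t = 0 := mem_eigenvalues_iff h α β hb
  have hjump : ∀ t, 0 < jump p q c α b t := fun t =>
    inv_pos.2 (integral_normSq_psi_pos h α t hb)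
  have hder : ∀ t : ℝ, D t = 0 → deriv D t ≠ 0 ∧ N t = jump p q c α b t * deriv D t := by
    intro t ht
    obtain ⟨e1, e2⟩ := eq_smul_of_boundary ht
    set k := (Real.sin β : ℂ) * (psi p q c α t).1 b - (Real.cos β : ℂ) * (psi p q c α t).2 b
    -- the Wronskian identity at `b`, where `ψ` is `k` times `(sin β, -cos β)`
    have hkN : k * N t = -1 := by
      have := wronskian_phi_psi h α hb.le (t : ℂ)
      rw [e1, e2] at this
      simp only [hNdef]
      linear_combination (-1 : ℂ) * this
    have hk0 : k ≠ 0 := by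
      intro h0
      rw [h0] at hkN
      norm_num at hkN
    -- Green's formula for `ψ(·, z)` and `ψ(·, t)`
    have hgreen : ∀ z : ℂ, -k * D z =
        (z - t) * ∫ r in c..b, (psi p q c α z).1 r * (psi p q c α (t : ℂ)).1 r := by
      intro z
      have := (h.psi_isSolutionOn α z b).green h hb.le (h.psi_isSolutionOn α (t : ℂ) b)
      rw [e1, e2, (h.psi_initial α z).1, (h.psi_initial α z).2, (h.psi_initial α t).1,
        (h.psi_initial α t).2] at this
      simp only [hDdef]
      linear_combination this
    have hslope : HasDerivAt D (-k⁻¹ * ((jump p q c α b t)⁻¹ : ℝ)) t := by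
      rw [hasDerivAt_iff_tendsto_slope]
      have hcont := (continuous_integral_psi_mul h α hb.le t).tendsto (t : ℂ)
      rw [integral_psi_mul_self h α hb.le t] at hcont
      refine ((hcont.mono_left nhdsWithin_le_nhds).const_mul (-k⁻¹)).congr' ?_
      filter_upwards [self_mem_nhdsWithin] with z hz
      have hz' : z - t ≠ 0 := sub_ne_zero.2 hz
      rw [slope_def_field, ht, sub_zero, eq_div_iff hz']
      have := hgreen z
      field_simp
      linear_combination this
    rw [hslope.deriv]
    have hj : ((jump p q c α b t : ℝ) : ℂ) ≠ 0 := Complex.ofReal_ne_zero.2 (hjump t).ne'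
    push_cast
    constructor
    · exact mul_ne_zero (neg_ne_zero.2 (inv_ne_zero hk0)) (inv_ne_zero hj)
    · have : N t = -k⁻¹ := by
        field_simp
        linear_combination hkN
      rw [this]
      field_simp
  refine ⟨fun z _ => weylM_conj h α β hb.le z, fun t _ => (hjump t).le, fun R => ?_⟩
  have hfin := finite_real_zeros hD (hDim Complex.I (by simp)) R
  have hF : ∀ t, t ∈ hfin.toFinset ↔ D t = 0 ∧ |t| ≤ R := fun t => by simp
  obtain ⟨K, hK, hKe⟩ := exists_analyticOnNhd_sub_principal hN hD (F := hfin.toFinset)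
    (w := jump p q c α b) (U := Metric.closedBall 0 R) (fun z hz h0 => by
      have him : z.im = 0 := by
        by_contra him
        exact hDim z him h0
      have hzr : z = (z.re : ℂ) := by
        apply Complex.ext <;> simp [him]
      refine ⟨z.re, (hF _).2 ⟨by rw [← hzr]; exact h0, ?_⟩, hzr⟩
      rw [mem_closedBall_zero_iff] at hz
      exact (Complex.abs_re_le_norm z).trans hz)
    (fun t ht => ((hF t).1 ht).1) (fun t ht => (hder t ((hF t).1 ht).1).1)
    (fun t ht => (hder t ((hF t).1 ht).1).2) hDim
  exact ⟨hfin.toFinset, K, fun t => by rw [hF, hE], hK, hKe⟩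

end WeylTheory

namespace WeylTheory

/-! ### Convergence of the pole measures -/

/-- The integral of `f` against the discrete measure with masses `w t` at the points of `E`. -/
noncomputable def poleSum (E : Set ℝ) (w : ℝ → ℝ) (f : ℝ → ℝ) : ℝ :=
  ∑ᶠ t ∈ E, w t * f t

lemma poleSum_eq_sum {E : Set ℝ} {w f : ℝ → ℝ} {R : ℝ} {F : Finset ℝ}
    (hF : ∀ t, t ∈ F ↔ t ∈ E ∧ |t| ≤ R) (hf : ∀ t, R < |t| → f t = 0) :
    poleSum E w f = ∑ t ∈ F, w t * f t := by
  refine finsum_mem_eq_sum_of_inter_support_eq _ ?_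
  ext t
  simp only [mem_inter_iff, Function.mem_support, Finset.mem_coe, hF]
  refine ⟨fun ⟨h1, h2⟩ => ⟨⟨h1, ?_⟩, h2⟩, fun ⟨h1, h2⟩ => ⟨h1.1, h2⟩⟩
  by_contra h3
  exact h2 (by rw [hf t (not_le.1 h3), mul_zero])

namespace HasRealPoles

variable {m : ℂ → ℂ} {E : Set ℝ} {w : ℝ → ℝ}

lemma exists_finset (h : HasRealPoles m E w) (R : ℝ) :
    ∃ F : Finset ℝ, ∀ t, t ∈ F ↔ t ∈ E ∧ |t| ≤ R := by
  obtain ⟨F, K, hF, -⟩ := h.principal R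
  exact ⟨F, hF⟩

lemma poleSum_add (h : HasRealPoles m E w) {f g : ℝ → ℝ} {R : ℝ} (hf : ∀ t, R < |t| → f t = 0)
    (hg : ∀ t, R < |t| → g t = 0) :
    poleSum E w (fun t => f t + g t) = poleSum E w f + poleSum E w g := by
  obtain ⟨F, hF⟩ := h.exists_finset R
  rw [poleSum_eq_sum hF hf, poleSum_eq_sum hF hg,
    poleSum_eq_sum hF (fun t ht => by rw [hf t ht, hg t ht, add_zero]), ← Finset.sum_add_distrib]
  exact Finset.sum_congr rfl fun t _ => mul_add _ _ _

lemma poleSum_const_mul (h : HasRealPoles m E w) {f : ℝ → ℝ} {R : ℝ}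
    (hf : ∀ t, R < |t| → f t = 0) (k : ℝ) :
    poleSum E w (fun t => k * f t) = k * poleSum E w f := by
  obtain ⟨F, hF⟩ := h.exists_finset R
  rw [poleSum_eq_sum hF hf, poleSum_eq_sum hF (fun t ht => by rw [hf t ht, mul_zero]),
    Finset.mul_sum]
  exact Finset.sum_congr rfl fun t _ => by ring

lemma poleSum_mono (h : HasRealPoles m E w) {f g : ℝ → ℝ} {R : ℝ} (hf : ∀ t, R < |t| → f t = 0)
    (hg : ∀ t, R < |t| → g t = 0) (hfg : ∀ t, f t ≤ g t) :
    poleSum E w f ≤ poleSum E w g := by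
  obtain ⟨F, hF⟩ := h.exists_finset R
  rw [poleSum_eq_sum hF hf, poleSum_eq_sum hF hg]
  exact Finset.sum_le_sum fun t ht =>
    mul_le_mul_of_nonneg_left (hfg t) (h.nonneg t ((hF t).1 ht).1)

lemma continuousAt (h : HasRealPoles m E w) {z : ℂ} (hz : z.im ≠ 0) : ContinuousAt m z := by
  obtain ⟨F, K, hF, hK, hm⟩ := h.principal ‖z‖
  have h1 : ContinuousAt (fun z => K z + ∑ t ∈ F, (w t : ℂ) / (t - z)) z := by
    refine (hK z (by simp)).continuousAt.add (tendsto_finsetSum _ fun t _ => ?_)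
    refine continuousAt_const.div (continuousAt_const.sub continuousAt_id) (sub_ne_zero.2 ?_)
    intro h0
    apply hz
    rw [← show ((t : ℂ)) = z from h0, Complex.ofReal_im]
  refine h1.congr ?_
  filter_upwards [Complex.continuous_im.continuousAt.eventually_ne hz] with z' hz'
  exact (hm z' hz').symm

end HasRealPoles

/-- On the circle `|z| = R` the factor `R² - z²` is of the size of `Im z`. -/
lemma norm_sq_sub_sq_of_mem_sphere {R : ℝ} {z : ℂ} (hz : ‖z‖ = R) :
    ‖(R : ℂ) ^ 2 - z ^ 2‖ = 2 * R * |z.im| := by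
  have h1 : (R : ℂ) ^ 2 = z * (starRingEnd ℂ) z := by
    rw [Complex.mul_conj, Complex.normSq_eq_norm_sq, hz]; push_cast; ring
  have h2 : (R : ℂ) ^ 2 - z ^ 2 = -(z * (z - (starRingEnd ℂ) z)) := by rw [h1]; ring
  rw [h2, Complex.sub_conj, norm_neg, norm_mul, hz, norm_mul, Complex.norm_I, Complex.norm_real,
    Real.norm_eq_abs, abs_mul]
  norm_num
  ring

lemma ae_circleMap_im_ne_zero {R : ℝ} (hR : 0 < R) : ∀ᵐ θ : ℝ, (circleMap 0 R θ).im ≠ 0 := by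
  have : {θ : ℝ | ¬ (circleMap 0 R θ).im ≠ 0} ⊆ range fun n : ℤ => (n : ℝ) * Real.pi := by
    intro θ hθ
    have h1 : (circleMap 0 R θ).im = 0 := not_not.1 hθ
    have h2 : (circleMap 0 R θ).im = R * Real.sin θ := by
      simp [circleMap, Complex.exp_ofReal_mul_I_im]
    rw [h2, mul_eq_zero, or_iff_right hR.ne', Real.sin_eq_zero_iff] at h1
    exact h1
  exact ((countable_range _).mono this).measure_zero _

/-- The weighted moments of the pole measure are contour integrals of `m` over a circle that crosses
the real line; the factor `R² - z²` cancels poles of `m` at the crossing points. -/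
lemma HasRealPoles.circleIntegral_eq {m : ℂ → ℂ} {E : Set ℝ} {w : ℝ → ℝ}
    (h : HasRealPoles m E w) {R : ℝ} (hR : 0 < R) {F : Finset ℝ}
    (hF : ∀ t, t ∈ F ↔ t ∈ E ∧ |t| ≤ R) (k : ℕ) :
    (∮ z in C(0, R), z ^ k * (((R : ℂ) ^ 2 - z ^ 2) * m z)) =
      -(2 * Real.pi * Complex.I) * ((∑ t ∈ F, w t * ((R ^ 2 - t ^ 2) * t ^ k) : ℝ) : ℂ) := by
  obtain ⟨F', K, hF', hK, hm⟩ := h.principal R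
  obtain rfl : F = F' := by ext t; rw [hF, hF']
  set g : ℂ → ℂ := fun z => z ^ k * (((R : ℂ) ^ 2 - z ^ 2) * K z + ∑ t ∈ F, (w t : ℂ) * (t + z))
    with hg
  set s : ℝ → ℂ → ℂ := fun t z => ((w t * (R ^ 2 - t ^ 2) : ℝ) : ℂ) * ((z - t)⁻¹ * z ^ k) with hs
  have hgan : ∀ z ∈ Metric.closedBall (0 : ℂ) R, AnalyticAt ℂ g z := by
    intro z hz
    refine (analyticAt_id.pow k).mul
      (((analyticAt_const.sub (analyticAt_id.pow 2)).mul (hK z hz)).add ?_)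
    exact Finset.analyticAt_fun_sum _ fun t _ => analyticAt_const.mul
      (analyticAt_const.add analyticAt_id)
  have hgint : (∮ z in C(0, R), g z) = 0 :=
    Complex.circleIntegral_eq_zero_of_differentiable_on_off_countable hR.le countable_empty
      (fun z hz => (hgan z hz).continuousAt.continuousWithinAt)
      (fun z hz => (hgan z (Metric.ball_subset_closedBall hz.1)).differentiableAt)
  have hgci : CircleIntegrable g 0 R := ContinuousOn.circleIntegrable hR.le fun z hz =>
    (hgan z (Metric.sphere_subset_closedBall hz)).continuousAt.continuousWithinAt
  have hsint : ∀ t ∈ F, CircleIntegrable (s t) 0 R ∧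
      (∮ z in C(0, R), s t z) =
        (2 * Real.pi * Complex.I) * ((w t * ((R ^ 2 - t ^ 2) * t ^ k) : ℝ) : ℂ) := by
    intro t ht
    -- a pole on the circle itself contributes nothing, as its coefficient vanishes
    rcases ((hF t).1 ht).2.lt_or_eq with htR | htR
    · have htb : (t : ℂ) ∈ Metric.ball (0 : ℂ) R := by simpa using htR
      constructor
      · refine ContinuousOn.circleIntegrable hR.le ?_
        refine continuousOn_const.mul (ContinuousOn.mul (ContinuousOn.inv₀ (by fun_prop) ?_)
          (by fun_prop))
        intro z hz h0
        rw [sub_eq_zero] at h0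
        rw [h0, mem_sphere_zero_iff_norm, Complex.norm_real, Real.norm_eq_abs] at hz
        exact htR.ne hz
      · simp only [hs]
        rw [circleIntegral.integral_const_mul]
        have := Complex.circleIntegral_sub_inv_smul_of_differentiable_on_off_countable
          countable_empty htb (f := fun z : ℂ => z ^ k) (by fun_prop)
          (fun z _ => by fun_prop)
        simp only [smul_eq_mul] at this
        rw [this]
        push_cast
        ring
    · have h0 : R ^ 2 - t ^ 2 = 0 := by rw [← htR, sq_abs, sub_self]
      have hs0 : s t = fun _ => 0 := by
        funext z; simp only [hs, h0, mul_zero, Complex.ofReal_zero, zero_mul]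
      rw [hs0, h0]
      exact ⟨circleIntegrable_const 0 0 R, by simp [circleIntegral]⟩
  have hae : (∮ z in C(0, R), z ^ k * (((R : ℂ) ^ 2 - z ^ 2) * m z)) =
      ∮ z in C(0, R), (g z - ∑ t ∈ F, s t z) := by
    refine intervalIntegral.integral_congr_ae ?_
    filter_upwards [ae_circleMap_im_ne_zero hR] with θ hθ _
    set z := circleMap 0 R θ
    have hzt : ∀ t ∈ F, (t : ℂ) - z ≠ 0 := by
      intro t _ h0
      apply hθ
      rw [← sub_eq_zero.1 h0, Complex.ofReal_im]
    congr 1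
    rw [hm z hθ]
    -- `(R² - z²) / (t - z) = (t + z) - (R² - t²) / (z - t)`
    have e : ((R : ℂ) ^ 2 - z ^ 2) * ∑ t ∈ F, (w t : ℂ) / (t - z) =
        (∑ t ∈ F, (w t : ℂ) * (t + z)) -
          ∑ t ∈ F, ((w t * (R ^ 2 - t ^ 2) : ℝ) : ℂ) * (z - t)⁻¹ := by
      rw [Finset.mul_sum, ← Finset.sum_sub_distrib]
      refine Finset.sum_congr rfl fun t ht => ?_
      have h1 := hzt t ht
      have h2 : z - (t : ℂ) ≠ 0 := fun h => h1 (by rw [← neg_sub, h, neg_zero])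
      rw [show (z - (t : ℂ))⁻¹ = -((t : ℂ) - z)⁻¹ by rw [← neg_sub, inv_neg]]
      push_cast
      field_simp
      ring
    simp only [hg, hs]
    rw [mul_add, e]
    have e2 : ∑ t ∈ F, ((w t * (R ^ 2 - t ^ 2) : ℝ) : ℂ) * ((z - t)⁻¹ * z ^ k) =
        z ^ k * ∑ t ∈ F, ((w t * (R ^ 2 - t ^ 2) : ℝ) : ℂ) * (z - t)⁻¹ := by
      rw [Finset.mul_sum]
      exact Finset.sum_congr rfl fun t _ => by ring
    rw [e2]
    ring
  rw [hae, circleIntegral.integral_sub hgci (CircleIntegrable.fun_sum F fun t ht => (hsint t ht).1),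
    hgint, circleIntegral.integral_fun_sum fun t ht => (hsint t ht).1,
    Finset.sum_congr rfl fun t ht => (hsint t ht).2, ← Finset.mul_sum]
  push_cast
  ring

/-- A family of functions with real poles that converges off the real line, with a locally uniform
bound `|m z| ≤ C / |Im z|`. -/
structure IsPoleFamily {ι : Type*} (L : Filter ι) (m : ι → ℂ → ℂ) (E : ι → Set ℝ)
    (w : ι → ℝ → ℝ) (mlim : ℂ → ℂ) : Prop where
  poles : ∀ i, HasRealPoles (m i) (E i) (w i)
  bound : ∀ R : ℝ, ∃ C : ℝ, ∀ i, ∀ z : ℂ, ‖z‖ ≤ R → z.im ≠ 0 → ‖m i z‖ * |z.im| ≤ C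
  lim : ∀ z : ℂ, z.im ≠ 0 → Tendsto (fun i => m i z) L (𝓝 (mlim z))

namespace IsPoleFamily

variable {ι : Type*} {L : Filter ι} {m : ι → ℂ → ℂ} {E : ι → Set ℝ} {w : ι → ℝ → ℝ} {mlim : ℂ → ℂ}

/-- The weight `max (R² - t²) 0`, which makes the contour integrals over `|z| = R` converge. -/
noncomputable def weight (R t : ℝ) : ℝ := max (R ^ 2 - t ^ 2) 0

lemma weight_eq_zero {R t : ℝ} (hR : 0 < R) (ht : R < |t|) : weight R t = 0 := by
  refine max_eq_right ?_
  have : R ^ 2 ≤ t ^ 2 := by rw [← sq_abs t]; gcongr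
  linarith

lemma weight_nonneg (R t : ℝ) : 0 ≤ weight R t := le_max_right _ _

/-- The bound `|m| ≤ C / |Im z|` is cancelled by `|R² - z²| = 2 R |Im z|`, so that dominated convergence
applies. -/
lemma tendsto_circleIntegral [L.IsCountablyGenerated] (h : IsPoleFamily L m E w mlim) {R : ℝ}
    (hR : 0 < R) (k : ℕ) :
    Tendsto (fun i => ∮ z in C(0, R), z ^ k * (((R : ℂ) ^ 2 - z ^ 2) * m i z)) L
      (𝓝 (∮ z in C(0, R), z ^ k * (((R : ℂ) ^ 2 - z ^ 2) * mlim z))) := by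
  obtain ⟨C, hC⟩ := h.bound R
  have hae := ae_circleMap_im_ne_zero hR
  refine intervalIntegral.tendsto_integral_filter_of_dominated_convergence
    (fun _ => R * (R ^ k * (2 * R * C))) (Eventually.of_forall fun i => ?_)
    (Eventually.of_forall fun i => ?_) intervalIntegrable_const ?_
  · set A : Set ℝ := {θ | (circleMap 0 R θ).im ≠ 0} with hA
    have hAo : IsOpen A :=
      isOpen_ne.preimage (Complex.continuous_im.comp (continuous_circleMap 0 R))
    have hcont : ContinuousOn (fun θ => deriv (circleMap 0 R) θ •
        (circleMap 0 R θ ^ k * (((R : ℂ) ^ 2 - circleMap 0 R θ ^ 2) *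
          m i (circleMap 0 R θ)))) A := by
      have hc := (continuous_circleMap 0 R)
      simp only [smul_eq_mul]
      refine ContinuousOn.mul ?_ (ContinuousOn.mul (hc.pow k).continuousOn
        (ContinuousOn.mul (continuous_const.sub (hc.pow 2)).continuousOn ?_))
      · rw [show deriv (circleMap 0 R) = fun θ => circleMap 0 R θ * Complex.I from
          funext fun θ => deriv_circleMap 0 R θ]
        exact (hc.mul continuous_const).continuousOn
      · intro θ hθ
        exact (((h.poles i).continuousAt hθ).comp (f := circleMap 0 R)
          hc.continuousAt).continuousWithinAt
    have := hcont.aestronglyMeasurable hAo.measurableSet (μ := volume)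
    have hAe : volume.restrict A = volume := by
      rw [Measure.restrict_eq_self_of_ae_mem]
      exact hae
    rw [hAe] at this
    exact this.restrict
  · filter_upwards [hae] with θ hθ _
    set z := circleMap 0 R θ
    have hz : ‖z‖ = R := by simp [z, abs_of_pos hR]
    rw [norm_smul, deriv_circleMap, norm_mul, Complex.norm_I, mul_one, hz, norm_mul, norm_pow, hz,
      norm_mul, norm_sq_sub_sq_of_mem_sphere hz]
    have := hC i z hz.le hθ
    refine mul_le_mul_of_nonneg_left (mul_le_mul_of_nonneg_left ?_ (by positivity)) hR.le
    calc 2 * R * |z.im| * ‖m i z‖ = 2 * R * (‖m i z‖ * |z.im|) := by ring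
      _ ≤ 2 * R * C := by gcongr
  · filter_upwards [hae] with θ hθ _
    exact ((h.lim _ hθ).const_mul _).const_mul _ |>.const_smul _

lemma tendsto_moment [L.IsCountablyGenerated] (h : IsPoleFamily L m E w mlim) {R : ℝ}
    (hR : 0 < R) (k : ℕ) :
    ∃ a : ℝ, Tendsto (fun i => poleSum (E i) (w i) fun t => weight R t * t ^ k) L (𝓝 a) := by
  have h1 := h.tendsto_circleIntegral hR k
  have h2 := (Complex.continuous_re.tendsto _).comp
    (h1.const_mul (-(2 * Real.pi * Complex.I))⁻¹)
  refine ⟨_, h2.congr fun i => ?_⟩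
  obtain ⟨F, hF⟩ := (h.poles i).exists_finset R
  have hne : -(2 * Real.pi * Complex.I) ≠ 0 := neg_ne_zero.2 Complex.two_pi_I_ne_zero
  simp only [Function.comp]
  rw [(h.poles i).circleIntegral_eq hR hF k, inv_mul_cancel_left₀ hne, Complex.ofReal_re,
    poleSum_eq_sum hF fun t ht => by rw [weight_eq_zero hR ht, zero_mul]]
  refine Finset.sum_congr rfl fun t ht => ?_
  have : t ^ 2 ≤ R ^ 2 := by
    rw [← sq_abs t]
    have := ((hF t).1 ht).2
    gcongr
  rw [weight, max_eq_left (by linarith)]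

lemma tendsto_polynomial [L.IsCountablyGenerated] (h : IsPoleFamily L m E w mlim) {R : ℝ}
    (hR : 0 < R) (P : Polynomial ℝ) :
    ∃ a : ℝ, Tendsto (fun i => poleSum (E i) (w i) fun t => weight R t * P.eval t) L (𝓝 a) := by
  induction P using Polynomial.induction_on' with
  | add P Q hP hQ =>
    obtain ⟨a, ha⟩ := hP
    obtain ⟨b, hb⟩ := hQ
    refine ⟨a + b, (ha.add hb).congr fun i => ?_⟩
    rw [← (h.poles i).poleSum_add (R := R)
      (fun t ht => by rw [weight_eq_zero hR ht, zero_mul])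
      (fun t ht => by rw [weight_eq_zero hR ht, zero_mul])]
    simp only [Polynomial.eval_add, mul_add]
  | monomial n k =>
    obtain ⟨a, ha⟩ := h.tendsto_moment hR n
    refine ⟨k * a, (ha.const_mul k).congr fun i => ?_⟩
    rw [← (h.poles i).poleSum_const_mul (R := R)
      (fun t ht => by rw [weight_eq_zero hR ht, zero_mul])]
    simp only [Polynomial.eval_monomial]
    congr 1
    funext t
    ring

end IsPoleFamily

lemma exists_tendsto_of_approx {ι : Type*} {L : Filter ι} [L.NeBot] {u : ι → ℝ}
    (h : ∀ ε > 0, ∃ a : ℝ, ∀ᶠ i in L, |u i - a| ≤ ε) : ∃ a : ℝ, Tendsto u L (𝓝 a) := by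
  refine cauchy_map_iff_exists_tendsto.1 (Metric.cauchy_iff.2 ⟨inferInstance, fun ε hε => ?_⟩)
  obtain ⟨a, ha⟩ := h (ε / 3) (by positivity)
  refine ⟨{x | |x - a| ≤ ε / 3}, ha, fun x hx y hy => ?_⟩
  rw [Real.dist_eq]
  have hx' : |x - a| ≤ ε / 3 := hx
  have hy' : |y - a| ≤ ε / 3 := hy
  rw [abs_le] at hx' hy'
  rw [abs_lt]
  constructor <;> linarith [hx'.1, hx'.2, hy'.1, hy'.2]

namespace IsPoleFamily

variable {ι : Type*} {L : Filter ι} {m : ι → ℂ → ℂ} {E : ι → Set ℝ} {w : ι → ℝ → ℝ} {mlim : ℂ → ℂ}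

/-- By the Weierstrass approximation theorem, convergence of the weighted moments gives convergence
for all continuous functions. -/
lemma tendsto_weight_mul [L.NeBot] [L.IsCountablyGenerated] (h : IsPoleFamily L m E w mlim) {R : ℝ}
    (hR : 0 < R) {f : ℝ → ℝ} (hf : Continuous f) :
    ∃ a : ℝ, Tendsto (fun i => poleSum (E i) (w i) fun t => weight R t * f t) L (𝓝 a) := by
  obtain ⟨M, hM⟩ := h.tendsto_moment hR 0
  simp only [pow_zero, mul_one] at hM
  have hMev : ∀ᶠ i in L, poleSum (E i) (w i) (weight R) < |M| + 1 :=
    hM.eventually (gt_mem_nhds ((le_abs_self M).trans_lt (lt_add_one _)))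
  refine exists_tendsto_of_approx fun ε hε => ?_
  set δ := ε / (2 * (|M| + 1)) with hδ
  have hδ0 : 0 < δ := by positivity
  obtain ⟨P, hP⟩ := exists_polynomial_near_of_continuousOn (-R) R f hf.continuousOn δ hδ0
  obtain ⟨a, ha⟩ := h.tendsto_polynomial hR P
  refine ⟨a, ?_⟩
  have ha' : ∀ᶠ i in L, |(poleSum (E i) (w i) fun t => weight R t * P.eval t) - a| < ε / 2 := by
    have := (Metric.tendsto_nhds.1 ha) (ε / 2) (by positivity)
    simpa only [Real.dist_eq] using this
  filter_upwards [hMev, ha'] with i hi hia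
  obtain ⟨F, hF⟩ := (h.poles i).exists_finset R
  have h1 : |(poleSum (E i) (w i) fun t => weight R t * f t) -
      poleSum (E i) (w i) fun t => weight R t * P.eval t| ≤ δ * poleSum (E i) (w i) (weight R) := by
    have e0 : ∀ g : ℝ → ℝ, ∀ t, R < |t| → weight R t * g t = 0 := fun g t ht => by
      rw [weight_eq_zero hR ht, zero_mul]
    rw [poleSum_eq_sum hF (e0 f), poleSum_eq_sum hF (e0 fun t => P.eval t),
      poleSum_eq_sum hF fun t ht => weight_eq_zero hR ht, ← Finset.sum_sub_distrib, Finset.mul_sum]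
    refine (Finset.abs_sum_le_sum_abs _ _).trans (Finset.sum_le_sum fun t ht => ?_)
    have hw := (h.poles i).nonneg t ((hF t).1 ht).1
    have hPt := hP t (abs_le.1 ((hF t).1 ht).2)
    have e : w i t * (weight R t * f t) - w i t * (weight R t * P.eval t) =
        -(w i t * weight R t * (P.eval t - f t)) := by ring
    have hww := mul_nonneg hw (weight_nonneg R t)
    rw [e, abs_neg, abs_mul, abs_of_nonneg hww]
    nlinarith
  have h2 : δ * poleSum (E i) (w i) (weight R) ≤ ε / 2 := by
    calc δ * poleSum (E i) (w i) (weight R) ≤ δ * (|M| + 1) := by gcongr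
      _ = ε / 2 := by rw [hδ]; field_simp
  have := abs_sub_le (poleSum (E i) (w i) fun t => weight R t * f t)
    (poleSum (E i) (w i) fun t => weight R t * P.eval t) a
  linarith

lemma tendsto_of_support [L.NeBot] [L.IsCountablyGenerated] (h : IsPoleFamily L m E w mlim)
    {f : ℝ → ℝ} (hf : Continuous f) {R : ℝ} (hR : 0 < R) (hfR : ∀ t, R < |t| → f t = 0) :
    ∃ a : ℝ, Tendsto (fun i => poleSum (E i) (w i) f) L (𝓝 a) := by
  -- write `f` as the weight of a larger radius times a continuous function
  set δ := (R + 1) ^ 2 - R ^ 2 with hδ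
  have hδ0 : 0 < δ := by rw [hδ]; ring_nf; linarith
  have hpos : ∀ t, 0 < max ((R + 1) ^ 2 - t ^ 2) δ := fun t => lt_max_of_lt_right hδ0
  obtain ⟨a, ha⟩ := h.tendsto_weight_mul (R := R + 1) (by linarith)
    (f := fun t => f t / max ((R + 1) ^ 2 - t ^ 2) δ)
    (hf.div (by fun_prop) fun t => (hpos t).ne')
  refine ⟨a, ha.congr fun i => ?_⟩
  congr 1
  funext t
  rcases le_or_gt (|t|) R with ht | ht
  · have h1 : t ^ 2 ≤ R ^ 2 := by rw [← sq_abs t]; gcongr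
    rw [weight, max_eq_left (by linarith), max_eq_left (by linarith)]
    have : (R + 1) ^ 2 - t ^ 2 ≠ 0 := by linarith
    field_simp
  · rw [hfR t ht]; simp

end IsPoleFamily

lemma exists_bound_of_hasCompactSupport {f : ℝ → ℝ} (hf : HasCompactSupport f) :
    ∃ R : ℝ, 0 < R ∧ ∀ t, R < |t| → f t = 0 := by
  obtain ⟨R, hR⟩ := hf.isCompact.isBounded.subset_closedBall 0
  refine ⟨max R 1, by positivity, fun t ht => image_eq_zero_of_notMem_tsupport fun hmem => ?_⟩
  have := hR hmem
  rw [mem_closedBall_zero_iff, Real.norm_eq_abs] at this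
  exact absurd ((le_max_left R 1).trans_lt ht) (not_lt.2 this)

/-- The pole measures converge vaguely: the limits of the integrals of compactly supported continuous
functions form a positive functional, which is represented by a measure. -/
theorem IsPoleFamily.exists_measure {ι : Type*} {L : Filter ι} {m : ι → ℂ → ℂ} {E : ι → Set ℝ}
    {w : ι → ℝ → ℝ} {mlim : ℂ → ℂ} [L.NeBot] [L.IsCountablyGenerated]
    (h : IsPoleFamily L m E w mlim) :
    ∃ μ : Measure ℝ, IsFiniteMeasureOnCompacts μ ∧ ∀ f : ℝ → ℝ, Continuous f →
      HasCompactSupport f → Tendsto (fun i => poleSum (E i) (w i) f) L (𝓝 (∫ t, f t ∂μ)) := by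
  have hex : ∀ f : CompactlySupportedContinuousMap ℝ ℝ,
      ∃ a : ℝ, Tendsto (fun i => poleSum (E i) (w i) f) L (𝓝 a) := by
    intro f
    obtain ⟨R, hR, hfR⟩ := exists_bound_of_hasCompactSupport f.hasCompactSupport
    exact h.tendsto_of_support f.continuous hR hfR
  choose Λ hΛ using hex
  let Λlin : CompactlySupportedContinuousMap ℝ ℝ →ₗ[ℝ] ℝ :=
    { toFun := Λ
      map_add' := fun f g => by
        refine tendsto_nhds_unique (hΛ (f + g)) (((hΛ f).add (hΛ g)).congr fun i => ?_)
        obtain ⟨R, hR, hfR⟩ := exists_bound_of_hasCompactSupport f.hasCompactSupport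
        obtain ⟨R', hR', hgR⟩ := exists_bound_of_hasCompactSupport g.hasCompactSupport
        exact ((h.poles i).poleSum_add (R := max R R')
          (fun t ht => hfR t ((le_max_left _ _).trans_lt ht))
          (fun t ht => hgR t ((le_max_right _ _).trans_lt ht))).symm
      map_smul' := fun k f => by
        refine tendsto_nhds_unique (hΛ (k • f)) (((hΛ f).const_mul k).congr fun i => ?_)
        obtain ⟨R, hR, hfR⟩ := exists_bound_of_hasCompactSupport f.hasCompactSupport
        exact ((h.poles i).poleSum_const_mul hfR k).symm }
  let Λpos : CompactlySupportedContinuousMap ℝ ℝ →ₚ[ℝ] ℝ := PositiveLinearMap.mk₀ Λlin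
    (fun f hf => by
      refine ge_of_tendsto' (hΛ f) fun i => ?_
      obtain ⟨R, hR, hfR⟩ := exists_bound_of_hasCompactSupport f.hasCompactSupport
      obtain ⟨F, hF⟩ := (h.poles i).exists_finset R
      rw [poleSum_eq_sum hF hfR]
      exact Finset.sum_nonneg fun t ht => mul_nonneg ((h.poles i).nonneg t ((hF t).1 ht).1) (hf t))
  refine ⟨RealRMK.rieszMeasure Λpos, inferInstance, fun f hf hfc => ?_⟩
  have := RealRMK.integral_rieszMeasure Λpos ⟨⟨f, hf⟩, hfc⟩
  change (∫ t, f t ∂(RealRMK.rieszMeasure Λpos)) = Λ ⟨⟨f, hf⟩, hfc⟩ at this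
  rw [this]
  exact hΛ ⟨⟨f, hf⟩, hfc⟩

end WeylTheory

namespace WeylTheory

/-! ### Trapezoids and the distribution function -/

/-- The trapezoid function that vanishes outside `(a, b)`, equals `1` on `[a + δ, b - δ]` and is
linear in between. -/
noncomputable def trap (a b δ t : ℝ) : ℝ := max 0 (min 1 (min ((t - a) / δ) ((b - t) / δ)))

lemma continuous_trap (a b δ : ℝ) : Continuous (trap a b δ) := by
  unfold trap; fun_prop

lemma trap_nonneg (a b δ t : ℝ) : 0 ≤ trap a b δ t := le_max_left _ _

lemma trap_le_one (a b δ t : ℝ) : trap a b δ t ≤ 1 := max_le zero_le_one (min_le_left _ _)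

lemma trap_of_le_left {a b δ t : ℝ} (hδ : 0 < δ) (ht : t ≤ a) : trap a b δ t = 0 :=
  max_eq_left ((min_le_right _ _).trans ((min_le_left _ _).trans
    (div_nonpos_of_nonpos_of_nonneg (by linarith) hδ.le)))

lemma trap_of_right_le {a b δ t : ℝ} (hδ : 0 < δ) (ht : b ≤ t) : trap a b δ t = 0 :=
  max_eq_left ((min_le_right _ _).trans ((min_le_right _ _).trans
    (div_nonpos_of_nonpos_of_nonneg (by linarith) hδ.le)))

lemma trap_eq_one {a b δ t : ℝ} (hδ : 0 < δ) (h1 : a + δ ≤ t) (h2 : t ≤ b - δ) :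
    trap a b δ t = 1 := by
  unfold trap
  rw [min_eq_left, max_eq_right zero_le_one]
  exact le_min ((one_le_div hδ).2 (by linarith)) ((one_le_div hδ).2 (by linarith))

lemma hasCompactSupport_trap {a b δ : ℝ} (hδ : 0 < δ) : HasCompactSupport (trap a b δ) := by
  refine HasCompactSupport.intro (isCompact_Icc (a := a) (b := b)) fun t ht => ?_
  rcases le_or_gt t a with h | h
  · exact trap_of_le_left hδ h
  · exact trap_of_right_le hδ (not_lt.1 fun h' => ht ⟨h.le, h'.le⟩)

lemma trap_eq_zero_of_abs {r δ t : ℝ} (hδ : 0 < δ) (ht : r < |t|) : trap (-r) r δ t = 0 := by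
  rcases lt_abs.1 ht with h | h
  · exact trap_of_right_le hδ h.le
  · exact trap_of_le_left hδ (by linarith)

lemma sign_mono : Monotone Real.sign := by
  intro x y hxy
  rcases lt_trichotomy x 0 with hx | rfl | hx
  · rw [Real.sign_of_neg hx]
    rcases Real.sign_apply_eq y with h | h | h <;> rw [h] <;> norm_num
  · rcases hxy.lt_or_eq with hy | rfl
    · rw [Real.sign_of_pos hy, Real.sign_zero]; norm_num
    · exact le_rfl
  · rw [Real.sign_of_pos hx, Real.sign_of_pos (hx.trans_le hxy)]

lemma abs_sign_le_one (x : ℝ) : |Real.sign x| ≤ 1 := by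
  rcases Real.sign_apply_eq x with h | h | h <;> rw [h] <;> norm_num

/-- The distribution function of `μ`, normalized to vanish at `0` and to take the mean of its
one-sided limits at the atoms of `μ`. The Stieltjes inversion formula holds at all points for this
normalization. -/
noncomputable def distMid (μ : Measure ℝ) (s : ℝ) : ℝ :=
  ∫ t, (Real.sign (s - t) + Real.sign t) / 2 ∂μ

section

variable {μ : Measure ℝ} [IsFiniteMeasureOnCompacts μ]

lemma integrable_sign_sub (s : ℝ) :
    Integrable (fun t => (Real.sign (s - t) + Real.sign t) / 2) μ := by
  have hms : Measurable Real.sign := sign_mono.measurable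
  have hm : Measurable fun t => (Real.sign (s - t) + Real.sign t) / 2 :=
    ((hms.comp (measurable_const.sub measurable_id)).add hms).div_const 2
  have hint : Integrable ((Icc (-|s|) |s|).indicator fun _ => (1 : ℝ)) μ :=
    (integrableOn_const (isCompact_Icc.measure_lt_top).ne).integrable_indicator measurableSet_Icc
  refine hint.mono hm.aestronglyMeasurable (Eventually.of_forall fun t => ?_)
  by_cases ht : t ∈ Icc (-|s|) |s|
  · rw [indicator_of_mem ht, Real.norm_eq_abs, norm_one, abs_div, abs_two]
    have := abs_add_le (Real.sign (s - t)) (Real.sign t)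
    have h1 := abs_sign_le_one (s - t)
    have h2 := abs_sign_le_one t
    linarith
  · rw [indicator_of_notMem ht]
    rw [mem_Icc, ← abs_le, not_le] at ht
    rcases lt_abs.1 ht with h | h
    · have h1 : s - t < 0 := by linarith [le_abs_self s]
      have h2 : 0 < t := (abs_nonneg s).trans_lt h
      rw [Real.sign_of_neg h1, Real.sign_of_pos h2]; simp
    · have h1 : 0 < s - t := by linarith [neg_abs_le s]
      have h2 : t < 0 := by linarith [abs_nonneg s]
      rw [Real.sign_of_pos h1, Real.sign_of_neg h2]; simp

lemma distMid_sub (a b : ℝ) :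
    distMid μ b - distMid μ a = ∫ t, (Real.sign (b - t) - Real.sign (a - t)) / 2 ∂μ := by
  unfold distMid
  rw [← integral_sub (integrable_sign_sub b) (integrable_sign_sub a)]
  exact integral_congr_ae (Eventually.of_forall fun t => by simp only; ring)

lemma integrable_sign_sub_sign (a b : ℝ) :
    Integrable (fun t => (Real.sign (b - t) - Real.sign (a - t)) / 2) μ :=
  ((integrable_sign_sub b).sub (integrable_sign_sub a)).congr
    (Eventually.of_forall fun t => by simp only [Pi.sub_apply]; ring)

lemma monotone_distMid : Monotone (distMid μ) := by
  intro a b hab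
  refine integral_mono (integrable_sign_sub a) (integrable_sign_sub b) fun t => ?_
  have := sign_mono (sub_le_sub_right hab t)
  simp only
  linarith

lemma distMid_sub_le_integral_trap {a b δ : ℝ} (hδ : 0 < δ) :
    distMid μ (b - 2 * δ) - distMid μ (a + 2 * δ) ≤ ∫ t, trap a b δ t ∂μ := by
  rw [distMid_sub]
  refine integral_mono (integrable_sign_sub_sign _ _)
    ((continuous_trap a b δ).integrable_of_hasCompactSupport (hasCompactSupport_trap hδ))
    fun t => ?_
  have h1 := abs_le.1 (abs_sign_le_one (b - 2 * δ - t))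
  have h2 := abs_le.1 (abs_sign_le_one (a + 2 * δ - t))
  simp only
  by_cases hcase : a + δ ≤ t ∧ t ≤ b - δ
  · rw [trap_eq_one hδ hcase.1 hcase.2]
    linarith [h1.2, h2.1]
  · refine le_trans ?_ (trap_nonneg a b δ t)
    rw [not_and_or, not_le, not_le] at hcase
    rcases hcase with h | h
    · rw [Real.sign_of_pos (show 0 < a + 2 * δ - t by linarith)]
      linarith [h1.2]
    · rw [Real.sign_of_neg (show b - 2 * δ - t < 0 by linarith)]
      linarith [h2.1]

lemma integral_trap_le_distMid_sub {a b δ : ℝ} (hab : a ≤ b) (hδ : 0 < δ) :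
    ∫ t, trap (a - δ) (b + δ) δ t ∂μ ≤ distMid μ (b + 2 * δ) - distMid μ (a - 2 * δ) := by
  rw [distMid_sub]
  refine integral_mono
    ((continuous_trap _ _ δ).integrable_of_hasCompactSupport (hasCompactSupport_trap hδ))
    (integrable_sign_sub_sign _ _) fun t => ?_
  simp only
  by_cases hcase : a - δ < t ∧ t < b + δ
  · rw [Real.sign_of_pos (show 0 < b + 2 * δ - t by linarith [hcase.2]),
      Real.sign_of_neg (show a - 2 * δ - t < 0 by linarith [hcase.1])]
    linarith [trap_le_one (a - δ) (b + δ) δ t]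
  · have h0 : trap (a - δ) (b + δ) δ t = 0 := by
      rw [not_and_or, not_lt, not_lt] at hcase
      rcases hcase with h | h
      · exact trap_of_le_left hδ h
      · exact trap_of_right_le hδ h
    rw [h0]
    have := sign_mono (show a - 2 * δ - t ≤ b + 2 * δ - t by linarith)
    linarith

end

/-- Vague convergence implies convergence of the distribution functions at continuity points. -/
lemma tendsto_poleSum_indicator {ι : Type*} {L : Filter ι} {E : ι → Set ℝ} {w : ι → ℝ → ℝ}
    {m : ι → ℂ → ℂ} (hpoles : ∀ i, HasRealPoles (m i) (E i) (w i)) {μ : Measure ℝ}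
    [IsFiniteMeasureOnCompacts μ]
    (hμ : ∀ f : ℝ → ℝ, Continuous f → HasCompactSupport f →
      Tendsto (fun i => poleSum (E i) (w i) f) L (𝓝 (∫ t, f t ∂μ)))
    {a b : ℝ} (hab : a ≤ b) (ha : ContinuousAt (distMid μ) a) (hb : ContinuousAt (distMid μ) b) :
    Tendsto (fun i => poleSum (E i) (w i) ((Ioc a b).indicator fun _ => 1)) L
      (𝓝 (distMid μ b - distMid μ a)) := by
  have hlim : ∀ k : ℝ, Tendsto (fun δ => distMid μ (b + k * δ) - distMid μ (a - k * δ)) (𝓝[>] 0)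
      (𝓝 (distMid μ b - distMid μ a)) := by
    intro k
    have h1 : Tendsto (fun δ : ℝ => b + k * δ) (𝓝[>] 0) (𝓝 b) := by
      have : Continuous fun δ : ℝ => b + k * δ := by fun_prop
      simpa using (this.tendsto 0).mono_left nhdsWithin_le_nhds
    have h2 : Tendsto (fun δ : ℝ => a - k * δ) (𝓝[>] 0) (𝓝 a) := by
      have : Continuous fun δ : ℝ => a - k * δ := by fun_prop
      simpa using (this.tendsto 0).mono_left nhdsWithin_le_nhds
    exact (hb.tendsto.comp h1).sub (ha.tendsto.comp h2)
  have hind : ∀ M t : ℝ, max |a| |b| ≤ M → M < |t| →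
      (Ioc a b).indicator (fun _ => (1 : ℝ)) t = 0 := by
    intro M t hM ht
    refine indicator_of_notMem (fun hmem => ?_) _
    have := abs_le_max_abs_abs hmem.1.le hmem.2
    linarith
  refine tendsto_order.2 ⟨fun x hx => ?_, fun x hx => ?_⟩
  · obtain ⟨δ, hxδ, hδ⟩ := (((hlim (-2)).eventually (lt_mem_nhds hx)).and
      (self_mem_nhdsWithin : Ioi (0 : ℝ) ∈ 𝓝[>] 0)).exists
    have hδ0 : (0 : ℝ) < δ := hδ
    have h1 := distMid_sub_le_integral_trap (μ := μ) (a := a) (b := b) hδ0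
    rw [show b - 2 * δ = b + -2 * δ by ring, show a + 2 * δ = a - -2 * δ by ring] at h1
    filter_upwards [(hμ _ (continuous_trap a b δ) (hasCompactSupport_trap hδ0)).eventually
      (lt_mem_nhds (hxδ.trans_le h1))] with i hi
    refine hi.trans_le ((hpoles i).poleSum_mono (R := max |a| |b|) (fun t ht => ?_)
      (fun t ht => hind _ t le_rfl ht) fun t => ?_)
    · rcases le_or_gt t a with h | h
      · exact trap_of_le_left hδ0 h
      · refine trap_of_right_le hδ0 (not_lt.1 fun h' => ?_)
        have := abs_le_max_abs_abs h.le h'.le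
        linarith
    · by_cases ht : t ∈ Ioc a b
      · rw [indicator_of_mem ht]; exact trap_le_one _ _ _ _
      · rw [indicator_of_notMem ht]
        rw [mem_Ioc, not_and_or, not_lt, not_le] at ht
        rcases ht with h | h
        · exact (trap_of_le_left hδ0 h).le
        · exact (trap_of_right_le hδ0 h.le).le
  · obtain ⟨δ, hxδ, hδ⟩ := (((hlim 2).eventually (gt_mem_nhds hx)).and
      (self_mem_nhdsWithin : Ioi (0 : ℝ) ∈ 𝓝[>] 0)).exists
    have hδ0 : (0 : ℝ) < δ := hδ
    have h1 := integral_trap_le_distMid_sub (μ := μ) hab hδ0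
    filter_upwards [(hμ _ (continuous_trap (a - δ) (b + δ) δ)
      (hasCompactSupport_trap hδ0)).eventually (gt_mem_nhds (h1.trans_lt hxδ))] with i hi
    refine lt_of_le_of_lt ((hpoles i).poleSum_mono (R := max |a - δ| |b + δ| + max |a| |b|)
      (fun t ht => hind _ t (by linarith [le_max_left |a - δ| |b + δ|, abs_nonneg (a - δ)]) ht)
      (fun t ht => ?_) fun t => ?_) hi
    · rcases le_or_gt t (a - δ) with h | h
      · exact trap_of_le_left hδ0 h
      · refine trap_of_right_le hδ0 (not_lt.1 fun h' => ?_)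
        have := abs_le_max_abs_abs h.le h'.le
        linarith [le_max_left |a| |b|, abs_nonneg a]
    · by_cases ht : t ∈ Ioc a b
      · rw [indicator_of_mem ht, trap_eq_one hδ0 (by linarith [ht.1]) (by linarith [ht.2])]
      · rw [indicator_of_notMem ht]; exact trap_nonneg _ _ _ _

/-! ### Stieltjes inversion -/

/-- The cutoff function that equals `1` on `[-r, r]` and vanishes outside `[-r - 1, r + 1]`. -/
noncomputable def cutoff (r t : ℝ) : ℝ := trap (-(r + 1)) (r + 1) 1 t

lemma cutoff_nonneg (r t : ℝ) : 0 ≤ cutoff r t := trap_nonneg _ _ _ _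

lemma cutoff_eq_one {r t : ℝ} (ht : |t| ≤ r) : cutoff r t = 1 := by
  obtain ⟨h1, h2⟩ := abs_le.1 ht
  exact trap_eq_one one_pos (by linarith) (by linarith)

lemma cutoff_eq_zero {r t : ℝ} (ht : r + 1 < |t|) : cutoff r t = 0 :=
  trap_eq_zero_of_abs one_pos ht

namespace HasRealPoles

variable {m : ℂ → ℂ} {E : Set ℝ} {w : ℝ → ℝ}

/-- Principal parts are split off with the continuous weight `cutoff r`, so that their sum is an
integral of a continuous function against the pole measure. The remainder is still analytic for
`|z| ≤ r`, where the cutoff is `1`. -/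
lemma exists_cutoff_part (h : HasRealPoles m E w) (r : ℝ) :
    ∃ (F : Finset ℝ) (K : ℂ → ℂ), (∀ t, t ∈ F ↔ t ∈ E ∧ |t| ≤ r + 1) ∧
      AnalyticOnNhd ℂ K (Metric.closedBall 0 r) ∧
      ∀ z : ℂ, z.im ≠ 0 → m z = K z + ∑ t ∈ F, ((w t * cutoff r t : ℝ) : ℂ) / (t - z) := by
  obtain ⟨F, K, hF, hK, hm⟩ := h.principal (r + 1)
  refine ⟨F, fun z => K z + ∑ t ∈ F, ((w t * (1 - cutoff r t) : ℝ) : ℂ) / (t - z), hF,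
    fun z hz => ?_, fun z hz => ?_⟩
  · refine (hK z (Metric.closedBall_subset_closedBall (by linarith) hz)).add
      (Finset.analyticAt_fun_sum _ fun t _ => ?_)
    rcases le_or_gt (|t|) r with ht | ht
    · rw [cutoff_eq_one ht]
      simp only [sub_self, mul_zero, Complex.ofReal_zero, zero_div]
      exact analyticAt_const
    · refine analyticAt_const.div (analyticAt_const.sub analyticAt_id) (sub_ne_zero.2 ?_)
      rintro (h0 : (t : ℂ) = z)
      rw [← h0, mem_closedBall_zero_iff, Complex.norm_real, Real.norm_eq_abs] at hz
      linarith
  · rw [hm z hz, add_assoc, ← Finset.sum_add_distrib]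
    congr 1
    refine Finset.sum_congr rfl fun t _ => ?_
    rw [← add_div]
    congr 1
    push_cast
    ring

lemma abs_im_le_norm_ofReal_sub (t : ℝ) (z : ℂ) : |z.im| ≤ ‖(t : ℂ) - z‖ := by
  have := Complex.abs_im_le_norm ((t : ℂ) - z)
  simpa using this

/-- Up to an error `O(ε)`, the imaginary part of `m (ν + i ε)` is the Poisson integral of the pole
measure. The remainder `K` is analytic across the real line, real there, and bounded because
`(r² - z²) K` is bounded on `|z| = r`. -/
lemma abs_im_sub_poleSum_le (h : HasRealPoles m E w) {r C M : ℝ} (hr : 0 < r)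
    (hC : ∀ z : ℂ, ‖z‖ ≤ r → z.im ≠ 0 → ‖m z‖ * |z.im| ≤ C)
    (hM : poleSum E w (cutoff r) ≤ M) {ν ε : ℝ} (hν : |ν| ≤ r / 8) (hε : 0 < ε) (hεr : ε ≤ r / 8) :
    |(m (ν + ε * Complex.I)).im -
      poleSum E w (fun t => cutoff r t * (ε / ((t - ν) ^ 2 + ε ^ 2)))| ≤
      2 * r * (C + M) / (3 / 4 * r ^ 2) / (r / 4) * ε := by
  obtain ⟨F, K, hF, hK, hm⟩ := h.exists_cutoff_part r
  have hcut : ∀ t, 0 ≤ cutoff r t := cutoff_nonneg r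
  have hw : ∀ t ∈ F, 0 ≤ w t * cutoff r t := fun t ht =>
    mul_nonneg (h.nonneg t ((hF t).1 ht).1) (hcut t)
  rw [poleSum_eq_sum hF fun t ht => cutoff_eq_zero ht] at hM
  set S : ℂ → ℂ := fun z => ∑ t ∈ F, ((w t * cutoff r t : ℝ) : ℂ) / (t - z) with hS
  have hSbound : ∀ z : ℂ, z.im ≠ 0 → ‖S z‖ * |z.im| ≤ M := by
    intro z hz
    refine le_trans ?_ hM
    calc ‖S z‖ * |z.im| ≤ (∑ t ∈ F, ‖((w t * cutoff r t : ℝ) : ℂ) / (t - z)‖) * |z.im| := by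
          gcongr; exact norm_sum_le _ _
      _ = ∑ t ∈ F, ‖((w t * cutoff r t : ℝ) : ℂ) / (t - z)‖ * |z.im| := Finset.sum_mul _ _ _
      _ ≤ ∑ t ∈ F, w t * cutoff r t := by
          refine Finset.sum_le_sum fun t ht => ?_
          have h0 : 0 < |z.im| := abs_pos.2 hz
          have h1 := abs_im_le_norm_ofReal_sub t z
          rw [norm_div, Complex.norm_real, Real.norm_eq_abs, abs_of_nonneg (hw t ht), div_mul_eq_mul_div,
            div_le_iff₀ (h0.trans_le h1)]
          exact mul_le_mul_of_nonneg_left h1 (hw t ht)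
  have hSconj : ∀ z : ℂ, S ((starRingEnd ℂ) z) = (starRingEnd ℂ) (S z) := by
    intro z
    simp only [hS, map_sum, map_div₀, map_sub, Complex.conj_ofReal]
  have hKconj : ∀ z : ℂ, z.im ≠ 0 → K ((starRingEnd ℂ) z) = (starRingEnd ℂ) (K z) := by
    intro z hz
    have h1 := hm z hz
    have h2 := hm ((starRingEnd ℂ) z) (by simpa using hz)
    rw [h.conj z hz, h1, map_add] at h2
    have h3 := hSconj z
    simp only [hS] at h3
    rw [h3] at h2
    exact (add_right_cancel h2).symm
  set B := 2 * r * (C + M) with hB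
  have hG : ∀ z : ℂ, ‖z‖ ≤ r → ‖((r : ℂ) ^ 2 - z ^ 2) * K z‖ ≤ B := by
    have hd : DiffContOnCl ℂ (fun z => ((r : ℂ) ^ 2 - z ^ 2) * K z) (Metric.ball 0 r) := by
      refine DifferentiableOn.diffContOnCl fun z hz => ?_
      rw [closure_ball _ hr.ne'] at hz
      exact ((differentiableAt_const _).sub (differentiableAt_id.pow 2)).mul
        (hK z hz).differentiableAt |>.differentiableWithinAt
    have hsph : ∀ z ∈ frontier (Metric.ball (0 : ℂ) r), ‖((r : ℂ) ^ 2 - z ^ 2) * K z‖ ≤ B := by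
      intro z hz
      rw [frontier_ball _ hr.ne', mem_sphere_zero_iff_norm] at hz
      have hCM : 0 ≤ C + M := by
        have h1 := hC (r * Complex.I) (by simp [abs_of_pos hr]) (by simp [hr.ne'])
        have h2 := hSbound (r * Complex.I) (by simp [hr.ne'])
        have h3 : 0 ≤ ‖m (r * Complex.I)‖ * |((r : ℂ) * Complex.I).im| := by positivity
        have h4 : 0 ≤ ‖S (r * Complex.I)‖ * |((r : ℂ) * Complex.I).im| := by positivity
        linarith
      rw [norm_mul, norm_sq_sub_sq_of_mem_sphere hz]
      by_cases him : z.im = 0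
      · rw [him, abs_zero, mul_zero, zero_mul]; positivity
      · have e : K z = m z - S z := by rw [hm z him]; simp only [hS]; ring
        have h1 := hC z hz.le him
        have h2 := hSbound z him
        calc 2 * r * |z.im| * ‖K z‖ ≤ 2 * r * |z.im| * (‖m z‖ + ‖S z‖) := by
              rw [e]; gcongr; exact norm_sub_le _ _
          _ = 2 * r * (‖m z‖ * |z.im| + ‖S z‖ * |z.im|) := by ring
          _ ≤ B := by rw [hB]; gcongr
    intro z hz
    refine Complex.norm_le_of_forall_mem_frontier_norm_le Metric.isBounded_ball hd hsph ?_
    rw [closure_ball _ hr.ne', mem_closedBall_zero_iff]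
    exact hz
  have hKb : ∀ z : ℂ, ‖z‖ ≤ r / 2 → ‖K z‖ ≤ B / (3 / 4 * r ^ 2) := by
    intro z hz
    have h1 := hG z (by linarith)
    have h2 : 3 / 4 * r ^ 2 ≤ ‖(r : ℂ) ^ 2 - z ^ 2‖ := by
      have h3 := norm_sub_norm_le ((r : ℂ) ^ 2) (z ^ 2)
      rw [norm_pow, norm_pow, Complex.norm_real, Real.norm_eq_abs, abs_of_pos hr] at h3
      have h4 : ‖z‖ ^ 2 ≤ (r / 2) ^ 2 := by gcongr
      nlinarith
    rw [le_div_iff₀ (by positivity)]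
    rw [norm_mul] at h1
    calc ‖K z‖ * (3 / 4 * r ^ 2) ≤ ‖K z‖ * ‖(r : ℂ) ^ 2 - z ^ 2‖ := by gcongr
      _ ≤ B := by rw [mul_comm]; exact h1
  set A := B / (3 / 4 * r ^ 2) with hA
  have hderiv : ∀ z ∈ Metric.closedBall (0 : ℂ) (r / 4), ‖deriv K z‖ ≤ A / (r / 4) := by
    intro z hz
    rw [mem_closedBall_zero_iff] at hz
    have hnorm : ∀ z' ∈ Metric.closedBall z (r / 4), ‖z'‖ ≤ r / 2 := by
      intro z' hz'
      rw [mem_closedBall_iff_norm] at hz'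
      have := norm_add_le (z' - z) z
      rw [sub_add_cancel] at this
      linarith
    refine Complex.norm_deriv_le_of_forall_mem_sphere_norm_le (by positivity)
      (DifferentiableOn.diffContOnCl fun z' hz' => ?_)
      fun z' hz' => hKb z' (hnorm z' (Metric.sphere_subset_closedBall hz'))
    rw [closure_ball _ (by positivity)] at hz'
    exact (hK z' (by
      rw [mem_closedBall_zero_iff]
      linarith [hnorm z' hz'])).differentiableAt.differentiableWithinAt
  set z : ℂ := ν + ε * Complex.I with hz
  have hzim : z.im = ε := by simp [hz]
  have hzre : z.re = ν := by simp [hz]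
  have hzim0 : z.im ≠ 0 := by rw [hzim]; exact hε.ne'
  have hzn : ‖z‖ ≤ r / 4 := by
    have := Complex.norm_le_abs_re_add_abs_im z
    rw [hzim, hzre, abs_of_pos hε] at this
    linarith
  -- mean value inequality on the segment from `conj z` to `z`, where `K (conj z) = conj (K z)`
  have hKim : |(K z).im| ≤ A / (r / 4) * ε := by
    have h1 := (convex_closedBall (0 : ℂ) (r / 4)).norm_image_sub_le_of_norm_deriv_le
      (f := K) (x := (starRingEnd ℂ) z) (y := z) (C := A / (r / 4))
      (fun z' hz' => (hK z' (Metric.closedBall_subset_closedBall (by linarith) hz')).differentiableAt)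
      hderiv (by rw [mem_closedBall_zero_iff, Complex.norm_conj]; exact hzn)
      (by rw [mem_closedBall_zero_iff]; exact hzn)
    rw [hKconj z hzim0, Complex.sub_conj, Complex.sub_conj, norm_mul, norm_mul, Complex.norm_I,
      Complex.norm_real, Complex.norm_real, mul_one, mul_one, hzim, Real.norm_eq_abs,
      Real.norm_eq_abs, abs_mul, abs_mul, abs_two, abs_of_pos hε] at h1
    linarith
  have hSim : (S z).im = poleSum E w (fun t => cutoff r t * (ε / ((t - ν) ^ 2 + ε ^ 2))) := by
    rw [poleSum_eq_sum hF fun t ht => by rw [cutoff_eq_zero ht, zero_mul]]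
    simp only [hS, Complex.im_sum]
    refine Finset.sum_congr rfl fun t _ => ?_
    rw [div_eq_mul_inv, Complex.im_ofReal_mul, Complex.inv_im, Complex.normSq_apply]
    simp only [Complex.sub_re, Complex.sub_im, Complex.ofReal_re, Complex.ofReal_im, hzim, hzre]
    rw [mul_assoc]
    congr 2
    ring
  have he : (m z).im - (S z).im = (K z).im := by
    rw [hm z hzim0, Complex.add_im]
    simp only [hS]
    ring
  rw [← hSim, he]
  exact hKim

end HasRealPoles

/-- The limit at `x = 0` is `0`; this is why the inversion formula gives the mean of the one-sided
limits at an atom. -/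
lemma tendsto_arctan_div (x : ℝ) :
    Tendsto (fun ε => Real.arctan (x / ε)) (𝓝[>] 0) (𝓝 (Real.pi / 2 * Real.sign x)) := by
  rcases lt_trichotomy x 0 with hx | rfl | hx
  · rw [Real.sign_of_neg hx, mul_neg_one]
    have h1 : Tendsto (fun ε : ℝ => x / ε) (𝓝[>] 0) atBot := by
      simp only [div_eq_mul_inv]
      exact tendsto_inv_nhdsGT_zero.const_mul_atTop_of_neg hx
    exact (Real.tendsto_arctan_atBot.mono_right nhdsWithin_le_nhds).comp h1
  · simp
  · rw [Real.sign_of_pos hx, mul_one]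
    have h1 : Tendsto (fun ε : ℝ => x / ε) (𝓝[>] 0) atTop := by
      simp only [div_eq_mul_inv]
      exact tendsto_inv_nhdsGT_zero.const_mul_atTop hx
    exact (Real.tendsto_arctan_atTop.mono_right nhdsWithin_le_nhds).comp h1

lemma integral_poisson (a b t : ℝ) {ε : ℝ} (hε : 0 < ε) :
    (∫ ν in a..b, ε / ((t - ν) ^ 2 + ε ^ 2)) =
      Real.arctan ((b - t) / ε) - Real.arctan ((a - t) / ε) := by
  have hpos : ∀ ν : ℝ, (t - ν) ^ 2 + ε ^ 2 ≠ 0 := fun ν => by positivity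
  refine intervalIntegral.integral_eq_sub_of_hasDerivAt (f := fun ν => Real.arctan ((ν - t) / ε))
    (fun ν _ => ?_) ?_
  · have h1 : HasDerivAt (fun ν : ℝ => (ν - t) / ε) (1 / ε) ν :=
      ((hasDerivAt_id ν).sub_const t).div_const ε
    have h2 := h1.arctan
    convert! h2 using 1
    have := hpos ν
    have h3 : (ε ^ 2 + (ν - t) ^ 2) ≠ 0 := by positivity
    field_simp
    ring
  · exact (Continuous.div (by fun_prop) (by fun_prop) hpos).intervalIntegrable _ _

namespace IsPoleFamily

variable {ι : Type*} {L : Filter ι} {m : ι → ℂ → ℂ} {E : ι → Set ℝ} {w : ι → ℝ → ℝ} {mlim : ℂ → ℂ}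

lemma intervalIntegrable_im [L.NeBot] [L.IsCountablyGenerated] (h : IsPoleFamily L m E w mlim)
    {ε : ℝ} (hε : 0 < ε) (a b : ℝ) :
    IntervalIntegrable (fun ν : ℝ => (mlim (ν + ε * Complex.I)).im) volume a b := by
  have him : ∀ ν : ℝ, ((ν : ℂ) + ε * Complex.I).im = ε := fun ν => by simp
  have him0 : ∀ ν : ℝ, ((ν : ℂ) + ε * Complex.I).im ≠ 0 := fun ν => by rw [him]; exact hε.ne'
  have hmeas : AEStronglyMeasurable (fun ν : ℝ => (mlim (ν + ε * Complex.I)).im) volume := by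
    refine aestronglyMeasurable_of_tendsto_ae L
      (f := fun i (ν : ℝ) => (m i (ν + ε * Complex.I)).im) (fun i => ?_)
      (Eventually.of_forall fun ν => (Complex.continuous_im.tendsto _).comp (h.lim _ (him0 ν)))
    refine Continuous.aestronglyMeasurable (continuous_iff_continuousAt.2 fun ν => ?_)
    have h1 : Continuous fun ν : ℝ => (ν : ℂ) + ε * Complex.I := by fun_prop
    exact Complex.continuous_im.continuousAt.comp
      (((h.poles i).continuousAt (him0 ν)).comp (f := fun ν : ℝ => (ν : ℂ) + ε * Complex.I)
        h1.continuousAt)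
  obtain ⟨C, hC⟩ := h.bound (max |a| |b| + ε)
  refine intervalIntegrable_const (c := C / ε) |>.mono_fun hmeas.restrict ?_
  refine (ae_restrict_iff' measurableSet_uIoc).2 (Eventually.of_forall fun ν hν => ?_)
  have hνab : |ν| ≤ max |a| |b| := by
    have := uIoc_subset_uIcc hν
    rw [uIcc, mem_Icc] at this
    have h1 := abs_le_max_abs_abs this.1 this.2
    refine h1.trans (max_le ?_ ?_)
    · rcases min_choice a b with h | h <;> rw [h]
      · exact le_max_left _ _
      · exact le_max_right _ _
    · rcases max_choice a b with h | h <;> rw [h]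
      · exact le_max_left _ _
      · exact le_max_right _ _
  have hn : ‖(ν : ℂ) + ε * Complex.I‖ ≤ max |a| |b| + ε := by
    have := Complex.norm_le_abs_re_add_abs_im ((ν : ℂ) + ε * Complex.I)
    rw [him, abs_of_pos hε] at this
    simp only [Complex.add_re, Complex.ofReal_re, Complex.mul_re, Complex.I_re, mul_zero,
      Complex.ofReal_im, zero_mul, sub_zero, add_zero] at this
    linarith
  have hle : ‖mlim (ν + ε * Complex.I)‖ ≤ C / ε := by
    refine le_of_tendsto (h.lim _ (him0 ν)).norm (Eventually.of_forall fun i => ?_)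
    rw [le_div_iff₀ hε]
    have := hC i _ hn (him0 ν)
    rwa [him, abs_of_pos hε] at this
  calc ‖(mlim (ν + ε * Complex.I)).im‖ ≤ ‖mlim (ν + ε * Complex.I)‖ := Complex.abs_im_le_norm _
    _ ≤ C / ε := hle
    _ ≤ ‖C / ε‖ := le_abs_self _

/-- In the limit, the imaginary part of `mlim (ν + i ε)` is the Poisson integral of the limit
measure up to an error `O(ε)`. -/
lemma exists_abs_im_sub_integral_le [L.NeBot] (h : IsPoleFamily L m E w mlim) {μ : Measure ℝ}
    (hμ : ∀ f : ℝ → ℝ, Continuous f → HasCompactSupport f →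
      Tendsto (fun i => poleSum (E i) (w i) f) L (𝓝 (∫ t, f t ∂μ))) {r : ℝ} (hr : 0 < r) :
    ∃ B : ℝ, ∀ ν ε : ℝ, |ν| ≤ r / 8 → 0 < ε → ε ≤ r / 8 →
      |(mlim (ν + ε * Complex.I)).im -
        ∫ t, cutoff r t * (ε / ((t - ν) ^ 2 + ε ^ 2)) ∂μ| ≤ B * ε := by
  obtain ⟨C, hC⟩ := h.bound r
  have hcc : Continuous (cutoff r) := continuous_trap _ _ _
  have hcs : HasCompactSupport (cutoff r) := hasCompactSupport_trap one_pos
  have hev := (hμ _ hcc hcs).eventually (gt_mem_nhds (lt_add_one _))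
  refine ⟨2 * r * (C + ((∫ t, cutoff r t ∂μ) + 1)) / (3 / 4 * r ^ 2) / (r / 4),
    fun ν ε hν hε hεr => ?_⟩
  have hcont : Continuous fun t => cutoff r t * (ε / ((t - ν) ^ 2 + ε ^ 2)) :=
    hcc.mul (Continuous.div (by fun_prop) (by fun_prop) fun t => by positivity)
  have h1 := hμ _ hcont (hcs.mul_right)
  have h2 := (Complex.continuous_im.tendsto _).comp
    (h.lim (ν + ε * Complex.I) (by simp [hε.ne']))
  refine le_of_tendsto (h2.sub h1).abs ?_
  filter_upwards [hev] with i hi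
  exact (h.poles i).abs_im_sub_poleSum_le hr (hC i) hi.le hν hε hεr

/-- The Stieltjes inversion formula, at all points `a`, `b`, including the atoms of `μ`. -/
theorem tendsto_integral_im [L.NeBot] [L.IsCountablyGenerated] (h : IsPoleFamily L m E w mlim)
    {μ : Measure ℝ} [IsFiniteMeasureOnCompacts μ]
    (hμ : ∀ f : ℝ → ℝ, Continuous f → HasCompactSupport f →
      Tendsto (fun i => poleSum (E i) (w i) f) L (𝓝 (∫ t, f t ∂μ))) (a b : ℝ) :
    Tendsto (fun ε : ℝ => (1 / Real.pi) * ∫ ν in a..b, (mlim (ν + ε * Complex.I)).im) (𝓝[>] 0)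
      (𝓝 (distMid μ b - distMid μ a)) := by
  set r : ℝ := 8 * (max |a| |b| + 1) with hr
  have hab0 : 0 ≤ max |a| |b| := le_max_of_le_left (abs_nonneg a)
  have hr0 : 0 < r := by positivity
  have ha : |a| ≤ r / 8 := by rw [hr]; linarith [le_max_left |a| |b|]
  have hb : |b| ≤ r / 8 := by rw [hr]; linarith [le_max_right |a| |b|]
  obtain ⟨B, hB⟩ := h.exists_abs_im_sub_integral_le hμ hr0
  have hcc : Continuous (cutoff r) := continuous_trap _ _ _
  have hcs : HasCompactSupport (cutoff r) := hasCompactSupport_trap one_pos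
  have hci : Integrable (cutoff r) μ := hcc.integrable_of_hasCompactSupport hcs
  set I : ℝ → ℝ := fun ε => ∫ t, cutoff r t *
    (Real.arctan ((b - t) / ε) - Real.arctan ((a - t) / ε)) ∂μ with hI
  -- the Poisson integral converges by dominated convergence
  have hIlim : Tendsto I (𝓝[>] 0) (𝓝 (Real.pi * (distMid μ b - distMid μ a))) := by
    have e : Real.pi * (distMid μ b - distMid μ a) =
        ∫ t, cutoff r t * (Real.pi / 2 * Real.sign (b - t) - Real.pi / 2 * Real.sign (a - t)) ∂μ := by
      rw [distMid_sub, ← integral_const_mul]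
      refine integral_congr_ae (Eventually.of_forall fun t => ?_)
      simp only
      rcases le_or_gt (|t|) r with ht | ht
      · rw [cutoff_eq_one ht]; ring
      · have h1 := abs_le.1 ha
        have h2 := abs_le.1 hb
        have : Real.sign (b - t) = Real.sign (a - t) := by
          rcases lt_abs.1 ht with h | h
          · rw [Real.sign_of_neg (by linarith), Real.sign_of_neg (by linarith)]
          · rw [Real.sign_of_pos (by linarith), Real.sign_of_pos (by linarith)]
        rw [this]; ring
    rw [e]
    refine tendsto_integral_filter_of_dominated_convergence (fun t => cutoff r t * Real.pi)
      (Eventually.of_forall fun ε => ?_) (Eventually.of_forall fun ε => Eventually.of_forall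
        fun t => ?_) (hci.mul_const _) (Eventually.of_forall fun t => ?_)
    · exact (hcc.mul (by fun_prop)).aestronglyMeasurable
    · rw [norm_mul, Real.norm_eq_abs, abs_of_nonneg (cutoff_nonneg r t),
        Real.norm_eq_abs]
      refine mul_le_mul_of_nonneg_left ?_ (cutoff_nonneg r t)
      have h1 := Real.arctan_lt_pi_div_two ((b - t) / ε)
      have h2 := Real.neg_pi_div_two_lt_arctan ((b - t) / ε)
      have h3 := Real.arctan_lt_pi_div_two ((a - t) / ε)
      have h4 := Real.neg_pi_div_two_lt_arctan ((a - t) / ε)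
      rw [abs_le]
      constructor <;> linarith
    · exact ((tendsto_arctan_div (b - t)).sub (tendsto_arctan_div (a - t))).const_mul _
  -- Fubini
  have hfub : ∀ ε > 0, IntervalIntegrable
      (fun ν => ∫ t, cutoff r t * (ε / ((t - ν) ^ 2 + ε ^ 2)) ∂μ) volume a b ∧
      (∫ ν in a..b, ∫ t, cutoff r t * (ε / ((t - ν) ^ 2 + ε ^ 2)) ∂μ) = I ε := by
    intro ε hε
    have hden : ∀ x : ℝ, x ^ 2 + ε ^ 2 ≠ 0 := fun x => by positivity
    have hintg : ∀ A : Set ℝ, volume A ≠ ⊤ →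
        Integrable (Function.uncurry fun ν t => cutoff r t * (ε / ((t - ν) ^ 2 + ε ^ 2)))
        ((volume.restrict A).prod μ) := by
      intro A hA
      have : IsFiniteMeasure (volume.restrict A) := ⟨by
        rw [Measure.restrict_apply_univ]; exact hA.lt_top⟩
      have hbd : Integrable (fun z : ℝ × ℝ => ε⁻¹ * cutoff r z.2) ((volume.restrict A).prod μ) :=
        (integrable_const (μ := volume.restrict A) (ε⁻¹)).mul_prod hci
      refine hbd.mono (Continuous.aestronglyMeasurable ?_) (Eventually.of_forall fun z => ?_)
      · exact (hcc.comp continuous_snd).mul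
          (continuous_const.div (by fun_prop) fun z => hden (z.2 - z.1))
      · have hc0 : 0 ≤ cutoff r z.2 := cutoff_nonneg r z.2
        have hp : 0 < (z.2 - z.1) ^ 2 + ε ^ 2 := by positivity
        simp only [Function.uncurry]
        rw [Real.norm_eq_abs, Real.norm_eq_abs, abs_of_nonneg (by positivity),
          abs_of_nonneg (by positivity), mul_comm]
        refine mul_le_mul_of_nonneg_right ?_ hc0
        rw [div_le_iff₀ hp, inv_mul_eq_div, le_div_iff₀ hε]
        nlinarith [sq_nonneg (z.2 - z.1)]
    constructor
    · refine ⟨?_, ?_⟩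
      · exact (hintg (Ioc a b) measure_Ioc_lt_top.ne).integral_prod_left
      · exact (hintg (Ioc b a) measure_Ioc_lt_top.ne).integral_prod_left
    · have hint2 : Integrable (Function.uncurry fun ν t => cutoff r t * (ε / ((t - ν) ^ 2 + ε ^ 2)))
          ((volume.restrict (uIoc a b)).prod μ) := hintg _ measure_Ioc_lt_top.ne
      rw [intervalIntegral_integral_swap hint2]
      refine integral_congr_ae (Eventually.of_forall fun t => ?_)
      simp only
      rw [intervalIntegral.integral_const_mul, integral_poisson a b t hε]
  have hdiff : Tendsto (fun ε : ℝ => (∫ ν in a..b, (mlim (ν + ε * Complex.I)).im) - I ε) (𝓝[>] 0)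
      (𝓝 0) := by
    have hz : Tendsto (fun ε : ℝ => B * ε * |b - a|) (𝓝[>] 0) (𝓝 0) := by
      have : Continuous fun ε : ℝ => B * ε * |b - a| := by fun_prop
      simpa using (this.tendsto 0).mono_left nhdsWithin_le_nhds
    refine squeeze_zero_norm' ?_ hz
    filter_upwards [Ioc_mem_nhdsGT (show (0 : ℝ) < r / 8 by positivity)] with ε hε
    obtain ⟨h1, h2⟩ := hfub ε hε.1
    rw [← h2, ← intervalIntegral.integral_sub (h.intervalIntegrable_im hε.1 a b) h1]
    refine intervalIntegral.norm_integral_le_of_norm_le_const fun ν hν => ?_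
    refine hB ν ε ?_ hε.1 hε.2
    have h3 := abs_le.1 ha
    have h4 := abs_le.1 hb
    have := uIoc_subset_uIcc hν
    rw [uIcc, mem_Icc] at this
    exact abs_le.2 ⟨(le_min h3.1 h4.1).trans this.1, this.2.trans (max_le h3.2 h4.2)⟩
  have := (hdiff.add hIlim).const_mul (1 / Real.pi)
  simp only [sub_add_cancel, zero_add] at this
  rwa [← mul_assoc, one_div, inv_mul_cancel₀ Real.pi_ne_zero, one_mul, ← one_div] at this

end IsPoleFamily

end WeylTheory

namespace WeylTheory

/-! ### The spectral function -/

variable {p q : ℝ → ℝ} {c : ℝ}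

/-- The two sums in `spectralFunction` are sums over one finite set `F` of eigenvalues. -/
lemma spectralFunction_eq_sum {α b β : ℝ} {R : ℝ} {F : Finset ℝ}
    (hF : ∀ t, t ∈ F ↔ t ∈ eigenvalues p q c α b β ∧ |t| ≤ R) {s : ℝ} (hs : |s| ≤ R) :
    spectralFunction p q c α b β s = ∑ t ∈ F, jump p q c α b t *
      ((Ioc 0 s).indicator (fun _ => 1) t - (Ioc s 0).indicator (fun _ => 1) t) := by
  have hR : 0 ≤ R := (abs_nonneg s).trans hs
  have key : ∀ u v : ℝ, |u| ≤ R → |v| ≤ R →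
      (∑' t : ↥(eigenvalues p q c α b β ∩ Ioc u v), jump p q c α b t) =
        ∑ t ∈ F, jump p q c α b t * (Ioc u v).indicator (fun _ => 1) t := by
    intro u v hu hv
    have he : eigenvalues p q c α b β ∩ Ioc u v = ↑(F.filter (· ∈ Ioc u v)) := by
      ext t
      simp only [mem_inter_iff, Finset.coe_filter, mem_ofPred_eq, hF]
      refine ⟨fun ⟨h1, h2⟩ => ⟨⟨h1, ?_⟩, h2⟩, fun ⟨h1, h2⟩ => ⟨h1.1, h2⟩⟩
      exact (abs_le_max_abs_abs h2.1.le h2.2).trans (max_le hu hv)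
    rw [he, Finset.tsum_subtype' (F.filter (· ∈ Ioc u v)) (fun t => jump p q c α b t),
      Finset.sum_filter]
    refine Finset.sum_congr rfl fun t _ => ?_
    by_cases h : t ∈ Ioc u v
    · rw [if_pos h, indicator_of_mem h, mul_one]
    · rw [if_neg h, indicator_of_notMem h, mul_zero]
  have h0 : |(0 : ℝ)| ≤ R := by rwa [abs_zero]
  rw [spectralFunction, key 0 s h0 hs, key s 0 hs h0, ← Finset.sum_sub_distrib]
  exact Finset.sum_congr rfl fun t _ => by ring

lemma spectralFunction_sub (h : RegularCoeff p q c) (α β : ℝ) {b : ℝ} (hb : c < b) {s t : ℝ}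
    (hst : s ≤ t) :
    spectralFunction p q c α b β t - spectralFunction p q c α b β s =
      poleSum (eigenvalues p q c α b β) (jump p q c α b) ((Ioc s t).indicator fun _ => 1) := by
  obtain ⟨F, hF⟩ := (hasRealPoles_weylM h α β hb).exists_finset (max |s| |t|)
  rw [spectralFunction_eq_sum hF (le_max_right _ _), spectralFunction_eq_sum hF (le_max_left _ _),
    poleSum_eq_sum hF (fun r hr => indicator_of_notMem
      (fun hmem => (abs_le_max_abs_abs hmem.1.le hmem.2).not_gt hr) _),
    ← Finset.sum_sub_distrib]
  refine Finset.sum_congr rfl fun r _ => ?_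
  rw [← mul_sub]
  congr 1
  simp only [indicator, mem_Ioc]
  split_ifs <;> first | (norm_num; done) | (exfalso; grind)

/-- Two monotone functions whose increments agree between common continuity points differ by a
constant at the continuity points of the first. -/
lemma exists_const_of_increments_eq {ρ σ : ℝ → ℝ} (hρ : Monotone ρ) (hσ : Monotone σ)
    (h : ∀ s t, ContinuousAt ρ s → ContinuousAt σ s → ContinuousAt ρ t → ContinuousAt σ t →
      σ s - σ t = ρ s - ρ t) :
    ∃ C : ℝ, ∀ s, ContinuousAt ρ s → σ s = ρ s + C := by
  set A : Set ℝ := {s | ContinuousAt ρ s ∧ ContinuousAt σ s} with hA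
  have hdense : Dense A := by
    have hc : (Aᶜ).Countable := by
      refine (hρ.countable_not_continuousAt.union hσ.countable_not_continuousAt).mono fun s hs => ?_
      simp only [hA, mem_compl_iff, mem_ofPred_eq, not_and_or] at hs
      exact hs
    simpa using hc.dense_compl ℝ
  obtain ⟨s₀, hs₀⟩ := hdense.nonempty
  refine ⟨σ s₀ - ρ s₀, fun s hs => ?_⟩
  have hval : ∀ t ∈ A, σ t = ρ t + (σ s₀ - ρ s₀) := fun t ht => by
    have := h t s₀ ht.1 ht.2 hs₀.1 hs₀.2
    linarith
  refine le_antisymm (le_of_forall_pos_le_add fun ε hε => ?_)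
    (le_of_forall_pos_le_add fun ε hε => ?_)
  · obtain ⟨δ, hδ, hδs⟩ := Metric.continuousAt_iff.1 hs ε hε
    obtain ⟨t, ht, h1, h2⟩ := hdense.exists_between (show s < s + δ by linarith)
    have h3 := hδs (show dist t s < δ by rw [Real.dist_eq, abs_lt]; constructor <;> linarith)
    rw [Real.dist_eq, abs_lt] at h3
    have h4 := hσ h1.le
    rw [hval t ht] at h4
    linarith [h3.2]
  · obtain ⟨δ, hδ, hδs⟩ := Metric.continuousAt_iff.1 hs ε hε
    obtain ⟨t, ht, h1, h2⟩ := hdense.exists_between (show s - δ < s by linarith)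
    have h3 := hδs (show dist t s < δ by rw [Real.dist_eq, abs_lt]; constructor <;> linarith)
    rw [Real.dist_eq, abs_lt] at h3
    have h4 := hσ h2.le
    rw [hval t ht] at h4
    linarith [h3.1]

/-- The Weyl functions of the intervals `[c, b]`, as a family in `b` and the boundary angle `β`.
They converge to the limit point as `b → ∞`, uniformly in `β`, because they lie on the Weyl
circles. The index `(b, β)` is subject to `b → ∞` only; for `b ≤ c + 1` the interval is replaced by
`[c, c + 1]`, so that every member of the family is a Weyl function. -/
lemma isPoleFamily_weylM (h : RegularCoeff p q c) (α : ℝ) {mlim : ℂ → ℂ}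
    (hm : ∀ l : ℂ, l.im ≠ 0 → IsWeylLimitPoint p q c α l (mlim l)) :
    IsPoleFamily (comap Prod.fst atTop : Filter (ℝ × ℝ))
      (fun i => weylM p q c α (max i.1 (c + 1)) i.2)
      (fun i => eigenvalues p q c α (max i.1 (c + 1)) i.2)
      (fun i => jump p q c α (max i.1 (c + 1))) mlim := by
  have hb : ∀ b : ℝ, c < max b (c + 1) := fun b => lt_max_of_lt_right (lt_add_one c)
  refine ⟨fun i => hasRealPoles_weylM h α i.2 (hb i.1), fun R => ?_, fun z hz => ?_⟩
  · obtain ⟨C, hC⟩ := exists_norm_mul_im_le h α (lt_add_one c) R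
    exact ⟨C, fun i z hzR hz => hC _ (le_max_right _ _) z hzR hz _
      (weylCircle_subset_weylDisc h α hz (hb i.1).le (weylM_mem_weylCircle h α i.2 (hb i.1) hz))⟩
  · intro u hu
    have h1 := tendsto_smallSets_iff.1 (hm z hz).2 u hu
    have h2 : ∀ᶠ i : ℝ × ℝ in comap Prod.fst atTop, weylCircle p q c α z i.1 ⊆ u :=
      tendsto_comap.eventually h1
    have h3 : ∀ᶠ i : ℝ × ℝ in comap Prod.fst atTop, c + 1 ≤ i.1 :=
      tendsto_comap.eventually (eventually_ge_atTop (c + 1))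
    change ∀ᶠ i : ℝ × ℝ in comap Prod.fst atTop, weylM p q c α (max i.1 (c + 1)) i.2 z ∈ u
    filter_upwards [h2, h3] with i hi hi'
    have h4 := weylM_mem_weylCircle h α i.2 (hb i.1) hz
    rw [max_eq_left hi'] at h4
    rw [max_eq_left hi']
    exact hi h4

end WeylTheory

open WeylTheory in
theorem theorem2p9 (p q : ℝ → ℝ) (c α : ℝ) (hc : 0 < c) (hα : α ∈ Set.Ico 0 Real.pi)
    (hp : ∀ r ∈ Set.Ici c, 0 < p r)
    (hpinv : MeasureTheory.LocallyIntegrableOn (fun r => (p r)⁻¹) (Set.Ici c))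
    (hq : MeasureTheory.LocallyIntegrableOn q (Set.Ici c))
    (hL : WeylTheory.LimitPointAtInfinity p q c) :
    ∃ (m : ℂ → ℂ) (ρ : ℝ → ℝ),
      (∀ l : ℂ, l.im ≠ 0 → WeylTheory.IsWeylLimitPoint p q c α l (m l)) ∧
      Monotone ρ ∧
      (∀ β : ℝ → ℝ, (∀ b, β b ∈ Set.Ico 0 Real.pi) →
        WeylTheory.IsLimitOfSpectralFunctions p q c α β ρ) ∧
      (∀ (β : ℝ → ℝ) (σ : ℝ → ℝ), (∀ b, β b ∈ Set.Ico 0 Real.pi) → Monotone σ →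
        WeylTheory.IsLimitOfSpectralFunctions p q c α β σ →
        ∃ C : ℝ, ∀ s, ContinuousAt ρ s → σ s = ρ s + C) ∧
      (∀ (ε : ℝ), 0 < ε → ∀ s t : ℝ, IntervalIntegrable
        (fun ν : ℝ => (m ((ν : ℂ) + (ε : ℂ) * Complex.I)).im) MeasureTheory.volume t s) ∧
      (∀ s t : ℝ, Filter.Tendsto
        (fun ε : ℝ => (1 / Real.pi) * ∫ ν in t..s, (m ((ν : ℂ) + (ε : ℂ) * Complex.I)).im)
        (nhdsWithin 0 (Set.Ioi 0)) (nhds (ρ s - ρ t))) := by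
  have hint : ∀ {f : ℝ → ℝ}, LocallyIntegrableOn f (Ici c) → ∀ b, c ≤ b →
      IntervalIntegrable f volume c b := by
    intro f hf b hb
    rw [intervalIntegrable_iff_integrableOn_Icc_of_le hb]
    exact (hf.mono_set Icc_subset_Ici_self).integrableOn_isCompact isCompact_Icc
  have h : RegularCoeff p q c := ⟨hp, hint hpinv, hint hq⟩
  choose! m hm using fun (l : ℂ) (hl : l.im ≠ 0) => exists_isWeylLimitPoint h hL α hl
  have hfam := isPoleFamily_weylM h α hm
  have hne : (comap Prod.fst atTop : Filter (ℝ × ℝ)).NeBot :=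
    NeBot.comap_of_surj inferInstance Prod.fst_surjective
  obtain ⟨μ, hμfin, hμ⟩ := hfam.exists_measure
  have hlim : ∀ β : ℝ → ℝ, IsLimitOfSpectralFunctions p q c α β (distMid μ) := by
    intro β
    have hpair : Tendsto (fun b : ℝ => (b, β b)) atTop (comap Prod.fst atTop) :=
      tendsto_comap_iff.2 tendsto_id
    have hle : ∀ s t, s ≤ t → ContinuousAt (distMid μ) s → ContinuousAt (distMid μ) t →
        Tendsto (fun b => spectralFunction p q c α b (β b) t - spectralFunction p q c α b (β b) s)
          atTop (𝓝 (distMid μ t - distMid μ s)) := by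
      intro s t hst hs ht
      refine ((tendsto_poleSum_indicator hfam.poles hμ hst hs ht).comp hpair).congr' ?_
      filter_upwards [eventually_ge_atTop (c + 1)] with b hb
      simp only [Function.comp, max_eq_left hb]
      exact (spectralFunction_sub h α (β b) (by linarith) hst).symm
    intro s t hs ht
    rcases le_total t s with hts | hst
    · exact hle t s hts ht hs
    · simpa only [neg_sub] using (hle s t hst hs ht).neg
  refine ⟨m, distMid μ, hm, monotone_distMid, fun β _ => hlim β, fun β σ _ hσ hσlim => ?_,
    fun ε hε s t => hfam.intervalIntegrable_im hε t s,
    fun s t => hfam.tendsto_integral_im hμ t s⟩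
  exact exists_const_of_increments_eq monotone_distMid hσ fun s t h1 h2 h3 h4 =>
    tendsto_nhds_unique (hσlim s t h2 h4) (hlim β s t h1 h3)
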